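/- **Setting.** "Efficient" means (uniform) polynomial time in the security parameter $\lambda$ (given as $1^\lambda$), "negligible" means $O(\lambda^{-c})$ for every $c$, and all lengths below are polynomially bounded functions of $\lambda$ such that the unary length is computable in polynomial time. A *secret-key pseudorandom code* (PRC) for $k$-bit messages with codewords of length $n=n(\lambda)$ is a triple of efficient randomized algorithms: $\mathsf{KeyGen}(1^\lambda)$ outputs $\mathsf{sk}$; $\mathsf{Encode}(\mathsf{sk},m;R)\in\{0,1\}^{n}$ for $m\in\{0,1\}^{k(\lambda)}$, with random coins $R\in\{0,1\}^{\rho(\lambda)}$; $\mathsf{Decode}(\mathsf{sk},x)\in\{0,1\}^{k(\lambda)}\cup\{\bot\}$ for $x\in\{0,1\}^*$. It must satisfy *soundness* (for every sequence of strings $c_\lambda$ fixed independently of the key, $\Pr[\mathsf{Decode}(\mathsf{sk},c_\lambda)=\bot]\ge 1-\mathrm{negl}(\lambda)$) and *pseudorandomness* (no efficient adversary distinguishes, with non-negligible advantage, oracle access to $\mathsf{Encode}(\mathsf{sk},\cdot)$ from an oracle that answers every query with a fresh uniform string in $\{0,1\}^{n}$). For $\delta\in\mathbb R$, a string $x$ is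 *$\delta$-close* to $c\in\{0,1\}^n$ if $|x|=n$ and $\mathrm{wt}(x\oplus c)\le\delta n$. *Adaptive $\delta$-robustness.* An efficient adversary queries $\mathsf{Encode}(\mathsf{sk},\cdot)$ adaptively, the pairs $(m,c)$ of queries and answers being recorded in a transcript, and then outputs $x$; it wins if some $(m,c)$ in the transcript has $c$ $\delta$-close to $x$ and $\mathsf{Decode}(\mathsf{sk},x)\ne m$. Every efficient adversary wins with negligible probability only. *$\delta$-ideal security.* In the real game an efficient adversary has oracle access to $\mathsf{Encode}(\mathsf{sk},\cdot)$ and $\mathsf{Decode}(\mathsf{sk},\cdot)$. In the ideal game an encoding query $m$ is answered with a fresh uniform $c\in\{0,1\}^n$, and $(m,c)$ is added to a transcript; a decoding query $x$ is answered with a uniformly random element of the set of those $m$ for which some $(m,c)$ in the transcript has $c$ $\delta$-close to $x$, or with $\bot$ if this set is empty. For every efficient adversary, the probabilities of outputting $1$ in the two games differ by a negligible amount. *The construction.* Let $k$ be a message length, let $\mathsf{PRC}=(\mathsf{KeyGen},\mathsf{Encode},\mathsf{Decode})$ be a PRC for messages of length $k+2\lambda$ with $\rho$ encoding coins and codeword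 length $n$, and let $F$ be an efficiently computable keyed function family from $\{0,1\}^{\lambda+k}$ to $\{0,1\}^{\rho}\times\{0,1\}^{\lambda}$ with an efficient key generator. For $\delta\in\mathbb R$ the code $\mathsf{PRC}^{\sharp}=\mathsf{PRC}^{\sharp}[F,\mathsf{PRC},\delta]$ for $k$-bit messages is defined as follows. * $\mathsf{KeyGen}^\sharp$ samples a key $K$ of $F$ and a key $\mathsf{sk}$ of $\mathsf{PRC}$ independently and outputs $(K,\mathsf{sk})$. * $\mathsf{Encode}^\sharp((K,\mathsf{sk}),m)$ samples $r\leftarrow\{0,1\}^\lambda$, sets $(R_1,R_2)=F_K(r\|m)$ and outputs $\mathsf{Encode}(\mathsf{sk},r\|m\|R_2;R_1)$. * $\mathsf{Decode}^\sharp((K,\mathsf{sk}),x)$ computes $\mathsf{Decode}(\mathsf{sk},x)$ and outputs $\bot$ if this is $\bot$. Otherwise it parses the result as $r\|m\|R_2$, sets $(R_1,\tilde R_2)=F_K(r\|m)$, and outputs $m$ if $\tilde R_2=R_2$ and $x$ is $\delta$-close to $\mathsf{Encode}(\mathsf{sk},r\|m\|R_2;R_1)$; otherwise it outputs $\bot$.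 **Theorem.** Let $\mathsf{PRC}$ be a secret-key PRC for messages of length $k+2\lambda$ that is adaptively $\delta$-robust, where $\delta$ is a real number such that $\lfloor\delta n(\lambda)\rfloor$ (read as $0$ if negative) is computable in time polynomial in $\lambda$ (for example, any rational $\delta$). Let $F$ be a pseudorandom function family, i.e. no efficient distinguisher has non-negligible advantage in telling oracle access to $F_K$, for a random key $K$, from oracle access to a uniformly random function with the same domain and range. Then $\mathsf{PRC}^\sharp[F,\mathsf{PRC},\delta]$ is a secret-key PRC, and it satisfies $\delta$-ideal security. -/

import Mathlib

namespace PRC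

/-! ### Strings, a machine model with a step count, polynomial time -/

/-- Bit strings of length `n`. -/
abbrev Bits (n : ℕ) : Type := Fin n → Bool

/-- The first `a` bits of a string of length `a + b`. -/
def Bits.left {a b : ℕ} (x : Bits (a + b)) : Bits a := fun i => x (Fin.castAdd b i)

/-- The last `b` bits of a string of length `a + b`. -/
def Bits.right {a b : ℕ} (x : Bits (a + b)) : Bits b := fun i => x (Fin.natAdd a i)

/-- Structured programs for a multi-stack machine. Every program mentions finitely many stacks
(indexed by `ℕ`), each of which holds bits. -/
inductive Prog : Type
  | skip : Prog
  | push (r : ℕ) (b : Bool) : Prog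
  | pop (r : ℕ) : Prog
  | seq (p q : Prog) : Prog
  /-- `branch r pt pf pe`: run `pt`, `pf` or `pe` according to whether the top of stack `r` is
  `true`, is `false`, or the stack is empty. -/
  | branch (r : ℕ) (pt pf pe : Prog) : Prog
  /-- `loop r p`: run `p` as long as stack `r` is not empty. -/
  | loop (r : ℕ) (p : Prog) : Prog

/-- Contents of all stacks, with the top of each stack at the head of the list. -/
abbrev Store : Type := ℕ → List Bool

/-- `Prog.Runs p s t s'`: started in `s`, the program `p` halts after exactly `t` steps in `s'`.
Each elementary instruction and each test is one step. -/
inductive Prog.Runs : Prog → Store → ℕ → Store → Prop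
  | skip (s : Store) : Runs .skip s 1 s
  | push (r : ℕ) (b : Bool) (s : Store) :
      Runs (.push r b) s 1 (Function.update s r (b :: s r))
  | pop (r : ℕ) (s : Store) : Runs (.pop r) s 1 (Function.update s r (s r).tail)
  | seq {p q : Prog} {s s' s'' : Store} {t t' : ℕ} :
      Runs p s t s' → Runs q s' t' s'' → Runs (.seq p q) s (t + t') s''
  | branchTrue {r : ℕ} {pt pf pe : Prog} {s s' : Store} {t : ℕ} :
      (s r).head? = some true → Runs pt s t s' → Runs (.branch r pt pf pe) s (t + 1) s'
  | branchFalse {r : ℕ} {pt pf pe : Prog} {s s' : Store} {t : ℕ} :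
      (s r).head? = some false → Runs pf s t s' → Runs (.branch r pt pf pe) s (t + 1) s'
  | branchEmpty {r : ℕ} {pt pf pe : Prog} {s s' : Store} {t : ℕ} :
      s r = [] → Runs pe s t s' → Runs (.branch r pt pf pe) s (t + 1) s'
  | loopDone {r : ℕ} {p : Prog} {s : Store} : s r = [] → Runs (.loop r p) s 1 s
  | loopStep {r : ℕ} {p : Prog} {s s' s'' : Store} {t t' : ℕ} :
      s r ≠ [] → Runs p s t s' → Runs (.loop r p) s' t' s'' →
        Runs (.loop r p) s (t + t' + 1) s''

/-- Self-delimiting encoding of a finite sequence of strings as one string: each bit `b` is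
written as `1b`, and each string is terminated by `0`. -/
def pack (l : List (List Bool)) : List Bool :=
  l.flatMap fun x => (x.flatMap fun b => [true, b]) ++ [false]

/-- The initial store: the input is on stack `0`, all other stacks are empty. -/
def initialStore (input : List Bool) : Store := fun r => if r = 0 then input else []

/-- Some program computes, for every instance `i`, the string `output i` (left on stack `1`) from
the sequence of strings `input i` in time polynomial in the length of the encoded input. -/
def PolyTime {ι : Type} (input : ι → List (List Bool)) (output : ι → List Bool) : Prop :=
  ∃ (p : Prog) (P : Polynomial ℕ), ∀ i : ι, ∃ (t : ℕ) (s : Store),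
    p.Runs (initialStore (pack (input i))) t s ∧ s 1 = output i ∧
      t ≤ P.eval (pack (input i)).length

/-- The string `1^n`. -/
def unary (n : ℕ) : List Bool := List.replicate n true

/-- `1^(ℓ n)` can be computed from `1^n` in time polynomial in `n` (in particular `ℓ` is
polynomially bounded). -/
def PolyLen (ℓ : ℕ → ℕ) : Prop := PolyTime (fun n => [unary n]) (fun n => unary (ℓ n))

/-- Types whose elements are written as bit strings when they are handled by a machine. -/
class BitEncoding (α : Type) where
  enc : α → List Bool

instance (n : ℕ) : BitEncoding (Bits n) := ⟨fun x => List.ofFn x⟩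
instance : BitEncoding (List Bool) := ⟨fun x => x⟩
instance : BitEncoding Bool := ⟨fun b => [b]⟩

instance {α : Type} [BitEncoding α] : BitEncoding (Option α) :=
  ⟨fun x => match x with
    | none => [false]
    | some a => true :: BitEncoding.enc a⟩

instance {α β : Type} [BitEncoding α] [BitEncoding β] : BitEncoding (α ⊕ β) :=
  ⟨fun x => match x with
    | Sum.inl a => false :: BitEncoding.enc a
    | Sum.inr b => true :: BitEncoding.enc b⟩

open BitEncoding (enc)

/-! ### Probability, negligible functions, adversaries -/

/-- The uniform distribution on `{0,1}^n`. -/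
noncomputable def uniformBits (n : ℕ) : PMF (Bits n) := PMF.uniformOfFintype (Bits n)

/-- The probability that an experiment outputs `1`. -/
noncomputable def prob (X : PMF Bool) : ℝ := (X true).toReal

/-- `f(n) = o(n^(-c))` for every `c`. -/
def Negligible (f : ℕ → ℝ) : Prop :=
  Asymptotics.SuperpolynomialDecay Filter.atTop (fun n : ℕ => (n : ℝ)) f

/-- A probabilistic interactive adversary: it makes queries in `Q n`, receives answers in `A n` and
finally outputs an element of `R n`, where `n` is the security parameter. It is given by its
next-query function and its output function, both depending on its random coins and on the
answers received so far (oldest first); `next = none` means that it makes no further query. It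
makes at most `queries n` queries. -/
structure Adversary (Q A R : ℕ → Type) where
  coins : ℕ → ℕ
  queries : ℕ → ℕ
  next : (n : ℕ) → Bits (coins n) → List (A n) → Option (Q n)
  output : (n : ℕ) → Bits (coins n) → List (A n) → R n

/-- What an adversary sees: `1^n`, its coins and the answers so far. -/
def Adversary.view {Q A R : ℕ → Type} [∀ n, BitEncoding (A n)] (𝒜 : Adversary Q A R)
    (i : (n : ℕ) × (Bits (𝒜.coins n) × List (A n))) : List (List Bool) :=
  unary i.1 :: enc i.2.1 :: i.2.2.map enc

/-- Probabilistic polynomial-time adversaries (uniform). -/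
structure Adversary.Efficient {Q A R : ℕ → Type} [∀ n, BitEncoding (Q n)]
    [∀ n, BitEncoding (A n)] [∀ n, BitEncoding (R n)] (𝒜 : Adversary Q A R) : Prop where
  coins : PolyLen 𝒜.coins
  queries : PolyLen 𝒜.queries
  next : PolyTime 𝒜.view (fun i => enc (𝒜.next i.1 i.2.1 i.2.2))
  output : PolyTime 𝒜.view (fun i => enc (𝒜.output i.1 i.2.1 i.2.2))

/-- At most `t` rounds of interaction between a query strategy and a stateful randomized oracle,
continuing from the oracle state `s` and the list `h` of earlier answers. Returns all answers and
the final oracle state. -/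
noncomputable def interact {Q A S : Type} (oracle : S → Q → PMF (A × S))
    (next : List A → Option Q) : ℕ → S → List A → PMF (List A × S)
  | 0, s, h => PMF.pure (h, s)
  | t + 1, s, h =>
    match next h with
    | none => PMF.pure (h, s)
    | some q => (oracle s q).bind fun a => interact oracle next t a.2 (h ++ [a.1])

/-- The adversary's run with an oracle started in state `s₀`: its output and the final state. -/
noncomputable def Adversary.run {Q A R : ℕ → Type} (𝒜 : Adversary Q A R) (n : ℕ) {S : Type}
    (oracle : S → Q n → PMF (A n × S)) (s₀ : S) : PMF (R n × S) :=
  (uniformBits (𝒜.coins n)).bind fun ω =>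
    (interact oracle (𝒜.next n ω) (𝒜.queries n) s₀ []).map fun y =>
      (𝒜.output n ω y.1, y.2)

/-- The output of the adversary with access to a stateless randomized oracle. -/
noncomputable def Adversary.runWith {Q A R : ℕ → Type} (𝒜 : Adversary Q A R) (n : ℕ)
    (oracle : Q n → PMF (A n)) : PMF (R n) :=
  (𝒜.run n (S := Unit) (fun _ q => (oracle q).map fun a => (a, ())) ()).map Prod.fst

/-! ### Pseudorandom functions -/

/-- A keyed function family `{0,1}^(inLen n) → {0,1}^(outLen n)` with a key generator. -/
structure KeyedFunction (inLen outLen : ℕ → ℕ) where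
  keyCoins : ℕ → ℕ
  keyLen : ℕ → ℕ
  keyGen : (n : ℕ) → Bits (keyCoins n) → Bits (keyLen n)
  eval : (n : ℕ) → Bits (keyLen n) → Bits (inLen n) → Bits (outLen n)

namespace KeyedFunction

variable {inLen outLen : ℕ → ℕ}

structure Efficient (F : KeyedFunction inLen outLen) : Prop where
  keyCoins : PolyLen F.keyCoins
  keyLen : PolyLen F.keyLen
  keyGen : PolyTime (fun i : (n : ℕ) × Bits (F.keyCoins n) => [unary i.1, enc i.2])
    (fun i => enc (F.keyGen i.1 i.2))
  eval : PolyTime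
    (fun i : (n : ℕ) × (Bits (F.keyLen n) × Bits (inLen n)) =>
      [unary i.1, enc i.2.1, enc i.2.2])
    (fun i => enc (F.eval i.1 i.2.1 i.2.2))

/-- Distinguishers with oracle access to a function. -/
abbrev Distinguisher (inLen outLen : ℕ → ℕ) : Type :=
  Adversary (fun n => Bits (inLen n)) (fun n => Bits (outLen n)) (fun _ => Bool)

noncomputable def realExp (F : KeyedFunction inLen outLen) (D : Distinguisher inLen outLen)
    (n : ℕ) : PMF Bool :=
  (uniformBits (F.keyCoins n)).bind fun u =>
    D.runWith n fun q => PMF.pure (F.eval n (F.keyGen n u) q)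

/-- The oracle is a uniformly random function. -/
noncomputable def randomExp (D : Distinguisher inLen outLen) (n : ℕ) : PMF Bool :=
  (PMF.uniformOfFintype (Bits (inLen n) → Bits (outLen n))).bind fun f =>
    D.runWith n fun q => PMF.pure (f q)

structure IsPRF (F : KeyedFunction inLen outLen) : Prop where
  efficient : F.Efficient
  pseudorandom : ∀ D : Distinguisher inLen outLen, D.Efficient →
    Negligible fun n => |prob (F.realExp D n) - prob (randomExp D n)|

end KeyedFunction

/-! ### Secret-key codes -/

/-- `c` and `x` have the same length `N`, and `wt(c ⊕ x) ≤ δ N`. -/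
def Close (δ : ℝ) {N : ℕ} (c : Bits N) (x : List Bool) : Prop :=
  x.length = N ∧ ((List.zipWith xor (List.ofFn c) x).count true : ℝ) ≤ δ * N

/-- Syntax of a secret-key code for messages of `k n` bits: randomized algorithms with explicit
random coins (the last argument of each algorithm). The value `none` of `decode` is `⊥`. -/
structure Code (k : ℕ → ℕ) where
  skLen : ℕ → ℕ
  cwLen : ℕ → ℕ
  keyCoins : ℕ → ℕ
  encCoins : ℕ → ℕ
  decCoins : ℕ → ℕ
  keyGen : (n : ℕ) → Bits (keyCoins n) → Bits (skLen n)
  encode : (n : ℕ) → Bits (skLen n) → Bits (k n) → Bits (encCoins n) → Bits (cwLen n)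
  decode : (n : ℕ) → Bits (skLen n) → List Bool → Bits (decCoins n) → Option (Bits (k n))

namespace Code

variable {k : ℕ → ℕ}

/-- All lengths and the three algorithms are polynomial-time computable. -/
structure Efficient (C : Code k) : Prop where
  msgLen : PolyLen k
  skLen : PolyLen C.skLen
  cwLen : PolyLen C.cwLen
  keyCoins : PolyLen C.keyCoins
  encCoins : PolyLen C.encCoins
  decCoins : PolyLen C.decCoins
  keyGen : PolyTime (fun i : (n : ℕ) × Bits (C.keyCoins n) => [unary i.1, enc i.2])
    (fun i => enc (C.keyGen i.1 i.2))
  encode : PolyTime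
    (fun i : (n : ℕ) × (Bits (C.skLen n) × Bits (k n) × Bits (C.encCoins n)) =>
      [unary i.1, enc i.2.1, enc i.2.2.1, enc i.2.2.2])
    (fun i => enc (C.encode i.1 i.2.1 i.2.2.1 i.2.2.2))
  decode : PolyTime
    (fun i : (n : ℕ) × (Bits (C.skLen n) × List Bool × Bits (C.decCoins n)) =>
      [unary i.1, enc i.2.1, enc i.2.2.1, enc i.2.2.2])
    (fun i => enc (C.decode i.1 i.2.1 i.2.2.1 i.2.2.2))

/-- A random key. -/
noncomputable def sampleKey (C : Code k) (n : ℕ) : PMF (Bits (C.skLen n)) :=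
  (uniformBits (C.keyCoins n)).map (C.keyGen n)

/-- Encoding with fresh coins. -/
noncomputable def sampleEncode (C : Code k) (n : ℕ) (sk : Bits (C.skLen n)) (m : Bits (k n)) :
    PMF (Bits (C.cwLen n)) :=
  (uniformBits (C.encCoins n)).map (C.encode n sk m)

/-- Decoding with fresh coins. -/
noncomputable def sampleDecode (C : Code k) (n : ℕ) (sk : Bits (C.skLen n)) (x : List Bool) :
    PMF (Option (Bits (k n))) :=
  (uniformBits (C.decCoins n)).map (C.decode n sk x)

/-- Every string chosen independently of the key decodes to `⊥` with overwhelming probability. -/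
def Sound (C : Code k) : Prop :=
  ∀ c : ℕ → List Bool, Negligible fun n =>
    1 - prob ((C.sampleKey n).bind fun sk => (C.sampleDecode n sk (c n)).map Option.isNone)

/-- Distinguishers with oracle access to an encoder. -/
abbrev EncDistinguisher (C : Code k) : Type :=
  Adversary (fun n => Bits (k n)) (fun n => Bits (C.cwLen n)) (fun _ => Bool)

/-- Encoding queries are indistinguishable from fresh uniform strings. -/
def Pseudorandom (C : Code k) : Prop :=
  ∀ D : C.EncDistinguisher, D.Efficient → Negligible fun n =>
    |prob ((C.sampleKey n).bind fun sk => D.runWith n (C.sampleEncode n sk)) -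
      prob (D.runWith n fun _ => uniformBits (C.cwLen n))|

/-- Secret-key pseudorandom codes; robustness is a separate property. -/
structure IsPRC (C : Code k) : Prop where
  efficient : C.Efficient
  sound : C.Sound
  pseudorandom : C.Pseudorandom

/-- The set of pairs (message, codeword) of the encoding queries so far. -/
abbrev Transcript (C : Code k) (n : ℕ) : Type := Finset (Bits (k n) × Bits (C.cwLen n))

/-! Adaptive robustness -/

/-- Adversaries that make encoding queries and output a string. -/
abbrev RobustAdversary (C : Code k) : Type :=
  Adversary (fun n => Bits (k n)) (fun n => Bits (C.cwLen n)) (fun _ => List Bool)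

open Classical in
/-- The robustness game: it outputs `true` if the adversary wins. -/
noncomputable def robustGame (C : Code k) (δ : ℝ) (𝒜 : C.RobustAdversary) (n : ℕ) :
    PMF Bool :=
  (C.sampleKey n).bind fun sk =>
    (𝒜.run n (S := C.Transcript n)
      (fun T m => (C.sampleEncode n sk m).map fun c => (c, insert (m, c) T)) ∅).bind fun y =>
        (C.sampleDecode n sk y.1).map fun m' =>
          decide (∃ e ∈ y.2, Close δ e.2 y.1 ∧ m' ≠ some e.1)

def AdaptivelyRobust (C : Code k) (δ : ℝ) : Prop :=
  ∀ 𝒜 : C.RobustAdversary, 𝒜.Efficient → Negligible fun n => prob (C.robustGame δ 𝒜 n)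

/-! Ideal security -/

/-- Adversaries that make encoding queries (`Sum.inl m`) and decoding queries (`Sum.inr x`) and
output a bit. -/
abbrev IdealAdversary (C : Code k) : Type :=
  Adversary (fun n => Bits (k n) ⊕ List Bool)
    (fun n => Bits (C.cwLen n) ⊕ Option (Bits (k n))) (fun _ => Bool)

noncomputable def realGame (C : Code k) (𝒜 : C.IdealAdversary) (n : ℕ) : PMF Bool :=
  (C.sampleKey n).bind fun sk => 𝒜.runWith n fun q =>
    match q with
    | Sum.inl m => (C.sampleEncode n sk m).map Sum.inl
    | Sum.inr x => (C.sampleDecode n sk x).map Sum.inr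

open Classical in
/-- The messages of the transcript whose codewords are close to `x`. -/
noncomputable def candidates (C : Code k) (δ : ℝ) {n : ℕ} (T : C.Transcript n) (x : List Bool) :
    Finset (Bits (k n)) :=
  (T.filter fun e => Close δ e.2 x).image Prod.fst

open Classical in
/-- The ideal decoder: a uniformly random candidate, or `⊥` if there is none. -/
noncomputable def idealDecode (C : Code k) (δ : ℝ) {n : ℕ} (T : C.Transcript n)
    (x : List Bool) : PMF (Option (Bits (k n))) :=
  if h : (C.candidates δ T x).Nonempty then
    (PMF.uniformOfFinset (C.candidates δ T x) h).map some
  else PMF.pure none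

noncomputable def idealOracle (C : Code k) (δ : ℝ) (n : ℕ) (T : C.Transcript n)
    (q : Bits (k n) ⊕ List Bool) :
    PMF ((Bits (C.cwLen n) ⊕ Option (Bits (k n))) × C.Transcript n) :=
  match q with
  | Sum.inl m => (uniformBits (C.cwLen n)).map fun c => (Sum.inl c, insert (m, c) T)
  | Sum.inr x => (C.idealDecode δ T x).map fun a => (Sum.inr a, T)

noncomputable def idealGame (C : Code k) (δ : ℝ) (𝒜 : C.IdealAdversary) (n : ℕ) : PMF Bool :=
  (𝒜.run n (C.idealOracle δ n) ∅).map Prod.fst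

def IdealSecure (C : Code k) (δ : ℝ) : Prop :=
  ∀ 𝒜 : C.IdealAdversary, 𝒜.Efficient → Negligible fun n =>
    |prob (C.realGame 𝒜 n) - prob (C.idealGame δ 𝒜 n)|

/-! The transformation -/

open Classical in
/-- The code that encodes `m` as `Encode(sk, r‖m‖R₂; R₁)` with `(R₁, R₂) = F(r‖m)`, and whose
decoder re-encodes and accepts only strings within distance `δ` of the re-encoded codeword. -/
noncomputable def sharp (C : Code fun n => n + k n + n)
    (F : KeyedFunction (fun n => n + k n) (fun n => C.encCoins n + n)) (δ : ℝ) : Code k where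
  skLen n := F.keyLen n + C.skLen n
  cwLen n := C.cwLen n
  keyCoins n := F.keyCoins n + C.keyCoins n
  encCoins n := n
  decCoins n := C.decCoins n
  keyGen n u := Fin.append (F.keyGen n u.left) (C.keyGen n u.right)
  encode n sk m r :=
    let R := F.eval n sk.left (Fin.append r m)
    C.encode n sk.right (Fin.append (Fin.append r m) R.right) R.left
  decode n sk x w :=
    match C.decode n sk.right x w with
    | none => none
    | some M =>
      let rm : Bits (n + k n) := Bits.left M
      let R := F.eval n sk.left rm
      if R.right = Bits.right M ∧ Close δ (C.encode n sk.right M R.left) x then some rm.right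
      else none

end Code

end PRC

namespace PRC

open BitEncoding (enc)

/-! ### Polynomial bounds -/

/-! For every efficient adversary, the probability of output 1 in the real game is at most that in
the ideal game plus a negligible term (`prob_realGame_le`). Applied to the adversary with
complemented output, the same bound gives the reverse inequality, so every hop below may be
one-sided.

Four hops lead from the real to the ideal game; let q bound the number of queries. (1) The keyed
function becomes a uniformly random function f, at the cost of a PRF advantage. (2) f is sampled
lazily (`expect_functionOracle_le`). While nonces are new, each encoding has fresh coins and a fresh
tag. A decoded message whose point r‖m no encoding has used is accepted only if its tag equals a
value of f that has never been revealed. Up to O(q²)/2^n, the decoder therefore accepts only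
messages that were really encoded, and only near a codeword logged for them. (3) Decoding becomes a
lookup in the log of encodings (`ival_freshOracle_le`). The two agree on x unless the underlying
decoder misses a logged message whose codeword is close to x; the probability of this is the loss of
x. If codewords of two different messages are close to x, the loss is 1, since no decoder returns
both; such a conflict raises a flag, and flagged runs count as 0. Losses are charged to adaptive
robustness: the lookup game needs only an encoding oracle, so an adversary can simulate it and
submit a randomly guessed query. The guess costs a factor 2^ℓ ≤ 2q + 1 (`expect_totalLoss_le`). (4)
The key now serves only for encoding, so pseudorandomness replaces codewords by uniform strings.
Without conflicts the ideal decoder has at most one candidate, the one found by the lookup; with a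
conflict the value counted is 0. Hence the lookup game lies below the ideal game, and the
probability of conflicts need not be bounded (`ival_logOracle_le_idealOracle`).

Pseudorandomness of the new code is ideal security for adversaries without decoding queries.
Soundness is inherited because the new decoder only rejects more.

The hops are inequalities between expectations over interactions (`ival`), mostly proved by
induction on the number of remaining queries. The reductions must also run in polynomial time on the
stack machine: `FP` is a calculus of polynomial-time string functions closed under composition,
pairing, branching and bounded iteration, and `Simulator` describes reductions that make exactly one
oracle call per simulated query. -/

theorem _root_.Polynomial.eval_nat_mono (P : Polynomial ℕ) : Monotone fun n : ℕ => P.eval n := by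
  intro a b h
  induction P using Polynomial.induction_on' with
  | add p q hp hq => simpa using add_le_add hp hq
  | monomial n c => simpa using Nat.mul_le_mul_left c (Nat.pow_le_pow_left h n)

/-- `f` is bounded by a polynomial in `L`. -/
def PolyBdd {ι : Type} (L f : ι → ℕ) : Prop := ∃ P : Polynomial ℕ, ∀ i, f i ≤ P.eval (L i)

namespace PolyBdd

variable {ι κ : Type} {L f g : ι → ℕ}

theorem const (c : ℕ) : PolyBdd L fun _ => c := ⟨Polynomial.C c, fun i => by simp⟩

theorem self : PolyBdd L L := ⟨Polynomial.X, fun i => by simp⟩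

theorem mono (h : PolyBdd L g) (hfg : ∀ i, f i ≤ g i) : PolyBdd L f :=
  let ⟨P, hP⟩ := h
  ⟨P, fun i => (hfg i).trans (hP i)⟩

theorem add (hf : PolyBdd L f) (hg : PolyBdd L g) : PolyBdd L fun i => f i + g i :=
  let ⟨P, hP⟩ := hf
  let ⟨Q, hQ⟩ := hg
  ⟨P + Q, fun i => by simpa using add_le_add (hP i) (hQ i)⟩

theorem mul (hf : PolyBdd L f) (hg : PolyBdd L g) : PolyBdd L fun i => f i * g i :=
  let ⟨P, hP⟩ := hf
  let ⟨Q, hQ⟩ := hg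
  ⟨P * Q, fun i => by simpa using Nat.mul_le_mul (hP i) (hQ i)⟩

/-- Bounds compose because polynomials with coefficients in `ℕ` are monotone; this is the reason for
working over `ℕ`. -/
theorem trans (hf : PolyBdd L f) (hg : PolyBdd f g) : PolyBdd L g :=
  let ⟨P, hP⟩ := hf
  let ⟨Q, hQ⟩ := hg
  ⟨Q.comp P, fun i => by
    simpa [Polynomial.eval_comp] using (hQ i).trans (Q.eval_nat_mono (hP i))⟩

theorem eval (P : Polynomial ℕ) (hf : PolyBdd L f) : PolyBdd L fun i => P.eval (f i) :=
  hf.trans ⟨P, fun _ => le_rfl⟩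

theorem reindex (h : PolyBdd L f) (φ : κ → ι) : PolyBdd (fun a => L (φ a)) fun a => f (φ a) :=
  let ⟨P, hP⟩ := h
  ⟨P, fun a => hP (φ a)⟩

end PolyBdd

/-! ### Running programs with a time bound -/

namespace Prog

/-- `p` turns the store `s` into `s'` in at most `T` steps. -/
def Exec (p : Prog) (s : Store) (T : ℕ) (s' : Store) : Prop := ∃ t ≤ T, p.Runs s t s'

namespace Exec

variable {p q : Prog} {s s' s'' : Store} {T T' : ℕ}

theorem mono (h : Exec p s T s') (hT : T ≤ T') : Exec p s T' s' :=
  let ⟨t, ht, hr⟩ := h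
  ⟨t, ht.trans hT, hr⟩

theorem seq (h : Exec p s T s') (h' : Exec q s' T' s'') : Exec (.seq p q) s (T + T') s'' :=
  let ⟨_, ht, hr⟩ := h
  let ⟨_, ht', hr'⟩ := h'
  ⟨_, add_le_add ht ht', .seq hr hr'⟩

theorem skip : Exec .skip s 1 s := ⟨1, le_rfl, .skip s⟩

theorem push (r : ℕ) (b : Bool) : Exec (.push r b) s 1 (Function.update s r (b :: s r)) :=
  ⟨1, le_rfl, .push r b s⟩

theorem pop (r : ℕ) : Exec (.pop r) s 1 (Function.update s r (s r).tail) :=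
  ⟨1, le_rfl, .pop r s⟩

theorem branchTrue {r : ℕ} {pt pf pe : Prog} (hr : (s r).head? = some true)
    (h : Exec pt s T s') : Exec (.branch r pt pf pe) s (T + 1) s' :=
  let ⟨t, ht, hh⟩ := h
  ⟨t + 1, by omega, .branchTrue hr hh⟩

theorem branchFalse {r : ℕ} {pt pf pe : Prog} (hr : (s r).head? = some false)
    (h : Exec pf s T s') : Exec (.branch r pt pf pe) s (T + 1) s' :=
  let ⟨t, ht, hh⟩ := h
  ⟨t + 1, by omega, .branchFalse hr hh⟩

theorem branchEmpty {r : ℕ} {pt pf pe : Prog} (hr : s r = [])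
    (h : Exec pe s T s') : Exec (.branch r pt pf pe) s (T + 1) s' :=
  let ⟨t, ht, hh⟩ := h
  ⟨t + 1, by omega, .branchEmpty hr hh⟩

theorem loopDone {r : ℕ} (hr : s r = []) : Exec (.loop r p) s 1 s :=
  ⟨1, le_rfl, .loopDone hr⟩

theorem loopStep {r : ℕ} (hr : s r ≠ []) (h : Exec p s T s') (h' : Exec (.loop r p) s' T' s'') :
    Exec (.loop r p) s (T + T' + 1) s'' :=
  let ⟨t, ht, hh⟩ := h
  let ⟨t', ht', hh'⟩ := h'
  ⟨t + t' + 1, by omega, .loopStep hr hh hh'⟩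

end Exec

/-- The store with the given contents of the first stacks. -/
def stk (l : List (List Bool)) : Store := fun r => l.getD r []

theorem initialStore_eq (w : List Bool) : initialStore w = stk [w] := by
  funext r
  rcases r with _ | r <;> simp [initialStore, stk]

/-- Move all stack indices up by `k`. -/
def shift (k : ℕ) : Prog → Prog
  | .skip => .skip
  | .push r b => .push (r + k) b
  | .pop r => .pop (r + k)
  | .seq p q => .seq (p.shift k) (q.shift k)
  | .branch r pt pf pe => .branch (r + k) (pt.shift k) (pf.shift k) (pe.shift k)
  | .loop r p => .loop (r + k) (p.shift k)

/-- The first `k` stacks of `S`, followed by those of `s`. -/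
def join (k : ℕ) (S s : Store) : Store := fun r => if r < k then S r else s (r - k)

theorem join_add (k : ℕ) (S s : Store) (r : ℕ) : join k S s (r + k) = s r := by
  simp [join]

theorem join_update (k : ℕ) (S s : Store) (r : ℕ) (v : List Bool) :
    join k S (Function.update s r v) = Function.update (join k S s) (r + k) v := by
  funext x
  by_cases hx : x < k
  · have : x ≠ r + k := by omega
    simp [join, hx, Function.update_of_ne this]
  · obtain ⟨y, rfl⟩ : ∃ y, x = y + k := ⟨x - k, by omega⟩
    rw [join_add]
    by_cases hy : y = r
    · simp [hy]
    · have : y + k ≠ r + k := by omega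
      rw [Function.update_of_ne hy, Function.update_of_ne this, join_add]

/-- A frame rule: a shifted program never touches the lowest `k` stacks, so other data can be kept
there while it runs as a subroutine. -/
theorem Runs.shift {p : Prog} {s s' : Store} {t : ℕ} (h : p.Runs s t s') (k : ℕ) (S : Store) :
    (p.shift k).Runs (join k S s) t (join k S s') := by
  induction h with
  | skip s => exact .skip _
  | push r b s => rw [join_update]; simpa [Prog.shift, join_add] using Runs.push (r + k) b (join k S s)
  | pop r s => rw [join_update]; simpa [Prog.shift, join_add] using Runs.pop (r + k) (join k S s)
  | seq _ _ h1 h2 => exact .seq h1 h2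
  | branchTrue hr _ h => exact .branchTrue (by rwa [join_add]) h
  | branchFalse hr _ h => exact .branchFalse (by rwa [join_add]) h
  | branchEmpty hr _ h => exact .branchEmpty (by rwa [join_add]) h
  | loopDone hr => exact .loopDone (by rwa [join_add])
  | loopStep hr _ _ h1 h2 => exact .loopStep (by rwa [join_add]) h1 h2

theorem join_stk (l l' : List (List Bool)) : join l.length (stk l) (stk l') = stk (l ++ l') := by
  funext r
  simp only [join, stk, List.getD_eq_getElem?_getD]
  split_ifs with h
  · rw [List.getElem?_append_left h]
  · rw [List.getElem?_append_right (by omega)]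

theorem Exec.shift {p : Prog} {w w' : List Bool} {T : ℕ} (h : p.Exec (stk [w]) T (stk [w']))
    (l : List (List Bool)) : (p.shift l.length).Exec (stk (l ++ [w])) T (stk (l ++ [w'])) :=
  let ⟨t, ht, hr⟩ := h
  ⟨t, ht, by simpa only [join_stk] using hr.shift l.length (stk l)⟩

/-! ### Basic programs -/

/-- Empty stack `r`. -/
def clear (r : ℕ) : Prog := .loop r (.pop r)

theorem exec_clear (r : ℕ) (s : Store) :
    (clear r).Exec s (2 * (s r).length + 1) (Function.update s r []) := by
  generalize hl : (s r).length = n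
  induction n generalizing s with
  | zero =>
    have h : s r = [] := List.length_eq_zero_iff.1 hl
    have : Function.update s r [] = s := by rw [← h]; simp
    rw [this]
    exact (Exec.loopDone h).mono (by omega)
  | succ n ih =>
    have h : s r ≠ [] := by intro h; simp [h] at hl
    have := ih (Function.update s r (s r).tail) (by simp [hl])
    rw [Function.update_idem] at this
    exact (Exec.loopStep h (Exec.pop r) this).mono (by omega)

/-- Run `f b` for every bit `b` of stack `r`, popping it. -/
def forEach (r : ℕ) (f : Bool → Prog) : Prog :=
  .loop r (.branch r (.seq (.pop r) (f true)) (.seq (.pop r) (f false)) .skip)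

/-- Here `st w a` is the loop invariant: `w` is still to be read on stack `r` and `a` is the value
accumulated so far. Each bit costs `c` steps plus the loop test, the branch test and the pop. -/
theorem exec_forEach {β : Type} {r : ℕ} {f : Bool → Prog} {c : ℕ} (st : List Bool → β → Store)
    (g : β → Bool → β) (hst : ∀ w a, st w a r = w)
    (h : ∀ b w a, (f b).Exec (Function.update (st (b :: w) a) r w) c (st w (g a b)))
    (w : List Bool) (a : β) :
    (forEach r f).Exec (st w a) ((c + 3) * w.length + 1) (st [] (w.foldl g a)) := by
  induction w generalizing a with
  | nil => exact (Exec.loopDone (hst _ _)).mono (by simp)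
  | cons b w ih =>
    have hne : st (b :: w) a r ≠ [] := by simp [hst]
    have hpop := Exec.pop r (s := st (b :: w) a)
    rw [hst, List.tail_cons] at hpop
    have hb : (Prog.branch r (.seq (.pop r) (f true)) (.seq (.pop r) (f false)) .skip).Exec
        (st (b :: w) a) (1 + c + 1) (st w (g a b)) := by
      cases b with
      | true => exact Exec.branchTrue (by simp [hst]) (hpop.seq (h _ _ _))
      | false => exact Exec.branchFalse (by simp [hst]) (hpop.seq (h _ _ _))
    exact (Exec.loopStep hne hb (ih _)).mono (by rw [List.length_cons]; ring_nf; omega)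

theorem _root_.List.foldl_flip_cons {α : Type} (w v : List α) :
    w.foldl (fun l b => b :: l) v = w.reverse ++ v := by
  induction w generalizing v with
  | nil => rfl
  | cons x w ih => simp [ih]

/-- Move the contents of stack `a` to stack `b`, reversing it. -/
def move (a b : ℕ) : Prog := forEach a fun x => .push b x

theorem exec_move {a b : ℕ} (hab : a ≠ b) (s : Store) :
    (move a b).Exec s (4 * (s a).length + 1)
      (Function.update (Function.update s a []) b ((s a).reverse ++ s b)) := by
  have := exec_forEach (r := a) (f := fun x => .push b x) (c := 1)
    (fun w v => Function.update (Function.update s a w) b v) (fun l b => b :: l)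
    (fun w v => by simp [Function.update_of_ne hab])
    (fun x w v => by
      convert Exec.push b x using 1
      funext r
      by_cases ha : r = a
      · subst ha; simp [Function.update, hab]
      · by_cases hb : r = b
        · subst hb; simp [Function.update, ha]
        · simp [Function.update, ha, hb]) (s a) (s b)
  simpa [move, List.foldl_flip_cons] using this

/-- The list of stacks after stack `r` has been set to `v`. -/
def put : List (List Bool) → ℕ → List Bool → List (List Bool)
  | [], 0, v => [v]
  | _ :: l, 0, v => v :: l
  | [], r + 1, v => [] :: put [] r v
  | a :: l, r + 1, v => a :: put l r v

theorem stk_put (l : List (List Bool)) (r : ℕ) (v : List Bool) :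
    Function.update (stk l) r v = stk (put l r v) := by
  funext x
  induction l generalizing r x with
  | nil =>
    induction r generalizing x with
    | zero => rcases x with _ | x <;> simp [stk, put]
    | succ r ih =>
      rcases x with _ | x
      · simp [stk, put]
      · have := ih x
        simp only [Function.update_apply, stk, put, List.getD_cons_succ, Nat.succ_inj] at this ⊢
        rw [← this]
        simp
  | cons a l ih =>
    rcases r with _ | r <;> rcases x with _ | x <;> simp [stk, put]
    have := ih r x
    simp only [Function.update_apply, stk, Nat.succ_inj, List.getD_cons_succ] at this ⊢
    simpa using this

/-- Lists of stacks that differ by trailing empty entries describe the same store. This allows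
intermediate stores to be trimmed to a normal form between subroutines. -/
theorem stk_append_nil (l : List (List Bool)) : stk (l ++ [[]]) = stk l := by
  funext r
  simp only [stk, List.getD_eq_getElem?_getD, List.getElem?_append]
  split_ifs with h
  · rfl
  · rcases h' : r - l.length with _ | n <;> simp [h]

theorem exec_move_stk {a b : ℕ} (hab : a ≠ b) (l : List (List Bool)) :
    (move a b).Exec (stk l) (4 * (l.getD a []).length + 1)
      (stk (put (put l a []) b ((l.getD a []).reverse ++ l.getD b []))) := by
  have := exec_move hab (stk l)
  simp only [stk_put] at this
  exact this

theorem exec_push_stk (r : ℕ) (b : Bool) (l : List (List Bool)) :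
    (push r b).Exec (stk l) 1 (stk (put l r (b :: l.getD r []))) := by
  have := Exec.push r b (s := stk l)
  rwa [stk_put] at this

theorem exec_pop_stk (r : ℕ) (l : List (List Bool)) :
    (pop r).Exec (stk l) 1 (stk (put l r (l.getD r []).tail)) := by
  have := Exec.pop r (s := stk l)
  rwa [stk_put] at this

theorem exec_clear_stk (r : ℕ) (l : List (List Bool)) :
    (clear r).Exec (stk l) (2 * (l.getD r []).length + 1) (stk (put l r [])) := by
  have := exec_clear r (stk l)
  rwa [stk_put] at this

/-- Copy stack `0` to stacks `1` and `2`, reversing it. -/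
theorem exec_copy (x : List Bool) :
    (forEach 0 fun b => .seq (.push 1 b) (.push 2 b)).Exec (stk [x]) (5 * x.length + 1)
      (stk [[], x.reverse, x.reverse]) := by
  have := exec_forEach (r := 0) (f := fun b => .seq (.push 1 b) (.push 2 b)) (c := 2)
    (fun w v => stk [w, v, v]) (fun l b => b :: l) (fun w v => rfl)
    (fun b w v => by
      convert (Exec.push 1 b).seq (Exec.push 2 b) using 1
      funext r
      rcases r with _ | _ | _ | r <;> simp [stk, Function.update]) x []
  rw [List.foldl_flip_cons, List.append_nil] at this
  convert this using 1
  funext r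
  rcases r with _ | _ | _ | r <;> simp [stk]

end Prog

end PRC

/-! ### Polynomial-time string functions: the class `FP` and its relation to `PolyTime`. -/

namespace PRC

open BitEncoding (enc)

namespace Prog

/-- One step pushes at most one bit, so running time bounds the growth of every stack. This makes
time bounds compose and bounds the cost of cleaning up. -/
theorem Runs.length_le {p : Prog} {s s' : Store} {t : ℕ} (h : p.Runs s t s') (r : ℕ) :
    (s' r).length ≤ (s r).length + t := by
  induction h with
  | skip s => omega
  | push x b s => by_cases hr : r = x <;> [subst hr; skip] <;> simp [*]
  | pop x s => by_cases hr : r = x <;> [subst hr; skip] <;> simp [*]; omega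
  | seq _ _ h1 h2 => omega
  | branchTrue _ _ h => omega
  | branchFalse _ _ h => omega
  | branchEmpty _ _ h => omega
  | loopDone _ => omega
  | loopStep _ _ _ h1 h2 => omega

theorem stk_trim₁ (a : List Bool) : stk [a, []] = stk [a] := stk_append_nil [a]

theorem stk_trim₂ (a : List Bool) : stk [a, [], []] = stk [a] :=
  (stk_append_nil [a, []]).trans (stk_trim₁ a)

/-- All stacks that occur in a program have an index below `width`. -/
def width : Prog → ℕ
  | .skip => 0
  | .push r _ => r + 1
  | .pop r => r + 1
  | .seq p q => max p.width q.width
  | .branch r pt pf pe => max (r + 1) (max pt.width (max pf.width pe.width))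
  | .loop r p => max (r + 1) p.width

/-- Only stacks below `width` can hold garbage after a run, so one fixed program can clean up. -/
theorem Runs.eq_of_width_le {p : Prog} {s s' : Store} {t : ℕ} (h : p.Runs s t s') {r : ℕ}
    (hr : p.width ≤ r) : s' r = s r := by
  induction h with
  | skip s => rfl
  | push x b s => simp only [width] at hr; rw [Function.update_of_ne (by omega)]
  | pop x s => simp only [width] at hr; rw [Function.update_of_ne (by omega)]
  | seq _ _ h1 h2 => simp only [width, max_le_iff] at hr; rw [h2 hr.2, h1 hr.1]
  | branchTrue _ _ h => simp only [width, max_le_iff] at hr; exact h hr.2.1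
  | branchFalse _ _ h => simp only [width, max_le_iff] at hr; exact h hr.2.2.1
  | branchEmpty _ _ h => simp only [width, max_le_iff] at hr; exact h hr.2.2.2
  | loopDone _ => rfl
  | loopStep _ _ _ h1 h2 =>
    have hr' := hr
    simp only [width, max_le_iff] at hr
    rw [h2 hr', h1 hr.2]

/-- Empty all stacks with an index below `k`, except stack `1`. -/
def clearBelow : ℕ → Prog
  | 0 => .skip
  | k + 1 => .seq (clearBelow k) (if k = 1 then .skip else clear k)

theorem exec_clearBelow (k : ℕ) (s : Store) {M : ℕ} (hM : ∀ r, (s r).length ≤ M) :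
    (clearBelow k).Exec s (k * (2 * M + 1) + 1)
      (fun r => if r < k ∧ r ≠ 1 then [] else s r) := by
  induction k with
  | zero => simpa [clearBelow] using Exec.skip
  | succ k ih =>
    by_cases hk : k = 1
    · subst hk
      simp only [clearBelow, if_true]
      have := ih.seq Exec.skip
      refine (congrArg (Exec _ _ _) ?_).mp (this.mono (T' := (1 + 1) * (2 * M + 1) + 1) (by omega))
      funext r
      congr 1
      ext
      omega
    · simp only [clearBelow, hk, if_false]
      have := ih.seq (exec_clear k _)
      have hl : (if k < k ∧ k ≠ 1 then [] else s k).length ≤ M := by simpa using hM k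
      refine (congrArg (Exec _ _ _) ?_).mp (this.mono (T' := (k + 1) * (2 * M + 1) + 1) ?_)
      · funext r
        by_cases hr : r = k
        · subst hr; simp [hk]
        · rw [Function.update_of_ne hr]
          congr 1
          ext
          omega
      · rw [add_mul]; omega

end Prog

open Prog

/-- `y` can be computed from `x` in polynomial time, by a program that replaces `x i` by `y i` on
stack `0` and leaves all other stacks empty. -/
def FP {ι : Type} (x y : ι → List Bool) : Prop :=
  ∃ (p : Prog) (P : Polynomial ℕ), ∀ i, p.Exec (stk [x i]) (P.eval (x i).length) (stk [y i])

namespace FP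

variable {ι κ : Type} {x y z w : ι → List Bool}

theorem of (p : Prog) {T : ι → ℕ} (hT : PolyBdd (fun i => (x i).length) T)
    (h : ∀ i, p.Exec (stk [x i]) (T i) (stk [y i])) : FP x y :=
  let ⟨P, hP⟩ := hT
  ⟨p, P, fun i => (h i).mono (hP i)⟩

theorem length (h : FP x y) : PolyBdd (fun i => (x i).length) fun i => (y i).length :=
  let ⟨_, P, hP⟩ := h
  ⟨Polynomial.X + P, fun i => by
    obtain ⟨t, ht, hr⟩ := hP i
    have := hr.length_le 0
    simp only [stk, List.getD_cons_zero] at this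
    simp only [Polynomial.eval_add, Polynomial.eval_X]
    omega⟩

theorem congr (h : FP x y) (hyz : ∀ i, y i = z i) : FP x z := by rwa [← funext hyz]

theorem id : FP x x := of .skip (PolyBdd.const 1) fun _ => Exec.skip

theorem comp (h : FP x y) (h' : FP y z) : FP x z := by
  have hl := h.length
  obtain ⟨p, P, hP⟩ := h
  obtain ⟨q, Q, hQ⟩ := h'
  exact of (.seq p q) ((PolyBdd.self.eval P).add (hl.eval Q)) fun i => (hP i).seq (hQ i)

theorem reindex (h : FP x y) (φ : κ → ι) : FP (fun a => x (φ a)) fun a => y (φ a) :=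
  let ⟨p, P, hP⟩ := h
  ⟨p, P, fun a => hP (φ a)⟩

/-- `PolyTime` leaves the result on stack `1` with garbage elsewhere, which does not compose. The
program is followed by clearing every stack it mentions except `1` and moving the result to stack
`0`. The detour over stack `2` makes the two reversals cancel. -/
theorem of_polyTime {input : ι → List (List Bool)} (h : PolyTime input y) :
    FP (fun i => pack (input i)) y := by
  obtain ⟨p, P, hP⟩ := h
  have hl : PolyBdd (fun i => (pack (input i)).length)
      fun i => (pack (input i)).length + P.eval (pack (input i)).length :=
    PolyBdd.self.add (PolyBdd.self.eval P)
  refine of (.seq p (.seq (clearBelow (p.width + 1)) (.seq (move 1 2) (move 2 0))))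
    (T := fun i => P.eval (pack (input i)).length + (((p.width + 1) *
      (2 * ((pack (input i)).length + P.eval (pack (input i)).length) + 1) + 1) +
      ((4 * ((pack (input i)).length + P.eval (pack (input i)).length) + 1) +
        (4 * ((pack (input i)).length + P.eval (pack (input i)).length) + 1)))) ?_ ?_
  · exact (PolyBdd.self.eval P).add
      ((((PolyBdd.const _).mul (((PolyBdd.const _).mul hl).add (.const _))).add (.const _)).add
        ((((PolyBdd.const _).mul hl).add (.const _)).add (((PolyBdd.const _).mul hl).add (.const _))))
  · intro i
    obtain ⟨t, s, hr, hs, ht⟩ := hP i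
    have hM : ∀ r, (s r).length ≤ (pack (input i)).length + P.eval (pack (input i)).length := by
      intro r
      refine (hr.length_le r).trans (add_le_add ?_ ht)
      rcases r with _ | r <;> simp [initialStore]
    rw [initialStore_eq] at hr
    have h0 : ∀ r, r ≠ 1 → (if r < p.width + 1 ∧ r ≠ 1 then [] else s r) = [] := by
      intro r hr1
      by_cases hw : r < p.width + 1
      · simp [hw, hr1]
      · simp only [hw, false_and, if_false]
        rw [hr.eq_of_width_le (by omega)]
        rcases r with _ | r
        · omega
        · simp [stk]
    have e : (fun r => if r < p.width + 1 ∧ r ≠ 1 then [] else s r) = stk [[], y i] := by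
      funext r
      rcases r with _ | _ | r
      · rw [h0 0 (by omega)]; rfl
      · simp [stk, hs]
      · rw [h0 _ (by omega)]; simp [stk]
    have hy := hM 1
    rw [hs] at hy
    refine Exec.seq ⟨t, ht, hr⟩ (Exec.seq (exec_clearBelow _ s hM) ?_)
    rw [e]
    have h1 := exec_move_stk (a := 1) (b := 2) (by decide) [[], y i]
    have h2 := exec_move_stk (a := 2) (b := 0) (by decide) [[], [], (y i).reverse]
    simp only [put, List.getD_cons_succ, List.getD_cons_zero, List.reverse_reverse,
      List.append_nil, List.length_reverse, List.getD_nil, stk_trim₂] at h1 h2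
    exact (h1.mono (by omega)).seq (h2.mono (by omega))

theorem polyTime {input : ι → List (List Bool)} (h : FP (fun i => pack (input i)) y) :
    PolyTime input y := by
  obtain ⟨p, P, hP⟩ := h
  refine ⟨.seq p (.seq (move 0 2) (move 2 1)), ?_⟩
  have hl := FP.length ⟨p, P, hP⟩
  obtain ⟨Q, hQ⟩ := (PolyBdd.self.eval P).add
    ((((PolyBdd.const 4).mul hl).add (.const 1)).add (((PolyBdd.const 4).mul hl).add (.const 1)))
  refine ⟨Q, fun i => ?_⟩
  have h1 := exec_move_stk (a := 0) (b := 2) (by decide) [y i]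
  have h2 := exec_move_stk (a := 2) (b := 1) (by decide) [[], [], (y i).reverse]
  simp only [put, List.getD_cons_succ, List.getD_cons_zero, List.reverse_reverse,
    List.append_nil, List.length_reverse, List.getD_nil] at h1 h2
  obtain ⟨t, ht, hr⟩ := (hP i).seq (h1.seq h2)
  exact ⟨t, _, by rwa [initialStore_eq], by simp [stk], ht.trans (hQ i)⟩

/-- Pairing of strings: the encoding of a sequence with the first entry `a`, where `b` encodes the
rest of the sequence. -/
def _root_.PRC.pc (a b : List Bool) : List Bool := (a.flatMap fun b => [true, b]) ++ false :: b

theorem _root_.PRC.pack_nil : pack [] = [] := rfl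

theorem _root_.PRC.pack_cons (a : List Bool) (l : List (List Bool)) : pack (a :: l) = pc a (pack l) := by
  simp [pack, pc]

theorem _root_.PRC.pack_append (l l' : List (List Bool)) : pack (l ++ l') = pack l ++ pack l' := by
  simp [pack]

theorem _root_.PRC.length_pc (a b : List Bool) : (pc a b).length = 2 * a.length + b.length + 1 := by
  simp [pc, List.length_flatMap]; omega

theorem nil : FP x fun _ => [] := by
  refine of (clear 0) (((PolyBdd.const 2).mul .self).add (.const 1)) fun i => ?_
  simpa [put] using exec_clear_stk 0 [x i]

theorem cons (h : FP x y) (b : Bool) : FP x fun i => b :: y i :=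
  h.comp (of (.push 0 b) (.const 1) fun i => by simpa [put] using exec_push_stk 0 b [y i])

theorem tail (h : FP x y) : FP x fun i => (y i).tail :=
  h.comp (of (.pop 0) (.const 1) fun i => by simpa [put] using exec_pop_stk 0 [y i])

theorem const (v : List Bool) : FP x fun _ => v := by
  induction v with
  | nil => exact nil
  | cons b v ih => exact ih.cons b

theorem reverse (h : FP x y) : FP x fun i => (y i).reverse := by
  -- Each move reverses the string, so an odd number of moves is needed; three return it to stack
  -- `0`.
  refine h.comp (of (.seq (move 0 1) (.seq (move 1 2) (move 2 0)))
    (T := fun i => (4 * (y i).length + 1) + ((4 * (y i).length + 1) + (4 * (y i).length + 1)))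
    ?_ fun i => ?_)
  · have : PolyBdd (fun i => (y i).length) fun i => 4 * (y i).length + 1 :=
      ((PolyBdd.const 4).mul .self).add (.const 1)
    exact this.add (this.add this)
  · have h1 := exec_move_stk (a := 0) (b := 1) (by decide) [y i]
    have h2 := exec_move_stk (a := 1) (b := 2) (by decide) [[], (y i).reverse]
    have h3 := exec_move_stk (a := 2) (b := 0) (by decide) [[], [], y i]
    simp only [put, List.getD_cons_succ, List.getD_cons_zero, List.reverse_reverse,
      List.append_nil, List.length_reverse, List.getD_nil, stk_trim₂] at h1 h2 h3
    exact h1.seq (h2.seq h3)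

end FP

end PRC

/-! ### Pairing, case distinction and bounded iteration in polynomial time. -/

namespace PRC

open BitEncoding (enc)
open Prog

namespace FP

variable {ι κ : Type} {x y z w : ι → List Bool}

/-- Reading `w` from its end and pushing first the bit and then `true` puts the marked bits on top
of `v` in the right order. -/
theorem exec_packLoop (w v : List Bool) :
    (forEach 0 fun b => .seq (.push 2 b) (.push 2 true)).Exec (stk [w.reverse, [], v])
      (5 * w.length + 1) (stk [[], [], (w.flatMap fun b => [true, b]) ++ v]) := by
  have := exec_forEach (r := 0) (f := fun b => .seq (.push 2 b) (.push 2 true)) (c := 2)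
    (fun w v => stk [w, [], v]) (fun l b => true :: b :: l) (fun w v => rfl)
    (fun b w v => by
      have h1 := exec_push_stk 2 b [w, [], v]
      have h2 := exec_push_stk 2 true [w, [], b :: v]
      rw [stk_put]
      exact h1.seq h2) w.reverse v
  rw [List.length_reverse] at this
  convert this using 4
  clear this
  induction w generalizing v with
  | nil => rfl
  | cons b w ih => simpa using ih v

/-- The program for `FP.pair`. -/
def pairProg (p q : Prog) : Prog :=
  .seq (forEach 0 fun b => .seq (.push 1 b) (.push 2 b)) <| .seq (move 1 0) <| .seq (move 2 1) <|
  .seq (p.shift 1) <| .seq (move 0 3) <| .seq (move 3 2) <| .seq (q.shift 2) <|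
  .seq (push 2 false) <| .seq (move 1 0) <|
  .seq (forEach 0 fun b => .seq (.push 2 b) (.push 2 true)) <| .seq (move 2 1) (move 1 0)

/-- The input is duplicated; the first program runs above one copy and the second above the first
result, each protected by the frame rule for `shift`. This lets later arguments treat `x` as a
context from which several values are computed. -/
theorem pair (h : FP x y) (h' : FP x z) : FP x fun i => pc (y i) (z i) := by
  have hly := h.length
  have hlz := h'.length
  obtain ⟨p, P, hP⟩ := h
  obtain ⟨q, Q, hQ⟩ := h'
  have hlin : ∀ {f : ι → ℕ}, PolyBdd (fun i => (x i).length) f →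
      PolyBdd (fun i => (x i).length) fun i => 4 * f i + 1 :=
    fun hf => ((PolyBdd.const 4).mul hf).add (.const 1)
  refine of (pairProg p q) (T := fun i => (5 * (x i).length + 1) + ((4 * (x i).length + 1) +
    ((4 * (x i).length + 1) + (P.eval (x i).length + ((4 * (x i).length + 1) +
    ((4 * (x i).length + 1) + (Q.eval (x i).length + (1 + ((4 * (y i).length + 1) +
    ((5 * (y i).length + 1) + ((4 * (2 * (y i).length + (z i).length + 1) + 1) +
    (4 * (2 * (y i).length + (z i).length + 1) + 1)))))))))))) ?_ fun i => ?_
  · have hp := ((((PolyBdd.const 2).mul hly).add hlz).add (.const 1))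
    exact (((PolyBdd.const 5).mul .self).add (.const 1)).add <| (hlin .self).add <|
      (hlin .self).add <| (PolyBdd.self.eval P).add <| (hlin .self).add <| (hlin .self).add <|
      (PolyBdd.self.eval Q).add <| (PolyBdd.const 1).add <| (hlin hly).add <|
      (((PolyBdd.const 5).mul hly).add (.const 1)).add <| (hlin hp).add (hlin hp)
  · have h1 := exec_move_stk (a := 1) (b := 0) (by decide) [[], (x i).reverse, (x i).reverse]
    have h2 := exec_move_stk (a := 2) (b := 1) (by decide) [x i, [], (x i).reverse]
    have h3 := (hP i).shift [x i]
    have h4 := exec_move_stk (a := 0) (b := 3) (by decide) [x i, y i]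
    have h5 := exec_move_stk (a := 3) (b := 2) (by decide) [[], y i, [], (x i).reverse]
    have h6 := (hQ i).shift [[], y i]
    have h7 := exec_push_stk 2 false [[], y i, z i]
    have h8 := exec_move_stk (a := 1) (b := 0) (by decide) [[], y i, false :: z i]
    have h9 := exec_packLoop (y i) (false :: z i)
    have h10 := exec_move_stk (a := 2) (b := 1) (by decide) [[], [], pc (y i) (z i)]
    have h11 := exec_move_stk (a := 1) (b := 0) (by decide) [[], (pc (y i) (z i)).reverse]
    have e1 : ∀ a b : List Bool, stk [a, b, []] = stk [a, b] := fun a b => stk_append_nil [a, b]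
    have e2 : ∀ a b c : List Bool, stk [a, b, c, []] = stk [a, b, c] :=
      fun a b c => stk_append_nil [a, b, c]
    simp only [put, List.getD_cons_succ, List.getD_cons_zero, List.reverse_reverse,
      List.append_nil, List.length_reverse, List.getD_nil, stk_trim₁, length_pc, e1, e2]
      at h1 h2 h4 h5 h7 h8 h10 h11
    exact (exec_copy _).seq <| h1.seq <| h2.seq <| h3.seq <| h4.seq <| h5.seq <| h6.seq <|
      h7.seq <| h8.seq <| h9.seq <| h10.seq h11

/-- Split a pair on stack `0` into its second component and, on stack `1`, the reversed first
component. -/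
def unpairProg : Prog :=
  .seq (.push 2 true) <| .loop 2 <|
    .branch 0 (.seq (.pop 0) (.seq (.branch 0 (.push 1 true) (.push 1 false) .skip) (.pop 0)))
      (.seq (.pop 0) (.pop 2)) .skip

/-- Loops test only for emptiness, so stack `2` carries a one-bit flag that keeps the loop alive
until the terminator `0` of the first component has been read. -/
theorem exec_unpairProg (a b : List Bool) :
    unpairProg.Exec (stk [pc a b]) (6 * a.length + 6) (stk [b, a.reverse]) := by
  suffices H : ∀ v, (Prog.loop 2 <|
      .branch 0 (.seq (.pop 0) (.seq (.branch 0 (.push 1 true) (.push 1 false) .skip) (.pop 0)))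
      (.seq (.pop 0) (.pop 2)) .skip).Exec (stk [pc a b, v, [true]]) (6 * a.length + 5)
        (stk [b, a.reverse ++ v]) by
    have h1 := exec_push_stk 2 true [pc a b]
    have h2 := h1.seq (H [])
    rw [List.append_nil] at h2
    exact h2.mono (by omega)
  induction a with
  | nil =>
    intro v
    refine (Exec.loopStep (T := 3) (T' := 1) (by simp [stk])
      (Exec.branchFalse (by simp [stk, pc]) ((exec_pop_stk 0 _).seq (exec_pop_stk 2 _))) ?_).mono
      (by simp)
    have e : stk [b, v, []] = stk [b, v] := stk_append_nil [b, v]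
    simp only [put, pc, List.flatMap_nil, List.nil_append, List.getD_cons_zero, List.tail_cons,
      List.getD_cons_succ, e, List.reverse_nil]
    exact Exec.loopDone (by simp [stk])
  | cons c a ih =>
    intro v
    have e : pc (c :: a) b = true :: c :: pc a b := by simp [pc]
    rw [e]
    have h1 := exec_pop_stk 0 [true :: c :: pc a b, v, [true]]
    have h2 : (Prog.branch 0 (.push 1 true) (.push 1 false) .skip).Exec
        (stk [c :: pc a b, v, [true]]) 2 (stk [c :: pc a b, c :: v, [true]]) := by
      cases c with
      | true => exact Exec.branchTrue (by simp [stk]) (exec_push_stk 1 true [true :: pc a b, v, [true]])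
      | false =>
        exact Exec.branchFalse (by simp [stk]) (exec_push_stk 1 false [false :: pc a b, v, [true]])
    have h3 := exec_pop_stk 0 [c :: pc a b, c :: v, [true]]
    have := Exec.loopStep (r := 2) (by simp [stk])
      (Exec.branchTrue (pf := .seq (.pop 0) (.pop 2)) (pe := .skip) (r := 0) (by simp [stk])
        (h1.seq (h2.seq h3))) (ih (c :: v))
    rw [List.reverse_cons, List.append_assoc]
    exact this.mono (by rw [List.length_cons]; omega)

theorem fst (h : FP x fun i => pc (y i) (z i)) : FP x y := by
  refine h.comp (of (.seq unpairProg (.seq (clear 0) (move 1 0)))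
    (T := fun i => (6 * (y i).length + 6) + ((2 * (z i).length + 1) + (4 * (y i).length + 1)))
    ?_ fun i => ?_)
  · exact (((PolyBdd.const 20).mul .self).add (.const 20)).mono fun i => by rw [length_pc]; omega
  · have h1 := exec_clear_stk 0 [z i, (y i).reverse]
    have h2 := exec_move_stk (a := 1) (b := 0) (by decide) [[], (y i).reverse]
    simp only [put, List.getD_cons_succ, List.getD_cons_zero, List.reverse_reverse,
      List.append_nil, List.length_reverse, stk_trim₁] at h1 h2
    exact (exec_unpairProg _ _).seq (h1.seq h2)

theorem snd (h : FP x fun i => pc (y i) (z i)) : FP x z := by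
  refine h.comp (of (.seq unpairProg (clear 1))
    (T := fun i => (6 * (y i).length + 6) + (2 * (y i).length + 1)) ?_ fun i => ?_)
  · exact (((PolyBdd.const 20).mul .self).add (.const 20)).mono fun i => by rw [length_pc]; omega
  · have h1 := exec_clear_stk 1 [z i, (y i).reverse]
    simp only [put, List.getD_cons_succ, List.getD_cons_zero, List.length_reverse, stk_trim₁] at h1
    exact (exec_unpairProg _ _).seq h1

theorem append (h : FP x y) (h' : FP x z) : FP x fun i => y i ++ z i := by
  refine (h.pair h').comp (of (.seq unpairProg (move 1 0))
    (T := fun i => (6 * (y i).length + 6) + (4 * (y i).length + 1)) ?_ fun i => ?_)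
  · exact (((PolyBdd.const 20).mul .self).add (.const 20)).mono fun i => by rw [length_pc]; omega
  · have h2 := exec_move_stk (a := 1) (b := 0) (by decide) [z i, (y i).reverse]
    simp only [put, List.getD_cons_succ, List.getD_cons_zero, List.reverse_reverse,
      List.length_reverse, stk_trim₁] at h2
    exact (exec_unpairProg _ _).seq h2

theorem pack_nil : FP x fun _ => pack [] := nil

theorem pack_cons {l : ι → List (List Bool)} (h : FP x y) (h' : FP x fun i => pack (l i)) :
    FP x fun i => pack (y i :: l i) :=
  (h.pair h').congr fun _ => (PRC.pack_cons _ _).symm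

theorem head_pack {l : ι → List (List Bool)} (h : FP x fun i => pack (y i :: l i)) : FP x y :=
  (h.congr fun _ => PRC.pack_cons _ _).fst

theorem tail_pack {l : ι → List (List Bool)} (h : FP x fun i => pack (y i :: l i)) :
    FP x fun i => pack (l i) :=
  (h.congr fun _ => PRC.pack_cons _ _).snd

/-- Case distinction according to the first bit of the input. -/
theorem branch (ht : FP (fun i : {i // (x i).head? = some true} => x i) fun i => y i)
    (hf : FP (fun i : {i // (x i).head? = some false} => x i) fun i => y i)
    (he : FP (fun i : {i // x i = []} => x i) fun i => y i) : FP x y := by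
  obtain ⟨p, P, hP⟩ := ht
  obtain ⟨q, Q, hQ⟩ := hf
  obtain ⟨r, R, hR⟩ := he
  refine ⟨.branch 0 p q r, P + Q + R + Polynomial.C 1, fun i => ?_⟩
  simp only [Polynomial.eval_add, Polynomial.eval_C]
  rcases hx : x i with _ | ⟨_ | _, v⟩
  · have := hR ⟨i, hx⟩
    simp only [hx] at this
    exact (Exec.branchEmpty (by simp [stk]) this).mono (by omega)
  · have := hQ ⟨i, by simp [hx]⟩
    simp only [hx] at this
    exact (Exec.branchFalse (by simp [stk]) this).mono (by omega)
  · have := hP ⟨i, by simp [hx]⟩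
    simp only [hx] at this
    exact (Exec.branchTrue (by simp [stk]) this).mono (by omega)

/-- Case distinction according to a computed bit. -/
theorem cond {c : ι → Bool} (hc : FP x fun i => [c i])
    (ht : FP (fun i : {i // c i = true} => x i) fun i => y i)
    (hf : FP (fun i : {i // c i = false} => x i) fun i => y i) : FP x y := by
  -- The computed bit is put in front of a copy of the input, so that the test on the first bit
  -- still leaves the input available to both branches.
  refine ((hc.append id).comp (branch ?_ ?_ ?_) : FP x y)
  · refine FP.comp (FP.tail id) ?_
    exact ht.reindex fun i : {i // ([c i] ++ x i).head? = some true} => ⟨i.1, by simpa using i.2⟩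
  · refine FP.comp (FP.tail id) ?_
    exact hf.reindex fun i : {i // ([c i] ++ x i).head? = some false} => ⟨i.1, by simpa using i.2⟩
  · exact (nil (x := fun i : {i // [c i] ++ x i = []} => [c i] ++ x i)).congr fun i =>
      absurd i.2 (by simp)

theorem ite {c : ι → Bool} (hc : FP x fun i => [c i]) (hy : FP x y) (hz : FP x z) :
    FP x fun i => if c i then y i else z i :=
  cond hc ((hy.reindex Subtype.val).congr fun i => by simp [i.2])
    ((hz.reindex Subtype.val).congr fun i => by simp [i.2])

/-- Iteration, once for every symbol of `w i`. -/
theorem iter' {st : ι → ℕ → List Bool} (hw : FP x w) (h0 : FP x fun i => st i 0)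
    (hs : FP (fun a : (i : ι) × Fin (w i).length => st a.1 a.2) fun a => st a.1 (a.2 + 1))
    (hb : ∃ P : Polynomial ℕ, ∀ i, ∀ j ≤ (w i).length, (st i j).length ≤ P.eval (x i).length) :
    FP x fun i => st i (w i).length := by
  -- The bound on all intermediate states is essential, since iterating a polynomial-time step may
  -- otherwise blow up exponentially. With it, each step takes at most `Q.eval (P.eval (x
  -- i).length)` steps of the machine.
  obtain ⟨P, hP⟩ := hb
  obtain ⟨p, Q, hQ⟩ := hs
  have hlw := hw.length
  have hl0 := h0.length
  obtain ⟨q, R, hR⟩ := hw.pair h0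
  refine of (.seq q <| .seq unpairProg <| .seq (move 0 2) <| .seq (move 1 0) <| .seq (move 2 1) <|
    .seq (.loop 0 (.seq (.pop 0) (p.shift 1))) (.seq (move 1 2) (move 2 0)))
    (T := fun i => R.eval (x i).length + ((6 * (w i).length + 6) + ((4 * (st i 0).length + 1) +
      ((4 * (w i).length + 1) + ((4 * (st i 0).length + 1) +
      (((w i).length * (2 + Q.eval (P.eval (x i).length)) + 1) +
      ((4 * P.eval (x i).length + 1) + (4 * P.eval (x i).length + 1)))))))) ?_ fun i => ?_
  · have hPP := (PolyBdd.self (L := fun i => (x i).length)).eval P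
    have hlin : ∀ {f : ι → ℕ}, PolyBdd (fun i => (x i).length) f →
        PolyBdd (fun i => (x i).length) fun i => 4 * f i + 1 :=
      fun hf => ((PolyBdd.const 4).mul hf).add (.const 1)
    exact (PolyBdd.self.eval R).add <| (((PolyBdd.const 6).mul hlw).add (.const 6)).add <|
      (hlin hl0).add <| (hlin hlw).add <| (hlin hl0).add <|
      ((hlw.mul ((PolyBdd.const 2).add (hPP.eval Q))).add (.const 1)).add <|
      (hlin hPP).add (hlin hPP)
  · have h1 := exec_move_stk (a := 0) (b := 2) (by decide) [st i 0, (w i).reverse]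
    have h2 := exec_move_stk (a := 1) (b := 0) (by decide) [[], (w i).reverse, (st i 0).reverse]
    have h3 := exec_move_stk (a := 2) (b := 1) (by decide) [w i, [], (st i 0).reverse]
    have h5 := exec_move_stk (a := 1) (b := 2) (by decide) [[], st i (w i).length]
    have h6 := exec_move_stk (a := 2) (b := 0) (by decide) [[], [], (st i (w i).length).reverse]
    have e1 : ∀ a b : List Bool, stk [a, b, []] = stk [a, b] := fun a b => stk_append_nil [a, b]
    simp only [put, List.getD_cons_succ, List.getD_cons_zero, List.reverse_reverse,
      List.append_nil, List.length_reverse, List.getD_nil, stk_trim₁, e1]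
      at h1 h2 h3 h5 h6
    have hlast := hP i _ le_rfl
    refine (hR i).seq <| (exec_unpairProg _ _).seq <| h1.seq <| h2.seq <| h3.seq <| Exec.seq ?_ <|
      (h5.mono (by omega)).seq (h6.mono (by omega))
    -- The rest `v` of `w` serves only as a counter: `j` rounds are done and `v.length` remain.
    suffices H : ∀ (v : List Bool) (j : ℕ), j + v.length = (w i).length →
        (Prog.loop 0 (.seq (.pop 0) (p.shift 1))).Exec (stk [v, st i j])
          (v.length * (2 + Q.eval (P.eval (x i).length)) + 1)
          (stk [[], st i (w i).length]) from H _ 0 (by simp)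
    intro v
    induction v with
    | nil =>
      intro j hj
      obtain rfl : j = (w i).length := by simpa using hj
      exact (Exec.loopDone (by simp [stk])).mono (by simp)
    | cons b v ih =>
      intro j hj
      rw [List.length_cons] at hj
      have hj' : j < (w i).length := by omega
      have h1 := exec_pop_stk 0 [b :: v, st i j]
      have h2 := (hQ ⟨i, ⟨j, hj'⟩⟩).shift [v]
      have h3 := Exec.loopStep (r := 0) (by simp [stk])
        (h1.seq (h2.mono (Q.eval_nat_mono (hP i j hj'.le)))) (ih (j + 1) (by omega))
      refine h3.mono ?_
      rw [List.length_cons, add_mul]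
      simp only
      omega

/-- Iteration with a step that has access to the input. -/
theorem iter {st : ι → ℕ → List Bool} (hw : FP x w) (h0 : FP x fun i => st i 0)
    (hs : FP (fun a : (i : ι) × Fin (w i).length => pc (st a.1 a.2) (x a.1))
      fun a => st a.1 (a.2 + 1))
    (hb : ∃ P : Polynomial ℕ, ∀ i, ∀ j ≤ (w i).length, (st i j).length ≤ P.eval (x i).length) :
    FP x fun i => st i (w i).length := by
  obtain ⟨P, hP⟩ := hb
  refine (iter' (st := fun i j => pc (st i j) (x i)) hw (h0.pair id)
    (hs.pair (FP.snd id)) ⟨2 * P + Polynomial.X + Polynomial.C 1, fun i j hj => ?_⟩).fst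
  have := hP i j hj
  simp only [length_pc, Polynomial.eval_add, Polynomial.eval_mul, Polynomial.eval_X,
    Polynomial.eval_C, Polynomial.eval_ofNat]
  omega

end FP

end PRC

/-! ### Unary arithmetic, strings and sequences of strings in polynomial time. -/

namespace PRC

open BitEncoding (enc)

theorem length_unary (n : ℕ) : (unary n).length = n := List.length_replicate

theorem unary_add (a b : ℕ) : unary (a + b) = unary a ++ unary b :=
  List.replicate_add _ _ _

theorem unary_succ (a : ℕ) : unary (a + 1) = true :: unary a := List.replicate_succ

theorem pack_eq_nil {l : List (List Bool)} : pack l = [] ↔ l = [] := by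
  cases l <;> simp [pack]

theorem length_le_length_pack (l : List (List Bool)) : l.length ≤ (pack l).length := by
  induction l with
  | nil => simp
  | cons a l ih => rw [pack_cons, length_pc, List.length_cons]; omega

namespace FP

variable {ι κ : Type} {x y z w : ι → List Bool}

theorem of_cond {c : ι → Bool} (hc : FP x fun i => [c i])
    (ht : ∀ Y : {i // c i = true} → List Bool, FP Y (fun i => x i) → FP Y fun i => y i)
    (hf : ∀ Y : {i // c i = false} → List Bool, FP Y (fun i => x i) → FP Y fun i => y i) :
    FP x y :=
  cond hc (ht _ id) (hf _ id)

theorem of_head? (f : Option Bool → List Bool) (h : FP x y) : FP x fun i => f (y i).head? :=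
  h.comp <| branch ((const (f (some true))).congr fun i => by rw [i.2])
    ((const (f (some false))).congr fun i => by rw [i.2])
    ((const (f none)).congr fun i => by rw [i.2]; rfl)

theorem of_head?₂ (f : Option Bool → Option Bool → List Bool) (hy : FP x y) (hz : FP x z) :
    FP x fun i => f (y i).head? (z i).head? := by
  refine of_cond (c := fun i => (y i).head? == some true)
    (hy.of_head? fun b => [b == some true]) (fun Y hY => ?_) fun Y hY => ?_
  · exact ((hY.comp (hz.reindex Subtype.val)).of_head? (f (some true))).congr fun i => by
      rw [show (y i).head? = some true by simpa using i.2]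
  · refine of_cond (c := fun i => (y i).head? == some false)
      (hY.comp ((hy.of_head? fun b => [b == some false]).reindex Subtype.val))
      (fun Z hZ => ?_) fun Z hZ => ?_
    · have := hZ.comp (hY.reindex Subtype.val)
      exact ((this.comp (hz.reindex fun i : {i : {i // _} // _} => i.1.1)).of_head? (f (some false))).congr fun i => by
        rw [show (y i.1.1).head? = some false by simpa using i.2]
    · have := hZ.comp (hY.reindex Subtype.val)
      exact ((this.comp (hz.reindex fun i : {i : {i // _} // _} => i.1.1)).of_head? (f none)).congr fun i => by
        have h1 := i.1.2
        have h2 := i.2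
        simp only [beq_eq_false_iff_ne] at h1 h2
        rw [show (y i.1.1).head? = none by
          rcases h : (y i.1.1).head? with _ | _ | _
          · rfl
          · exact absurd h h2
          · exact absurd h h1]

theorem bit₂ (f : Bool → Bool → Bool) {b c : ι → Bool} (hb : FP x fun i => [b i])
    (hc : FP x fun i => [c i]) : FP x fun i => [f (b i) (c i)] :=
  hb.of_head?₂ (fun b c => [f (b.getD false) (c.getD false)]) hc

theorem bit₁ (f : Bool → Bool) {b : ι → Bool} (hb : FP x fun i => [b i]) :
    FP x fun i => [f (b i)] :=
  hb.of_head? (fun b => [f (b.getD false)])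

theorem isEmpty (h : FP x y) : FP x fun i => [(y i).isEmpty] :=
  (h.of_head? fun b => [b.isNone]).congr fun i => by cases y i <;> rfl

theorem unary_length (h : FP x y) : FP x fun i => unary (y i).length := by
  refine iter' (st := fun _ j => unary j) h nil (cons id true) ?_
  obtain ⟨P, hP⟩ := h.length
  exact ⟨P, fun i j hj => by rw [length_unary]; exact hj.trans (hP i)⟩

/-- Recursion with `N i` steps. -/
theorem iterate {st : ι → ℕ → List Bool} {N : ι → ℕ} (hN : FP x fun i => unary (N i))
    (h0 : FP x fun i => st i 0)
    (hs : ∀ Y : (i : ι) × Fin (N i) → List Bool, (FP Y fun a => unary a.2) →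
      (FP Y fun a => st a.1 a.2) → (FP Y fun a => x a.1) → FP Y fun a => st a.1 (a.2 + 1))
    (hb : PolyBdd (fun a : (i : ι) × Fin (N i + 1) => (x a.1).length)
      fun a => (st a.1 a.2).length) :
    FP x fun i => st i (N i) := by
  obtain ⟨P, hP⟩ := hb
  obtain ⟨Q, hQ⟩ := hN.length
  -- The round number travels along with the state in unary, so that a step may depend on it.
  have := iter (st := fun i j => pc (st i j) (unary j)) hN (h0.pair nil) ?_ ?_
  · exact FP.fst (z := fun i => unary (N i)) (this.congr fun i => by rw [length_unary])
  · have h := hs (fun a => pc (pc (st a.1 a.2) (unary a.2)) (x a.1)) id.fst.snd id.fst.fst id.snd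
    exact (h.pair (id.fst.snd.cons true)).reindex fun a : (i : ι) × Fin (unary (N i)).length =>
      (⟨a.1, ⟨a.2, by simpa only [length_unary] using a.2.2⟩⟩ : (i : ι) × Fin (N i))
  · refine ⟨2 * P + Q + Polynomial.C 1, fun i j hj => ?_⟩
    rw [length_unary] at hj
    have h1 := hP ⟨i, ⟨j, by omega⟩⟩
    have h2 := hQ i
    simp only at h1
    simp only [length_unary] at h2
    simp only [length_pc, length_unary, Polynomial.eval_add, Polynomial.eval_mul,
      Polynomial.eval_C, Polynomial.eval_ofNat]
    omega

theorem unary_add {a b : ι → ℕ} (ha : FP x fun i => unary (a i)) (hb : FP x fun i => unary (b i)) :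
    FP x fun i => unary (a i + b i) :=
  (ha.append hb).congr fun _ => (PRC.unary_add _ _).symm

theorem drop {n : ι → ℕ} (hn : FP x fun i => unary (n i)) (h : FP x y) :
    FP x fun i => (y i).drop (n i) := by
  refine iterate (st := fun i j => (y i).drop j) hn (h.congr fun _ => rfl)
    (fun Y _ hs _ => hs.tail.congr fun a => by simp) ?_
  exact (h.length.reindex Sigma.fst).mono fun a => by simp

theorem take {n : ι → ℕ} (hn : FP x fun i => unary (n i)) (h : FP x y) :
    FP x fun i => (y i).take (n i) := by
  have h1 : FP x fun i => unary ((y i).length - n i) :=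
    (drop hn h.unary_length).congr fun i => by simp [unary]
  exact (drop h1 h.reverse).reverse.congr fun i => by
    rw [List.drop_reverse, List.reverse_reverse]
    rcases le_total (n i) (y i).length with hl | hl
    · congr 1; omega
    · rw [List.take_of_length_le hl, List.take_of_length_le (by omega)]

theorem unary_sub {a b : ι → ℕ} (ha : FP x fun i => unary (a i)) (hb : FP x fun i => unary (b i)) :
    FP x fun i => unary (a i - b i) :=
  (drop hb ha).congr fun i => by simp [unary]

theorem le {a b : ι → ℕ} (ha : FP x fun i => unary (a i)) (hb : FP x fun i => unary (b i)) :
    FP x fun i => [decide (a i ≤ b i)] :=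
  (unary_sub ha hb).isEmpty.congr fun i => by
    congr 1
    rw [Bool.eq_iff_iff]
    simp [unary, Nat.sub_eq_zero_iff_le]

theorem unary_mul {a b : ι → ℕ} (ha : FP x fun i => unary (a i)) (hb : FP x fun i => unary (b i)) :
    FP x fun i => unary (a i * b i) := by
  refine iterate (st := fun i j => unary (j * b i)) ha (nil.congr fun i => by simp [unary])
    (fun Y _ hs hx => (hs.unary_add (hx.comp (hb.reindex Sigma.fst))).congr fun a => by
      rw [add_mul, one_mul]) ?_
  have h := (ha.length.mul hb.length).reindex
    (fun a : (i : ι) × Fin (a i + 1) => a.1)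
  refine h.mono fun c => ?_
  simp only [length_unary]
  exact Nat.mul_le_mul_right _ (by have := c.2.2; omega)

/-- A list can be computed if its length can be bounded and its entries can be computed. -/
theorem build {l : ι → List Bool} {N : ι → ℕ} (hN : FP x fun i => unary (N i))
    (hl : ∀ i, (l i).length ≤ N i)
    (hs : ∀ Y : (i : ι) × Fin (N i) → List Bool, (FP Y fun a => unary a.2) →
      (FP Y fun a => x a.1) → FP Y fun a => (l a.1)[(a.2 : ℕ)]?.toList) : FP x l := by
  refine FP.congr (iterate (st := fun i j => (l i).take j) hN (nil.congr fun i => by simp)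
    (fun Y hj hs' hx => (hs'.append (hs Y hj hx)).congr fun a => by rw [List.take_add_one]) ?_)
    fun i => List.take_of_length_le (hl i)
  exact (hN.length.reindex Sigma.fst).mono fun a => by
    simp only [length_unary, List.length_take]
    exact (min_le_right _ _).trans (hl _)

theorem replicate {n : ι → ℕ} (hn : FP x fun i => unary (n i)) (b : Bool) :
    FP x fun i => List.replicate (n i) b :=
  build hn (fun i => by simp) fun Y _ _ => (const [b]).congr fun a => by simp

theorem zipWith (f : Bool → Bool → Bool) (hy : FP x y) (hz : FP x z) :
    FP x fun i => List.zipWith f (y i) (z i) := by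
  refine build hy.unary_length (fun i => by simp) fun Y hj hx => ?_
  have h1 := drop hj (hx.comp (hy.reindex Sigma.fst))
  have h2 := drop hj (hx.comp (hz.reindex Sigma.fst))
  refine (h1.of_head?₂ (fun b c => (Option.map₂ f b c).toList) h2).congr fun a => ?_
  rw [List.head?_drop, List.head?_drop, List.getElem?_zipWith]
  cases (y a.1)[(a.2 : ℕ)]? <;> cases (z a.1)[(a.2 : ℕ)]? <;> rfl

theorem count (h : FP x y) : FP x fun i => unary ((y i).count true) := by
  refine FP.congr (iterate (st := fun i j => unary (((y i).take j).count true)) h.unary_length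
    (nil.congr fun i => by simp [unary]) (fun Y hj hs hx => ?_) ?_)
    fun i => by rw [List.take_length]
  · have h1 := drop hj (hx.comp (h.reindex Sigma.fst))
    refine (hs.append (h1.of_head? fun b => if b = some true then [true] else [])).congr fun a => ?_
    rw [List.take_add_one, List.count_append, PRC.unary_add, List.head?_drop]
    rcases (y a.1)[(a.2 : ℕ)]? with _ | _ | _ <;> simp [unary]
  · exact (h.length.reindex Sigma.fst).mono fun a => by
      simp only [length_unary]
      exact List.count_le_length.trans (by simp)

/-- Reduces equality of strings to a length comparison and a Hamming weight. The lengths are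
compared separately because `zipWith` truncates. -/
theorem _root_.PRC.eq_iff_count_xor (y z : List Bool) :
    y = z ↔ y.length = z.length ∧ (List.zipWith xor y z).count true = 0 := by
  induction y generalizing z with
  | nil => cases z <;> simp
  | cons b y ih =>
    cases z with
    | nil => simp
    | cons c z =>
      simp only [List.cons.injEq, ih, List.length_cons, List.zipWith_cons_cons, List.count_cons]
      cases b <;> cases c <;> simp

theorem eq_length {a b : ι → ℕ} (ha : FP x fun i => unary (a i)) (hb : FP x fun i => unary (b i)) :
    FP x fun i => [decide (a i = b i)] :=
  (bit₂ and (ha.le hb) (hb.le ha)).congr fun i => by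
    simp only [List.cons.injEq, and_true, ← Bool.decide_and, decide_eq_decide]; omega

theorem beq (hy : FP x y) (hz : FP x z) : FP x fun i => [decide (y i = z i)] :=
  (bit₂ and (hy.unary_length.eq_length hz.unary_length)
    ((hy.zipWith xor hz).count.eq_length ((const (unary 0)).congr fun _ => rfl))).congr fun i => by
    rw [← Bool.decide_and]
    simp only [eq_iff_count_xor]

/-! Sequences of strings -/

variable {l l' : ι → List (List Bool)}

theorem pack_append (h : FP x fun i => pack (l i)) (h' : FP x fun i => pack (l' i)) :
    FP x fun i => pack (l i ++ l' i) :=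
  (h.append h').congr fun _ => (PRC.pack_append _ _).symm

theorem pack_isEmpty (h : FP x fun i => pack (l i)) : FP x fun i => [(l i).isEmpty] :=
  h.isEmpty.congr fun i => by
    have := @pack_eq_nil (l i)
    cases hl : l i
    · rfl
    · rw [hl] at this
      simpa using this

theorem pack_cases (h : FP x fun i => pack (l i))
    (hn : ∀ Y : {i // (l i).isEmpty = true} → List Bool, FP Y (fun i => x i) → FP Y fun i => y i)
    (hc : ∀ Y : {i // (l i).isEmpty = false} → List Bool, FP Y (fun i => x i) →
      FP Y (fun i => (l i).headD []) → FP Y (fun i => pack (l i).tail) → FP Y fun i => y i) :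
    FP x y := by
  refine of_cond h.pack_isEmpty hn fun Y hY => ?_
  have h1 : FP Y fun i => pc ((l i).headD []) (pack (l i).tail) :=
    (hY.comp (h.reindex Subtype.val)).congr fun i => by
      rw [← PRC.pack_cons]
      have := i.2
      cases hl : l i.1
      · simp [hl] at this
      · rfl
  exact hc Y hY h1.fst h1.snd

theorem pack_tail (h : FP x fun i => pack (l i)) : FP x fun i => pack (l i).tail :=
  pack_cases h (fun Y _ => nil.congr fun i => by
    have := i.2
    rw [List.isEmpty_iff] at this
    rw [this]; rfl) fun _ _ _ h => h

theorem pack_headD (h : FP x fun i => pack (l i)) : FP x fun i => (l i).headD [] :=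
  pack_cases h (fun Y _ => nil.congr fun i => by
    have := i.2
    rw [List.isEmpty_iff] at this
    rw [this]; rfl) fun _ _ h _ => h

theorem _root_.PRC.length_pack_drop_le (l : List (List Bool)) (n : ℕ) :
    (pack (l.drop n)).length ≤ (pack l).length := by
  conv_rhs => rw [← List.take_append_drop n l, PRC.pack_append]
  simp

theorem _root_.PRC.length_pack_take_le (l : List (List Bool)) (n : ℕ) :
    (pack (l.take n)).length ≤ (pack l).length := by
  conv_rhs => rw [← List.take_append_drop n l, PRC.pack_append]
  simp

theorem pack_drop {n : ι → ℕ} (hn : FP x fun i => unary (n i)) (h : FP x fun i => pack (l i)) :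
    FP x fun i => pack ((l i).drop (n i)) := by
  refine iterate (st := fun i j => pack ((l i).drop j)) hn (h.congr fun _ => rfl)
    (fun Y _ hs _ => hs.pack_tail.congr fun a => by simp) ?_
  exact (h.length.reindex Sigma.fst).mono fun a => length_pack_drop_le _ _

theorem pack_take {n : ι → ℕ} (hn : FP x fun i => unary (n i)) (h : FP x fun i => pack (l i)) :
    FP x fun i => pack ((l i).take (n i)) := by
  refine iterate (st := fun i j => pack ((l i).take j)) hn (nil.congr fun _ => by simp [pack])
    (fun Y hj hs hx => ?_) ?_
  · have h1 := pack_drop hj (hx.comp (h.reindex Sigma.fst))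
    refine (hs.pack_append (l' := fun a => (l a.1)[(a.2 : ℕ)]?.toList) ?_).congr
      fun a => by rw [List.take_add_one]
    refine pack_cases h1 (fun Z _ => nil.congr fun a => ?_) fun Z _ hh _ => ?_
    · have := a.2
      rw [List.isEmpty_iff, List.drop_eq_nil_iff] at this
      rw [List.getElem?_eq_none this]; rfl
    · refine (hh.pack_cons FP.pack_nil).congr fun a => ?_
      have := a.2
      rw [← List.head?_drop]
      cases hl : List.drop _ (l a.1.1)
      · simp [hl] at this
      · rfl
  · exact (h.length.reindex Sigma.fst).mono fun a => length_pack_take_le _ _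

theorem pack_getElem? {n : ι → ℕ} (hn : FP x fun i => unary (n i)) (h : FP x fun i => pack (l i)) :
    FP x fun i => (l i)[n i]?.getD [] :=
  (pack_drop hn h).pack_headD.congr fun i => by
    rw [List.headD_eq_head?_getD, List.head?_drop]

theorem pack_length (h : FP x fun i => pack (l i)) : FP x fun i => unary (l i).length := by
  refine FP.congr (iterate (st := fun i j => unary ((l i).take j).length) h.unary_length
    (nil.congr fun i => by simp [unary]) (fun Y hj hs hx => ?_) ?_)
    fun i => by rw [List.take_of_length_le (length_le_length_pack _)]
  · have h1 := (pack_drop hj (hx.comp (h.reindex Sigma.fst))).pack_isEmpty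
    refine (hs.append (h1.ite nil (const [true]))).congr fun a => ?_
    rw [List.take_add_one, List.length_append, PRC.unary_add, ← List.head?_drop]
    cases List.drop (a.2 : ℕ) (l a.1) <;> rfl
  · exact (h.length.reindex Sigma.fst).mono fun a => by
      simp only [length_unary, List.length_take]
      exact (min_le_right _ _).trans (length_le_length_pack _)

end FP

/-- Every length that is polynomial-time computable is polynomially bounded. -/
theorem PolyLen.fp {ℓ : ℕ → ℕ} (h : PolyLen ℓ) {ι : Type} {x : ι → List Bool} {n : ι → ℕ}
    (hn : FP x fun i => unary (n i)) : FP x fun i => unary (ℓ (n i)) :=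
  (hn.pack_cons (l := fun _ => []) .pack_nil).comp ((FP.of_polyTime h).reindex n)

theorem PolyLen.of_fp {ℓ : ℕ → ℕ}
    (h : ∀ X : ℕ → List Bool, FP X unary → FP X fun n => unary (ℓ n)) : PolyLen ℓ :=
  FP.polyTime (h _ (FP.head_pack (l := fun _ => []) FP.id))

theorem PolyLen.polyBdd {ℓ : ℕ → ℕ} (h : PolyLen ℓ) : PolyBdd (fun n => n) ℓ := by
  have := (FP.id (x := unary)).length
  have h2 := (h.fp (FP.id (x := unary))).length
  simpa only [length_unary] using h2

end PRC

namespace PRC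

open BitEncoding (enc)

/-! ### Encodings -/

/-- The string `l`, cut or padded with zeros to length `n`. -/
def toBits (n : ℕ) (l : List Bool) : Bits n := fun i => l.getD i false

theorem enc_bits {n : ℕ} (x : Bits n) : enc x = List.ofFn x := rfl

theorem length_enc_bits {n : ℕ} (x : Bits n) : (enc x).length = n := List.length_ofFn

theorem enc_injective {n : ℕ} : Function.Injective (enc : Bits n → List Bool) :=
  List.ofFn_injective

theorem enc_toBits (n : ℕ) (l : List Bool) :
    enc (toBits n l) = (l ++ List.replicate n false).take n := by
  apply List.ext_getElem?
  intro i
  rw [enc_bits, List.getElem?_ofFn, List.getElem?_take]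
  by_cases hi : i < n
  · simp only [hi, dite_true, if_true, toBits, List.getD_eq_getElem?_getD, List.getElem?_append]
    by_cases hl : i < l.length
    · simp [hl]
    · have : i - l.length < n := by omega
      simp [hl, this]
  · simp [hi]

theorem enc_append {a b : ℕ} (x : Bits a) (y : Bits b) :
    enc (Fin.append x y : Bits (a + b)) = enc x ++ enc y := List.ofFn_fin_append x y

theorem Bits.append_left_right {a b : ℕ} (x : Bits (a + b)) : Fin.append x.left x.right = x :=
  Fin.append_castAdd_natAdd

theorem Bits.left_append {a b : ℕ} (x : Bits a) (y : Bits b) :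
    Bits.left (Fin.append x y : Bits (a + b)) = x := by
  funext i; simp [Bits.left]

theorem Bits.right_append {a b : ℕ} (x : Bits a) (y : Bits b) :
    Bits.right (Fin.append x y : Bits (a + b)) = y := by
  funext i; simp [Bits.right]

theorem enc_left {a b : ℕ} (x : Bits (a + b)) : enc x.left = (enc x).take a := by
  conv_rhs => rw [← x.append_left_right, enc_append, List.take_left' (length_enc_bits _)]

theorem enc_right {a b : ℕ} (x : Bits (a + b)) : enc x.right = (enc x).drop a := by
  conv_rhs => rw [← x.append_left_right, enc_append, List.drop_left' (length_enc_bits _)]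

theorem enc_none {α : Type} [BitEncoding α] : enc (none : Option α) = [false] := rfl

theorem enc_some {α : Type} [BitEncoding α] (a : α) : enc (some a) = true :: enc a := rfl

theorem enc_inl {α β : Type} [BitEncoding α] [BitEncoding β] (a : α) :
    enc (Sum.inl a : α ⊕ β) = false :: enc a := rfl

theorem enc_inr {α β : Type} [BitEncoding α] [BitEncoding β] (b : β) :
    enc (Sum.inr b : α ⊕ β) = true :: enc b := rfl

/-- A bound `ℓ` with `q < 2 ^ ℓ ≤ 2 * q + 1`, computed by `j` steps of doubling. -/
def logBound (q : ℕ) : ℕ → ℕ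
  | 0 => 0
  | j + 1 => if 2 ^ logBound q j ≤ q then logBound q j + 1 else logBound q j

/-- The power is doubled only while it is at most `q`. This keeps the factor lost by guessing a
query linear in the number of queries. -/
theorem two_pow_logBound_le (q j : ℕ) : 2 ^ logBound q j ≤ 2 * q + 1 := by
  induction j with
  | zero => simp [logBound]
  | succ j ih =>
    rw [logBound]
    split_ifs with h
    · rw [pow_succ]; omega
    · exact ih

theorem logBound_le (q j : ℕ) : logBound q j ≤ 2 * q + 1 :=
  Nat.lt_two_pow_self.le.trans (two_pow_logBound_le q j)

theorem lt_two_pow_logBound (q : ℕ) : q < 2 ^ logBound q q := by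
  -- Until the power exceeds `q`, every step increases the exponent. For `j = q` either alternative
  -- suffices, since `q < 2 ^ q`.
  suffices H : ∀ j, j ≤ logBound q j ∨ q < 2 ^ logBound q j by
    rcases H q with h | h
    · exact Nat.lt_two_pow_self.trans_le (Nat.pow_le_pow_right (by norm_num) h)
    · exact h
  intro j
  induction j with
  | zero => simp
  | succ j ih =>
    rw [logBound]
    split_ifs with h
    · left
      rcases ih with ih | ih <;> omega
    · right; omega

/-- The number with the given binary digits, most significant digit first. -/
def ofDigits (l : List Bool) : ℕ := l.foldl (fun v b => v + v + b.toNat) 0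

theorem ofDigits_concat (l : List Bool) (b : Bool) :
    ofDigits (l ++ [b]) = ofDigits l + ofDigits l + b.toNat := by
  simp [ofDigits]

theorem ofDigits_lt (l : List Bool) : ofDigits l < 2 ^ l.length := by
  induction l using List.reverseRecOn with
  | nil => simp [ofDigits]
  | append_singleton l b ih =>
    rw [ofDigits_concat, List.length_append, List.length_singleton, pow_succ]
    cases b <;> simp <;> omega

theorem exists_ofDigits_eq (ℓ v : ℕ) (h : v < 2 ^ ℓ) : ∃ l : List Bool, l.length = ℓ ∧ ofDigits l = v := by
  induction ℓ generalizing v with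
  | zero => exact ⟨[], rfl, by simp at h; simp [h, ofDigits]⟩
  | succ ℓ ih =>
    obtain ⟨l, hl, hv⟩ := ih (v / 2) (by rw [pow_succ] at h; omega)
    refine ⟨l ++ [decide (v % 2 = 1)], by simp [hl], ?_⟩
    rw [ofDigits_concat, hv]
    rcases Nat.mod_two_eq_zero_or_one v with h | h <;> simp [h] <;> omega

namespace FP

variable {ι κ : Type} {x y z w : ι → List Bool}

theorem toBits {n : ι → ℕ} (hn : FP x fun i => unary (n i)) (h : FP x y) :
    FP x fun i => enc (PRC.toBits (n i) (y i)) :=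
  (take hn (h.append (replicate hn false))).congr fun _ => (enc_toBits _ _).symm

theorem enc_append {a b : ι → ℕ} {u : ∀ i, Bits (a i)} {v : ∀ i, Bits (b i)}
    (hu : FP x fun i => enc (u i)) (hv : FP x fun i => enc (v i)) :
    FP x fun i => enc (Fin.append (u i) (v i) : Bits (a i + b i)) :=
  (hu.append hv).congr fun _ => (PRC.enc_append _ _).symm

theorem enc_left {a b : ι → ℕ} {u : ∀ i, Bits (a i + b i)} (ha : FP x fun i => unary (a i))
    (hu : FP x fun i => enc (u i)) : FP x fun i => enc (u i).left :=
  (take ha hu).congr fun _ => (PRC.enc_left _).symm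

theorem enc_right {a b : ι → ℕ} {u : ∀ i, Bits (a i + b i)} (ha : FP x fun i => unary (a i))
    (hu : FP x fun i => enc (u i)) : FP x fun i => enc (u i).right :=
  (drop ha hu).congr fun _ => (PRC.enc_right _).symm

section Cases

variable {α β : ι → Type} [∀ i, BitEncoding (α i)] [∀ i, BitEncoding (β i)]

theorem option_cases {o : ∀ i, Option (α i)} (h : FP x fun i => enc (o i))
    (hn : ∀ Y : {i // (o i).isSome = false} → List Bool, FP Y (fun i => x i) → FP Y fun i => y i)
    (hs : ∀ Y : {i // (o i).isSome = true} → List Bool, FP Y (fun i => x i) →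
      FP Y (fun i => enc ((o i).get i.2)) → FP Y fun i => y i) : FP x y := by
  refine of_cond (c := fun i => (o i).isSome) ((h.of_head? fun b => [b.getD false]).congr fun i => ?_)
    (fun Y hY => hs Y hY ?_) hn
  · cases o i <;> rfl
  · refine (hY.comp (h.reindex Subtype.val)).tail.congr fun i => ?_
    obtain ⟨a, ha⟩ := Option.isSome_iff_exists.1 i.2
    simp only [ha, enc_some, Option.get_some, List.tail_cons]

theorem enc_some' {a : ∀ i, α i} (h : FP x fun i => enc (a i)) : FP x fun i => enc (some (a i)) :=
  (h.cons true).congr fun _ => (enc_some _).symm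

theorem sum_cases {o : ∀ i, α i ⊕ β i} (h : FP x fun i => enc (o i))
    (hl : ∀ Y : {i // (o i).isLeft = true} → List Bool, FP Y (fun i => x i) →
      FP Y (fun i => enc ((o i).getLeft i.2)) → FP Y fun i => y i)
    (hr : ∀ Y : {i // (o i).isRight = true} → List Bool, FP Y (fun i => x i) →
      FP Y (fun i => enc ((o i).getRight i.2)) → FP Y fun i => y i) : FP x y := by
  refine of_cond (c := fun i => (o i).isLeft) ((h.of_head? fun b => [!b.getD false]).congr fun i => ?_)
    (fun Y hY => hl Y hY ?_) fun Y hY => ?_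
  · rcases o i with a | a <;> rfl
  · refine (hY.comp (h.reindex Subtype.val)).tail.congr fun i => ?_
    obtain ⟨a, ha⟩ := Sum.isLeft_iff.1 i.2
    simp only [ha, enc_inl, Sum.getLeft_inl, List.tail_cons]
  · let φ : {i // (o i).isRight = true} → {i // (o i).isLeft = false} :=
      fun i => ⟨i.1, by have := i.2; rcases hi : o i.1 with a | a <;> simp [hi] at this ⊢⟩
    let ψ : {i // (o i).isLeft = false} → {i // (o i).isRight = true} :=
      fun i => ⟨i.1, by have := i.2; rcases hi : o i.1 with a | a <;> simp [hi] at this ⊢⟩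
    refine (hr (fun i => Y (φ i)) (hY.reindex φ) ?_).reindex ψ
    refine ((hY.reindex φ).comp (h.reindex Subtype.val)).tail.congr fun i => ?_
    obtain ⟨a, ha⟩ := Sum.isRight_iff.1 i.2
    simp only [ha, enc_inr, Sum.getRight_inr, List.tail_cons]

end Cases

theorem logBound {q : ι → ℕ} (hq : FP x fun i => unary (q i)) :
    FP x fun i => unary (PRC.logBound (q i) (q i)) := by
  refine fst (z := fun i => unary (2 ^ PRC.logBound (q i) (q i)))
    -- The power is carried along in unary, so that the comparison with `q` and the doubling are
    -- immediate; it never exceeds `2 * q + 1`.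
    (iterate (st := fun i j => pc (unary (PRC.logBound (q i) j)) (unary (2 ^ PRC.logBound (q i) j)))
      hq (const (pc (unary 0) (unary 1))) (fun Y hj hs hx => ?_) ?_)
  · have h1 := hs.fst
    have h2 := hs.snd
    refine ((le h2 (hx.comp (hq.reindex Sigma.fst))).ite ((h1.cons true).pair (h2.append h2))
      hs).congr fun a => ?_
    rw [PRC.logBound]
    by_cases h : 2 ^ PRC.logBound (q a.1) a.2 ≤ q a.1
    · simp only [h, decide_true, if_true, ← unary_succ, ← PRC.unary_add, pow_succ, mul_two]
    · simp [h]
  · have h := ((((PolyBdd.const 2).mul hq.length).add (.const 1)).reindex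
      (fun a : (i : ι) × Fin (q i + 1) => a.1))
    refine ((((PolyBdd.const 2).mul h).add h).add (.const 1)).mono fun a => ?_
    simp only [length_pc, length_unary]
    have h1 := two_pow_logBound_le (q a.1) a.2
    have h2 := logBound_le (q a.1) a.2
    omega

/-- The unary value of a digit string can be exponential in its length; `hy` restricts to strings
short enough for the value to stay below a number available in unary. -/
theorem ofDigits {q : ι → ℕ} (hq : FP x fun i => unary (q i)) (h : FP x y)
    (hy : ∀ i, 2 ^ (y i).length ≤ q i) : FP x fun i => unary (PRC.ofDigits (y i)) := by
  refine FP.congr (iterate (st := fun i j => unary (PRC.ofDigits ((y i).take j))) h.unary_length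
    (nil.congr fun i => by simp [PRC.ofDigits, unary]) (fun Y hj hs hx => ?_) ?_)
    fun i => by rw [List.take_length]
  · have h1 := drop hj (hx.comp (h.reindex Sigma.fst))
    refine ((hs.append hs).append (h1.of_head? fun b => unary (b.getD false).toNat)).congr
      fun a => ?_
    have ha : (a.2 : ℕ) < (y a.1).length := a.2.2
    rw [List.take_add_one, List.head?_drop, List.getElem?_eq_getElem ha, Option.toList_some,
      ofDigits_concat, PRC.unary_add, PRC.unary_add, Option.getD_some]
  · refine (hq.length.reindex Sigma.fst).mono fun a => ?_
    simp only [length_unary]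
    refine (ofDigits_lt _).le.trans (le_trans ?_ (hy a.1))
    exact Nat.pow_le_pow_right (by norm_num) (by simp)

open Classical in
theorem close {δ : ℝ} {N : ι → ℕ} {c : ∀ i, Bits (N i)} (hN : FP x fun i => unary (N i))
    (hd : FP x fun i => unary ⌊δ * (N i : ℝ)⌋₊) (hc : FP x fun i => enc (c i)) (hy : FP x y) :
    FP x fun i => [decide (Close δ (c i) (y i))] := by
  have hl := hy.unary_length.eq_length hN
  rcases le_or_gt 0 δ with hδ | hδ
  · refine (bit₂ and hl ((hc.zipWith xor hy).count.le hd)).congr fun i => ?_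
    rw [← Bool.decide_and]
    congr 2
    rw [Close, Nat.le_floor_iff (by positivity)]
    rfl
  -- For negative `δ` the natural floor is `0` and would wrongly allow equality. The weight
  -- condition then holds only for length `0`, so the length is tested instead.
  · refine (bit₂ and hl (hN.eq_length (const (unary 0)))).congr fun i => ?_
    rw [← Bool.decide_and]
    congr 2
    refine propext ⟨fun h => ⟨h.1, ?_⟩, fun h => ⟨h.1, ?_⟩⟩
    · have h1 : (y i).length = 0 := h.1.trans h.2
      rw [List.length_eq_zero_iff.1 h1]
      simp [h.2]
    · by_contra hne
      have hpos : (0 : ℝ) < N i := by exact_mod_cast Nat.pos_of_ne_zero hne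
      have h2 := h.2
      have h3 : (0 : ℝ) ≤ ((List.zipWith xor (List.ofFn (c i)) (y i)).count true : ℝ) := by positivity
      nlinarith [mul_pos_of_neg_of_neg hδ (neg_neg_of_pos hpos)]

end FP

namespace KeyedFunction.Efficient

variable {inLen outLen : ℕ → ℕ} {F : KeyedFunction inLen outLen} {ι : Type} {x : ι → List Bool}
  {n : ι → ℕ}

theorem fp_keyGen (hF : F.Efficient) (hn : FP x fun i => unary (n i))
    {u : ∀ i, Bits (F.keyCoins (n i))} (hu : FP x fun i => enc (u i)) :
    FP x fun i => enc (F.keyGen (n i) (u i)) :=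
  (hn.pack_cons (hu.pack_cons (l := fun _ => []) .pack_nil)).comp
    ((FP.of_polyTime hF.keyGen).reindex fun i => ⟨n i, u i⟩)

theorem fp_eval (hF : F.Efficient) (hn : FP x fun i => unary (n i))
    {u : ∀ i, Bits (F.keyLen (n i))} (hu : FP x fun i => enc (u i))
    {v : ∀ i, Bits (inLen (n i))} (hv : FP x fun i => enc (v i)) :
    FP x fun i => enc (F.eval (n i) (u i) (v i)) :=
  (hn.pack_cons (hu.pack_cons (hv.pack_cons (l := fun _ => []) .pack_nil))).comp
    ((FP.of_polyTime hF.eval).reindex fun i => ⟨n i, u i, v i⟩)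

end KeyedFunction.Efficient

namespace Code

variable {k : ℕ → ℕ}

namespace Efficient

variable {C : Code k} {ι : Type} {x : ι → List Bool} {n : ι → ℕ}

theorem fp_keyGen (hC : C.Efficient) (hn : FP x fun i => unary (n i))
    {u : ∀ i, Bits (C.keyCoins (n i))} (hu : FP x fun i => enc (u i)) :
    FP x fun i => enc (C.keyGen (n i) (u i)) :=
  (hn.pack_cons (hu.pack_cons (l := fun _ => []) .pack_nil)).comp
    ((FP.of_polyTime hC.keyGen).reindex fun i => ⟨n i, u i⟩)

theorem fp_encode (hC : C.Efficient) (hn : FP x fun i => unary (n i))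
    {u : ∀ i, Bits (C.skLen (n i))} (hu : FP x fun i => enc (u i))
    {m : ∀ i, Bits (k (n i))} (hm : FP x fun i => enc (m i))
    {r : ∀ i, Bits (C.encCoins (n i))} (hr : FP x fun i => enc (r i)) :
    FP x fun i => enc (C.encode (n i) (u i) (m i) (r i)) :=
  (hn.pack_cons (hu.pack_cons (hm.pack_cons (hr.pack_cons (l := fun _ => []) .pack_nil)))).comp
    ((FP.of_polyTime hC.encode).reindex fun i => ⟨n i, u i, m i, r i⟩)

theorem fp_decode (hC : C.Efficient) (hn : FP x fun i => unary (n i))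
    {u : ∀ i, Bits (C.skLen (n i))} (hu : FP x fun i => enc (u i))
    {y : ι → List Bool} (hy : FP x y)
    {r : ∀ i, Bits (C.decCoins (n i))} (hr : FP x fun i => enc (r i)) :
    FP x fun i => enc (C.decode (n i) (u i) (y i) (r i)) :=
  (hn.pack_cons (hu.pack_cons (hy.pack_cons (hr.pack_cons (l := fun _ => []) .pack_nil)))).comp
    ((FP.of_polyTime hC.decode).reindex fun i => ⟨n i, u i, y i, r i⟩)

end Efficient

end Code

end PRC

namespace PRC

open BitEncoding (enc)

/-! ### Adversaries that simulate other adversaries -/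

namespace Adversary

/-- To show that a function of the view of an adversary is efficient. -/
theorem polyTime_view {Q A R : ℕ → Type} [∀ n, BitEncoding (A n)] {𝒜 : Adversary Q A R}
    {y : (n : ℕ) × (Bits (𝒜.coins n) × List (A n)) → List Bool}
    (h : ∀ X : (n : ℕ) × (Bits (𝒜.coins n) × List (A n)) → List Bool,
      (FP X fun i => unary i.1) → (FP X fun i => enc i.2.1) →
      (FP X fun i => pack (i.2.2.map enc)) → FP X y) : PolyTime 𝒜.view y :=
  FP.polyTime <| h _ (FP.head_pack FP.id) (FP.head_pack (FP.tail_pack FP.id))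
    (FP.tail_pack (FP.tail_pack FP.id))

variable {Q A R : ℕ → Type} [∀ n, BitEncoding (Q n)] [∀ n, BitEncoding (A n)]
  [∀ n, BitEncoding (R n)] {𝒜 : Adversary Q A R} {ι : Type} {x : ι → List Bool} {n : ι → ℕ}

theorem Efficient.fp_next (h𝒜 : 𝒜.Efficient) (hn : FP x fun i => unary (n i))
    {ω : ∀ i, Bits (𝒜.coins (n i))} (hω : FP x fun i => enc (ω i)) {l : ∀ i, List (A (n i))}
    (hl : FP x fun i => pack ((l i).map enc)) :
    FP x fun i => enc (𝒜.next (n i) (ω i) (l i)) :=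
  (hn.pack_cons (hω.pack_cons hl)).comp
    ((FP.of_polyTime h𝒜.next).reindex fun i => ⟨n i, ω i, l i⟩)

theorem Efficient.fp_output (h𝒜 : 𝒜.Efficient) (hn : FP x fun i => unary (n i))
    {ω : ∀ i, Bits (𝒜.coins (n i))} (hω : FP x fun i => enc (ω i)) {l : ∀ i, List (A (n i))}
    (hl : FP x fun i => pack ((l i).map enc)) :
    FP x fun i => enc (𝒜.output (n i) (ω i) (l i)) :=
  (hn.pack_cons (hω.pack_cons hl)).comp
    ((FP.of_polyTime h𝒜.output).reindex fun i => ⟨n i, ω i, l i⟩)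

end Adversary

/-- A way to answer queries in `Q n` with the help of an oracle for queries in `Q' n`, which is
called exactly once for every query. The internal state is initialized with random coins. -/
structure Simulator (Q A Q' A' S : ℕ → Type) where
  extra : ℕ → ℕ
  start : (n : ℕ) → Bits (extra n) → S n
  ask : (n : ℕ) → S n → Q n → Q' n
  step : (n : ℕ) → S n → Q n → A' n → A n × S n

namespace Simulator

variable {Q A R Q' A' R' S : ℕ → Type}

structure Efficient [∀ n, BitEncoding (Q n)] [∀ n, BitEncoding (A n)] [∀ n, BitEncoding (Q' n)]
    [∀ n, BitEncoding (A' n)] [∀ n, BitEncoding (S n)] (σ : Simulator Q A Q' A' S) : Prop where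
  extra : PolyLen σ.extra
  start : ∀ {ι : Type} {x : ι → List Bool} {n : ι → ℕ} {u : ∀ i, Bits (σ.extra (n i))},
    (FP x fun i => unary (n i)) → (FP x fun i => enc (u i)) →
    FP x fun i => enc (σ.start (n i) (u i))
  ask : ∀ {ι : Type} {x : ι → List Bool} {n : ι → ℕ} {s : ∀ i, S (n i)} {q : ∀ i, Q (n i)},
    (FP x fun i => unary (n i)) → (FP x fun i => enc (s i)) → (FP x fun i => enc (q i)) →
    FP x fun i => enc (σ.ask (n i) (s i) (q i))
  answer : ∀ {ι : Type} {x : ι → List Bool} {n : ι → ℕ} {s : ∀ i, S (n i)} {q : ∀ i, Q (n i)}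
    {a : ∀ i, A' (n i)},
    (FP x fun i => unary (n i)) → (FP x fun i => enc (s i)) → (FP x fun i => enc (q i)) →
    (FP x fun i => enc (a i)) → FP x fun i => enc (σ.step (n i) (s i) (q i) (a i)).1
  state : ∀ {ι : Type} {x : ι → List Bool} {n : ι → ℕ} {s : ∀ i, S (n i)} {q : ∀ i, Q (n i)}
    {a : ∀ i, A' (n i)},
    (FP x fun i => unary (n i)) → (FP x fun i => enc (s i)) → (FP x fun i => enc (q i)) →
    (FP x fun i => enc (a i)) → FP x fun i => enc (σ.step (n i) (s i) (q i) (a i)).2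
  size : ∃ P : Polynomial ℕ, ∀ n s q a, (enc (σ.step n s q a).1).length ≤ P.eval n ∧
    (enc (σ.step n s q a).2).length ≤ (enc s).length + P.eval n

variable (σ : Simulator Q A Q' A' S) (𝒜 : Adversary Q A R)

/-- The answers for the simulated adversary and the state after one more oracle answer. -/
def replayStep (n : ℕ) (ω : Bits (𝒜.coins n)) (p : List (A n) × S n) (a : A' n) :
    List (A n) × S n :=
  match 𝒜.next n ω p.1 with
  | none => p
  | some q => (p.1 ++ [(σ.step n p.2 q a).1], (σ.step n p.2 q a).2)

/-- The answers for the simulated adversary and the state after the oracle answers `l`. -/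
def replay (n : ℕ) (ω : Bits (𝒜.coins n)) (s : S n) (l : List (A' n)) : List (A n) × S n :=
  l.foldl (σ.replayStep 𝒜 n ω) ([], s)

/-- The adversary that runs `𝒜`, answers its queries as described by `σ`, and finally applies
`out`. -/
def adversary (out : (n : ℕ) → Bits (𝒜.coins n) → List (A n) → S n → R' n) :
    Adversary Q' A' R' where
  coins n := 𝒜.coins n + σ.extra n
  queries := 𝒜.queries
  next n u l :=
    let p := σ.replay 𝒜 n u.left (σ.start n u.right) l
    (𝒜.next n u.left p.1).map (σ.ask n p.2)
  output n u l :=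
    let p := σ.replay 𝒜 n u.left (σ.start n u.right) l
    out n u.left p.1 p.2

variable {σ 𝒜} [∀ n, BitEncoding (A n)] [∀ n, BitEncoding (S n)]

/-- Answers have length at most `P.eval n` whatever the state is, and each step lengthens the state
by at most `P.eval n`. The growth is therefore linear in the number of answers, as needed for the
iteration in `Efficient.fp_replay`. -/
theorem size_replay {P : Polynomial ℕ}
    (hP : ∀ n s q a, (enc (σ.step n s q a).1).length ≤ P.eval n ∧
      (enc (σ.step n s q a).2).length ≤ (enc s).length + P.eval n)
    (n : ℕ) (ω : Bits (𝒜.coins n)) (s : S n) (l : List (A' n)) :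
    (pack ((σ.replay 𝒜 n ω s l).1.map enc)).length ≤ l.length * (2 * P.eval n + 1) ∧
    (enc (σ.replay 𝒜 n ω s l).2).length ≤ (enc s).length + l.length * P.eval n := by
  induction l using List.reverseRecOn with
  | nil => simp [replay, pack]
  | append_singleton l a ih =>
    rw [replay, List.foldl_append, List.foldl_cons, List.foldl_nil, ← replay, replayStep]
    obtain ⟨ih1, ih2⟩ := ih
    rw [List.length_append, List.length_singleton, add_mul, add_mul]
    split
    · constructor <;> omega
    · rename_i q hq
      obtain ⟨h1, h2⟩ := hP n (σ.replay 𝒜 n ω s l).2 q a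
      constructor
      · rw [List.map_append, List.map_singleton, pack_append, List.length_append, pack_cons,
          length_pc, pack_nil, List.length_nil]
        omega
      · simp only
        omega

variable [∀ n, BitEncoding (Q n)] [∀ n, BitEncoding (Q' n)] [∀ n, BitEncoding (A' n)]
    [∀ n, BitEncoding (R n)] [∀ n, BitEncoding (R' n)]

/-- An adversary keeps no state between queries: it sees only its coins and the answers so far. The
simulation therefore recomputes everything from the list of oracle answers each time. -/
theorem Efficient.fp_replay (hσ : σ.Efficient) (h𝒜 : 𝒜.Efficient) {ι : Type} {x : ι → List Bool}
    {n : ι → ℕ} {ω : ∀ i, Bits (𝒜.coins (n i))} {s : ∀ i, S (n i)} {l : ∀ i, List (A' (n i))}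
    (hn : FP x fun i => unary (n i)) (hω : FP x fun i => enc (ω i)) (hs : FP x fun i => enc (s i))
    (hl : FP x fun i => pack ((l i).map enc)) :
    FP x fun i => pc (pack ((σ.replay 𝒜 (n i) (ω i) (s i) (l i)).1.map enc))
      (enc (σ.replay 𝒜 (n i) (ω i) (s i) (l i)).2) := by
  have hlen : FP x fun i => unary (l i).length := hl.pack_length.congr fun i => by simp
  refine FP.congr (FP.iterate (N := fun i => (l i).length) (st := fun i j =>
      pc (pack ((σ.replay 𝒜 (n i) (ω i) (s i) ((l i).take j)).1.map enc))
      (enc (σ.replay 𝒜 (n i) (ω i) (s i) ((l i).take j)).2)) hlen ?_ (fun Y hj hst hx => ?_) ?_)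
    fun i => by rw [List.take_length]
  · exact (FP.nil.pair hs).congr fun i => by simp [replay, pack]
  · have hn' := hx.comp (hn.reindex Sigma.fst)
    have hω' := hx.comp (hω.reindex Sigma.fst)
    have ha : FP Y fun a => enc ((l a.1)[a.2]) :=
      (hj.pack_getElem? (hx.comp (hl.reindex Sigma.fst))).congr fun a => by simp
    have e : ∀ a : (i : ι) × Fin (l i).length,
        σ.replay 𝒜 (n a.1) (ω a.1) (s a.1) ((l a.1).take (a.2 + 1)) =
        σ.replayStep 𝒜 (n a.1) (ω a.1)
          (σ.replay 𝒜 (n a.1) (ω a.1) (s a.1) ((l a.1).take a.2)) ((l a.1)[a.2]) := by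
      intro a
      rw [List.take_add_one, List.getElem?_eq_getElem a.2.2, replay, List.foldl_append]
      rfl
    simp only [e]
    refine FP.option_cases (h𝒜.fp_next hn' hω' hst.fst) (fun Z hZ => ?_) fun Z hZ hq => ?_
    · refine (hZ.comp (hst.reindex Subtype.val)).congr fun a => ?_
      have h := a.2
      rw [Option.isSome_eq_false_iff, Option.isNone_iff_eq_none] at h
      rw [replayStep, h]
    · have hn'' := hZ.comp (hn'.reindex Subtype.val)
      have hst' := hZ.comp (hst.reindex Subtype.val)
      have ha' := hZ.comp (ha.reindex Subtype.val)
      have h1 := hσ.answer hn'' hst'.snd hq ha'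
      have h2 := hσ.state hn'' hst'.snd hq ha'
      refine ((hst'.fst.append (h1.pack_cons (l := fun _ => []) .pack_nil)).pair h2).congr
        fun a => ?_
      obtain ⟨q, h⟩ := Option.isSome_iff_exists.1 a.2
      rw [replayStep]
      simp only [h, Option.get_some, List.map_append, List.map_singleton, pack_append]
  · obtain ⟨P, hP⟩ := hσ.size
    have hb := hlen.length
    have hb2 := hn.length
    have hb3 := hs.length
    simp only [length_unary] at hb hb2
    have h1 := hb.mul ((hb2.eval P).add (.const 1))
    refine ((((((PolyBdd.const 10).mul h1).add hb3).add (.const 1)).reindex Sigma.fst).mono ?_ :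
      PolyBdd _ _)
    rintro ⟨i, j⟩
    obtain ⟨h1, h2⟩ := size_replay hP (n i) (ω i) (s i) ((l i).take j) (𝒜 := 𝒜)
    have hj : ((l i).take j).length ≤ (l i).length := by simp
    have h3 := Nat.mul_le_mul_right (P.eval (n i)) hj
    simp only [length_pc]
    simp only [mul_add] at h1 ⊢
    rw [mul_left_comm] at h1
    simp only [mul_one] at h1 ⊢
    omega

theorem Efficient.adversary (hσ : σ.Efficient) (h𝒜 : 𝒜.Efficient)
    {out : (n : ℕ) → Bits (𝒜.coins n) → List (A n) → S n → R' n}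
    (hout : ∀ {ι : Type} {x : ι → List Bool} {n : ι → ℕ} {ω : ∀ i, Bits (𝒜.coins (n i))}
      {l : ∀ i, List (A (n i))} {s : ∀ i, S (n i)},
      (FP x fun i => unary (n i)) → (FP x fun i => enc (ω i)) →
      (FP x fun i => pack ((l i).map enc)) → (FP x fun i => enc (s i)) →
      FP x fun i => enc (out (n i) (ω i) (l i) (s i))) :
    (σ.adversary 𝒜 out).Efficient where
  coins := .of_fp fun X hn => (h𝒜.coins.fp hn).unary_add (hσ.extra.fp hn)
  queries := h𝒜.queries
  next := Adversary.polyTime_view fun X hn hu hl => by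
    have hω := FP.enc_left (b := fun i => σ.extra i.1) (h𝒜.coins.fp hn) hu
    have hs := hσ.start hn (FP.enc_right (b := fun i => σ.extra i.1) (h𝒜.coins.fp hn) hu)
    have hp := hσ.fp_replay h𝒜 hn hω hs hl
    refine FP.option_cases (h𝒜.fp_next hn hω hp.fst) (fun Z hZ => ?_) fun Z hZ hq => ?_
    · refine (FP.const [false]).congr fun a => ?_
      have h := a.2
      rw [Option.isSome_eq_false_iff, Option.isNone_iff_eq_none] at h
      simp only [Simulator.adversary, h, Option.map_none]
      rfl
    · have hn' := hZ.comp (hn.reindex Subtype.val)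
      have hp' := hZ.comp (hp.reindex Subtype.val)
      refine (hσ.ask hn' hp'.snd hq).enc_some'.congr fun a => ?_
      obtain ⟨q, h⟩ := Option.isSome_iff_exists.1 a.2
      simp only [Simulator.adversary, h, Option.map_some, Option.get_some]
  output := Adversary.polyTime_view fun X hn hu hl => by
    have hω := FP.enc_left (b := fun i => σ.extra i.1) (h𝒜.coins.fp hn) hu
    have hs := hσ.start hn (FP.enc_right (b := fun i => σ.extra i.1) (h𝒜.coins.fp hn) hu)
    have hp := hσ.fp_replay h𝒜 hn hω hs hl
    exact hout hn hω hp.fst hp.snd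

end Simulator

end PRC

/-! ### Searching in lists, and efficiency of the transformed code. -/

namespace PRC

open BitEncoding (enc)

instance {α β : Type} [BitEncoding α] [BitEncoding β] : BitEncoding (α × β) :=
  ⟨fun p => pc (enc p.1) (enc p.2)⟩

theorem enc_prod {α β : Type} [BitEncoding α] [BitEncoding β] (p : α × β) :
    enc p = pc (enc p.1) (enc p.2) := rfl

namespace FP

variable {ι : Type} {x : ι → List Bool}

theorem find? {α : ι → Type} [∀ i, BitEncoding (α i)] {l : ∀ i, List (α i)}
    {p : ∀ i, α i → Bool} (hl : FP x fun i => pack ((l i).map enc))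
    (hp : ∀ {κ : Type} {Y : κ → List Bool} {φ : κ → ι} {e : ∀ a, α (φ a)},
      (FP Y fun a => x (φ a)) → (FP Y fun a => enc (e a)) → FP Y fun a => [p (φ a) (e a)]) :
    FP x fun i => enc ((l i).find? (p i)) := by
  have hlen : FP x fun i => unary (l i).length := hl.pack_length.congr fun i => by simp
  refine FP.congr (FP.iterate (N := fun i => (l i).length)
    (st := fun i j => enc (((l i).take j).find? (p i))) hlen ?_ (fun Y hj hs hx => ?_) ?_)
    fun i => by rw [List.take_length]
  · exact (const [false]).congr fun i => by simp [enc_none]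
  · refine option_cases hs (fun Z hZ => ?_) fun Z hZ he => ?_
    · have he : FP Z fun a => enc ((l a.1.1)[a.1.2]) :=
        ((hZ.comp (hj.reindex Subtype.val)).pack_getElem?
          (hZ.comp (hx.reindex Subtype.val) |>.comp (hl.reindex _))).congr fun a => by simp
      refine ((hp (φ := fun a => a.1.1) (hZ.comp (hx.reindex Subtype.val)) he).ite he.enc_some'
        (const [false])).congr fun a => ?_
      have h := a.2
      rw [Option.isSome_eq_false_iff, Option.isNone_iff_eq_none] at h
      rw [List.take_add_one, List.find?_append, h, List.getElem?_eq_getElem a.1.2.2]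
      simp only [Option.toList_some, List.find?_singleton, Option.none_or, Fin.getElem_fin]
      split_ifs <;> rfl
    · refine (hZ.comp (hs.reindex Subtype.val)).congr fun a => ?_
      obtain ⟨q, h⟩ := Option.isSome_iff_exists.1 a.2
      rw [List.take_add_one, List.find?_append, h, Option.some_or]
  · refine ((hl.length.add (.const 1)).reindex Sigma.fst).mono fun a => ?_
    have h2 : ∀ e ∈ l a.1, (enc e).length ≤ (pack ((l a.1).map enc)).length := by
      intro e he
      obtain ⟨l1, l2, h⟩ := List.append_of_mem he
      rw [h, List.map_append, List.map_cons, PRC.pack_append, PRC.pack_cons, List.length_append,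
        length_pc]
      omega
    rcases h : ((l a.1).take a.2).find? (p a.1) with _ | e
    · simp [enc_none]
    · have := h2 e (List.mem_of_mem_take (List.mem_of_find?_eq_some h))
      simp only [enc_some, List.length_cons]
      omega

theorem isSome {α : ι → Type} [∀ i, BitEncoding (α i)] {o : ∀ i, Option (α i)}
    (h : FP x fun i => enc (o i)) : FP x fun i => [(o i).isSome] :=
  (h.of_head? fun b => [b.getD false]).congr fun i => by cases o i <;> rfl

theorem beq_bits {n : ι → ℕ} {u v : ∀ i, Bits (n i)} (hu : FP x fun i => enc (u i))
    (hv : FP x fun i => enc (v i)) : FP x fun i => [decide (u i = v i)] :=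
  (beq hu hv).congr fun i => by simp only [enc_injective.eq_iff]

end FP

namespace Code

variable {k : ℕ → ℕ}

/-- Messages of the underlying code are `r‖m‖R₂`. -/
abbrev Msg (k : ℕ → ℕ) (n : ℕ) : Type := Bits (n + k n + n)

/-- The message `r‖m‖R₂`. -/
def mkMsg {n : ℕ} (p : Bits (n + k n)) (R : Bits n) : Msg k n := Fin.append p R

/-- The `m` in `r‖m‖R₂`. -/
def Msg.text {n : ℕ} (M : Msg k n) : Bits (k n) := Bits.right (Bits.left M : Bits (n + k n))

/-- The `r‖m` in `r‖m‖R₂`. -/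
def Msg.point {n : ℕ} (M : Msg k n) : Bits (n + k n) := Bits.left M

variable (C : Code fun n => n + k n + n) (δ : ℝ)

/-- The codeword of `r‖m`, given the function value at `r‖m`. -/
def encodeWith (n : ℕ) (sk : Bits (C.skLen n)) (p : Bits (n + k n)) (y : Bits (C.encCoins n + n)) :
    Bits (C.cwLen n) :=
  C.encode n sk (mkMsg p y.right) y.left

open Classical in
/-- The decoder that checks the tag and re-encodes, for an arbitrary function `f`. -/
noncomputable def decodeWith (n : ℕ) (f : Bits (n + k n) → Bits (C.encCoins n + n))
    (sk : Bits (C.skLen n)) (x : List Bool) (w : Bits (C.decCoins n)) : Option (Bits (k n)) :=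
  match C.decode n sk x w with
  | none => none
  | some M =>
    if (f (Msg.point M)).right = Bits.right M ∧
      Close δ (C.encode n sk M (f (Msg.point M)).left) x then some (Msg.text M) else none

variable {C δ} {ι : Type} {x : ι → List Bool} {n : ι → ℕ}

theorem fp_point (hn : FP x fun i => unary (n i)) (hk : PolyLen k) {M : ∀ i, Msg k (n i)}
    (hM : FP x fun i => enc (M i)) : FP x fun i => enc (M i).point :=
  FP.enc_left (hn.unary_add (hk.fp hn)) hM

theorem fp_text (hn : FP x fun i => unary (n i)) (hk : PolyLen k) {M : ∀ i, Msg k (n i)}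
    (hM : FP x fun i => enc (M i)) : FP x fun i => enc (M i).text :=
  FP.enc_right hn (fp_point hn hk hM)

theorem fp_mkMsg {p : ∀ i, Bits (n i + k (n i))} (hp : FP x fun i => enc (p i))
    {R : ∀ i, Bits (n i)} (hR : FP x fun i => enc (R i)) :
    FP x fun i => enc (mkMsg (p i) (R i)) :=
  FP.enc_append hp hR

theorem polyLen_of_tagged (h : PolyLen fun n => n + k n + n) : PolyLen k :=
  .of_fp fun _ hX => (((h.fp hX).unary_sub hX).unary_sub hX).congr fun n => by congr 1; omega

theorem fp_encodeWith (hC : C.Efficient) (hn : FP x fun i => unary (n i))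
    {sk : ∀ i, Bits (C.skLen (n i))} (hsk : FP x fun i => enc (sk i))
    {p : ∀ i, Bits (n i + k (n i))} (hp : FP x fun i => enc (p i))
    {y : ∀ i, Bits (C.encCoins (n i) + n i)} (hy : FP x fun i => enc (y i)) :
    FP x fun i => enc (C.encodeWith (n i) (sk i) (p i) (y i)) :=
  hC.fp_encode hn hsk (fp_mkMsg hp (FP.enc_right (hC.encCoins.fp hn) hy))
    (FP.enc_left (hC.encCoins.fp hn) hy)

/-- The function is required to be computable only at the point of the decoded message. This covers
both the keyed function and, in the simulation, a single answer of the function oracle. -/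
theorem fp_decodeWith (hC : C.Efficient) (hδ : PolyLen fun n => ⌊δ * (C.cwLen n : ℝ)⌋₊)
    (hn : FP x fun i => unary (n i))
    {sk : ∀ i, Bits (C.skLen (n i))} (hsk : FP x fun i => enc (sk i))
    {y : ι → List Bool} (hy : FP x y)
    {w : ∀ i, Bits (C.decCoins (n i))} (hw : FP x fun i => enc (w i))
    {f : ∀ i, Bits (n i + k (n i)) → Bits (C.encCoins (n i) + n i)}
    (hf : ∀ {κ : Type} {Y : κ → List Bool} {φ : κ → ι}
      {M : ∀ a, Msg k (n (φ a))}, (∀ a, C.decode (n (φ a)) (sk (φ a)) (y (φ a)) (w (φ a)) = some (M a)) →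
      (FP Y fun a => x (φ a)) → (FP Y fun a => enc (M a)) →
      FP Y fun a => enc (f (φ a) (M a).point)) :
    FP x fun i => enc (C.decodeWith δ (n i) (f i) (sk i) (y i) (w i)) := by
  classical
  have hk := polyLen_of_tagged hC.msgLen
  refine FP.option_cases (hC.fp_decode hn hsk hy hw) (fun Z hZ => ?_) fun Z hZ hM => ?_
  · refine (FP.const [false]).congr fun a => ?_
    have h := a.2
    rw [Option.isSome_eq_false_iff, Option.isNone_iff_eq_none] at h
    rw [decodeWith, h]
    rfl
  · have hn' := hZ.comp (hn.reindex Subtype.val)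
    have hsk' := hZ.comp (hsk.reindex Subtype.val)
    have hy' := hZ.comp (hy.reindex Subtype.val)
    have hR := hf (φ := Subtype.val) (M := fun a => (C.decode _ _ _ _).get a.2)
      (fun a => by rw [Option.some_get]) hZ hM
    have hρ := hC.encCoins.fp hn'
    have h1 := FP.beq_bits (FP.enc_right hρ hR)
      (FP.enc_right (hn'.unary_add (hk.fp hn')) hM)
    have h2 := FP.close (hC.cwLen.fp hn') (hδ.fp hn')
      (hC.fp_encode hn' hsk' hM (FP.enc_left hρ hR)) hy'
    refine (((FP.bit₂ and h1 h2).ite (fp_text hn' hk hM).enc_some' (FP.const [false])).congr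
      fun a => ?_)
    obtain ⟨M, h⟩ := Option.isSome_iff_exists.1 a.2
    rw [decodeWith]
    simp only [h, Option.get_some, ← Bool.decide_and, decide_eq_true_eq]
    split_ifs <;> rfl

theorem sharp_encode (F : KeyedFunction (fun n => n + k n) (fun n => C.encCoins n + n)) (n : ℕ)
    (sk : Bits (F.keyLen n + C.skLen n)) (m : Bits (k n)) (r : Bits n) :
    (C.sharp F δ).encode n sk m r =
      C.encodeWith n sk.right (Fin.append r m) (F.eval n sk.left (Fin.append r m)) := rfl

theorem sharp_decode (F : KeyedFunction (fun n => n + k n) (fun n => C.encCoins n + n)) (n : ℕ)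
    (sk : Bits (F.keyLen n + C.skLen n)) (x : List Bool) (w : Bits (C.decCoins n)) :
    (C.sharp F δ).decode n sk x w = C.decodeWith δ n (F.eval n sk.left) sk.right x w := rfl

theorem sharp_efficient {F : KeyedFunction (fun n => n + k n) (fun n => C.encCoins n + n)}
    (hδ : PolyLen fun n => ⌊δ * (C.cwLen n : ℝ)⌋₊) (hC : C.Efficient) (hF : F.Efficient) :
    (C.sharp F δ).Efficient where
  msgLen := polyLen_of_tagged hC.msgLen
  skLen := .of_fp fun _ hn => (hF.keyLen.fp hn).unary_add (hC.skLen.fp hn)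
  cwLen := hC.cwLen
  keyCoins := .of_fp fun _ hn => (hF.keyCoins.fp hn).unary_add (hC.keyCoins.fp hn)
  encCoins := .of_fp fun _ hn => hn
  decCoins := hC.decCoins
  keyGen := FP.polyTime <| by
    have hn : FP (fun i : (n : ℕ) × Bits (F.keyCoins n + C.keyCoins n) =>
      pack [unary i.1, enc i.2]) fun i => unary i.1 := FP.id.head_pack
    have hu : FP (fun i : (n : ℕ) × Bits (F.keyCoins n + C.keyCoins n) =>
      pack [unary i.1, enc i.2]) fun i => enc i.2 := FP.id.tail_pack.head_pack
    exact FP.enc_append (hF.fp_keyGen hn (FP.enc_left (hF.keyCoins.fp hn) hu))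
      (hC.fp_keyGen hn (FP.enc_right (hF.keyCoins.fp hn) hu))
  encode := FP.polyTime <| by
    let X := fun i : (n : ℕ) × (Bits (F.keyLen n + C.skLen n) × Bits (k n) × Bits n) =>
      pack [unary i.1, enc i.2.1, enc i.2.2.1, enc i.2.2.2]
    have hn : FP X fun i => unary i.1 := FP.id.head_pack
    have hsk : FP X fun i => enc i.2.1 := FP.id.tail_pack.head_pack
    have hm : FP X fun i => enc i.2.2.1 := FP.id.tail_pack.tail_pack.head_pack
    have hr : FP X fun i => enc i.2.2.2 := FP.id.tail_pack.tail_pack.tail_pack.head_pack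
    have hl := hF.keyLen.fp hn
    have hp := FP.enc_append hr hm
    exact fp_encodeWith hC hn (FP.enc_right hl hsk) hp (hF.fp_eval hn (FP.enc_left hl hsk) hp)
  decode := FP.polyTime <| by
    let X := fun i : (n : ℕ) × (Bits (F.keyLen n + C.skLen n) × List Bool × Bits (C.decCoins n)) =>
      pack [unary i.1, enc i.2.1, enc i.2.2.1, enc i.2.2.2]
    have hn : FP X fun i => unary i.1 := FP.id.head_pack
    have hsk : FP X fun i => enc i.2.1 := FP.id.tail_pack.head_pack
    have hm : FP X fun i => enc i.2.2.1 := FP.id.tail_pack.tail_pack.head_pack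
    have hr : FP X fun i => enc i.2.2.2 := FP.id.tail_pack.tail_pack.tail_pack.head_pack
    have hl := hF.keyLen.fp hn
    exact fp_decodeWith (f := fun i => F.eval i.1 i.2.1.left) hC hδ hn (FP.enc_right hl hsk) hm hr
      fun _ hY hM => hF.fp_eval (hY.comp (hn.reindex _))
        (hY.comp ((FP.enc_left hl hsk).reindex _))
        (fp_point (hY.comp (hn.reindex _)) (polyLen_of_tagged hC.msgLen) hM)

end Code

end PRC

namespace PRC

open BitEncoding (enc)

namespace Code

variable {k : ℕ → ℕ} (C : Code fun n => n + k n + n) (δ : ℝ) (q : ℕ → ℕ)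

theorem enc_list (l : List Bool) : enc l = l := rfl

theorem length_enc_option_bits {n : ℕ} (o : Option (Bits n)) : (enc o).length ≤ n + 1 := by
  cases o with
  | none => simp [enc_none]
  | some a => simp [enc_some, length_enc_bits]

/-! ### The reduction to the pseudorandom function -/

/-- Simulation of the code, with an oracle in place of the keyed function. The state is the key
and the unused random bits. -/
noncomputable def functionSimulator : Simulator (fun n => Bits (k n) ⊕ List Bool)
    (fun n => Bits (C.cwLen n) ⊕ Option (Bits (k n))) (fun n => Bits (n + k n))
    (fun n => Bits (C.encCoins n + n)) (fun n => Bits (C.skLen n) × List Bool) where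
  extra n := C.keyCoins n + q n * (n + C.decCoins n)
  start n u := (C.keyGen n u.left, enc u.right)
  ask n s
    | Sum.inl m => Fin.append (toBits n s.2) m
    | Sum.inr x =>
      match C.decode n s.1 x (toBits _ (s.2.drop n)) with
      -- The interface calls the oracle for every query; if decoding has already failed, a dummy
      -- point is asked and the answer has no effect.
      | none => fun _ => false
      | some M => Msg.point M
  step n s a y :=
    (match a with
      | Sum.inl m => Sum.inl (C.encodeWith n s.1 (Fin.append (toBits n s.2) m) y)
      | Sum.inr x => Sum.inr (C.decodeWith δ n (fun _ => y) s.1 x (toBits _ (s.2.drop n))),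
      s.1, s.2.drop (n + C.decCoins n))

variable {C δ q}

theorem functionSimulator_efficient (hC : C.Efficient)
    (hδ : PolyLen fun n => ⌊δ * (C.cwLen n : ℝ)⌋₊) (hq : PolyLen q) :
    (C.functionSimulator δ q).Efficient where
  extra := .of_fp fun _ hn => (hC.keyCoins.fp hn).unary_add
    ((hq.fp hn).unary_mul (hn.unary_add (hC.decCoins.fp hn)))
  start hn hu := FP.pair (hC.fp_keyGen hn (FP.enc_left (hC.keyCoins.fp hn) hu))
    (FP.enc_right (hC.keyCoins.fp hn) hu)
  ask {ι x n s a} hn hs ha := by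
    refine FP.sum_cases ha (fun Y hY hm => ?_) fun Y hY hx => ?_
    · have hn' := hY.comp (hn.reindex Subtype.val)
      have ht := hY.comp ((FP.snd hs).reindex Subtype.val)
      refine (FP.enc_append (FP.toBits hn' ht) hm).congr fun i => ?_
      obtain ⟨m, h⟩ := Sum.isLeft_iff.1 i.2
      simp only [h, functionSimulator, Sum.getLeft_inl, enc_list]
    · have hn' := hY.comp (hn.reindex Subtype.val)
      have hsk := hY.comp ((FP.fst hs).reindex Subtype.val)
      have ht := hY.comp ((FP.snd hs).reindex Subtype.val)
      have hw := FP.toBits (hC.decCoins.fp hn') (FP.drop hn' ht)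
      have hk := polyLen_of_tagged hC.msgLen
      refine FP.option_cases (hC.fp_decode hn' hsk hx hw) (fun Z hZ => ?_) fun Z hZ hM => ?_
      · refine (FP.replicate ((hZ.comp (hn'.reindex _)).unary_add
          (hk.fp (hZ.comp (hn'.reindex _)))) false).congr fun i => ?_
        obtain ⟨x, h⟩ := Sum.isRight_iff.1 i.1.2
        have h2 := i.2
        rw [Option.isSome_eq_false_iff, Option.isNone_iff_eq_none] at h2
        simp only [h, Sum.getRight_inr] at h2
        rw [enc_list, enc_list] at h2
        simp only [h, functionSimulator, h2]
        exact (List.ofFn_const _ _).symm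
      · refine (fp_point (hZ.comp (hn'.reindex _)) hk hM).congr fun i => ?_
        obtain ⟨x, h⟩ := Sum.isRight_iff.1 i.1.2
        obtain ⟨M, h2⟩ := Option.isSome_iff_exists.1 i.2
        simp only [h, Sum.getRight_inr] at h2
        rw [enc_list, enc_list] at h2
        simp only [h, functionSimulator, h2, Sum.getRight_inr, Option.get_some, enc_list]
  answer {ι x n s a y} hn hs ha hy := by
    refine FP.sum_cases ha (fun Y hY hm => ?_) fun Y hY hx => ?_
    · have hn' := hY.comp (hn.reindex Subtype.val)
      have hsk := hY.comp ((FP.fst hs).reindex Subtype.val)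
      have ht := hY.comp ((FP.snd hs).reindex Subtype.val)
      have hy' := hY.comp (hy.reindex Subtype.val)
      refine (FP.cons (fp_encodeWith hC hn' hsk (FP.enc_append (FP.toBits hn' ht) hm) hy')
        false).congr fun i => ?_
      obtain ⟨m, h⟩ := Sum.isLeft_iff.1 i.2
      simp only [h, functionSimulator, Sum.getLeft_inl, enc_inl, enc_list]
    · have hn' := hY.comp (hn.reindex Subtype.val)
      have hsk := hY.comp ((FP.fst hs).reindex Subtype.val)
      have ht := hY.comp ((FP.snd hs).reindex Subtype.val)
      have hy' := hY.comp (hy.reindex Subtype.val)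
      have hw := FP.toBits (hC.decCoins.fp hn') (FP.drop hn' ht)
      refine (FP.cons (fp_decodeWith (f := fun i _ => y i.1) hC hδ hn' hsk hx hw
        fun _ hZ _ => hZ.comp (hy'.reindex _)) true).congr fun i => ?_
      obtain ⟨x, h⟩ := Sum.isRight_iff.1 i.2
      simp only [h, functionSimulator, Sum.getRight_inr, enc_inr, enc_list]
  state {ι x n s a y} hn hs ha hy := FP.pair (FP.fst hs)
    (FP.drop (hn.unary_add (hC.decCoins.fp hn)) (FP.snd hs))
  size := by
    obtain ⟨P, hP⟩ := hC.cwLen.polyBdd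
    obtain ⟨K, hK⟩ := (polyLen_of_tagged hC.msgLen).polyBdd
    refine ⟨P + K + Polynomial.C 2, fun n s a y => ⟨?_, ?_⟩⟩
    · simp only [Polynomial.eval_add, Polynomial.eval_C]
      have h1 : C.cwLen n ≤ P.eval n := hP n
      have h2 : k n ≤ K.eval n := hK n
      rcases a with m | x
      · simp only [functionSimulator, enc_inl, List.length_cons, length_enc_bits]
        omega
      · simp only [functionSimulator, enc_inr, List.length_cons]
        have := length_enc_option_bits
          (C.decodeWith δ n (fun _ => y) s.1 x (toBits _ (s.2.drop n)))
        omega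
    · simp only [functionSimulator, enc_prod, length_pc]
      have : (enc (s.2.drop (n + C.decCoins n))).length ≤ (enc s.2).length := by
        simp [enc]
      omega

/-! ### The simulation without key -/

variable (C) in
/-- The encodings so far. -/
abbrev Log (n : ℕ) : Type := List (Msg k n × Bits (C.cwLen n))

open Classical in
/-- The message of the first entry of the log whose codeword is close to `x`. -/
noncomputable def lookup (δ : ℝ) {n : ℕ} (L : C.Log n) (x : List Bool) : Option (Bits (k n)) :=
  (L.find? fun e => Close δ e.2 x).map fun e => e.1.text

open Classical in
/-- Whether two codewords of the log with different messages are close to `x`. -/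
noncomputable def conflict (δ : ℝ) {n : ℕ} (L : C.Log n) (x : List Bool) : Bool :=
  (L.find? fun e => Close δ e.2 x ∧ some e.1.text ≠ lookup δ L x).isSome

variable (C) in
/-- The state of the simulation: the log, a flag for conflicts, a number and unused random bits. -/
structure LogState (ℓ : ℕ → ℕ) (n : ℕ) where
  log : C.Log n
  bad : Bool
  digits : Bits (ℓ n)
  tape : List Bool

instance {ℓ : ℕ → ℕ} {n : ℕ} : BitEncoding (C.LogState ℓ n) :=
  ⟨fun s => pc (pack (s.log.map enc)) (pc [s.bad] (pc (enc s.digits) s.tape))⟩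

theorem enc_logState {ℓ : ℕ → ℕ} {n : ℕ} (s : C.LogState ℓ n) :
    enc s = pc (pack (s.log.map enc)) (pc [s.bad] (pc (enc s.digits) s.tape)) := rfl

/-- The message `r‖m‖R₂` with the first bits of the tape as `r` and `R₂`. -/
def tapeMsg (n : ℕ) (tape : List Bool) (m : Bits (k n)) : Msg k n :=
  mkMsg (Fin.append (toBits n tape) m) (toBits n (tape.drop n))

variable (C δ q) in
/-- Simulation with an oracle for encodings of the underlying code; decoding queries are answered
from the log. -/
noncomputable def logSimulator (ℓ : ℕ → ℕ) : Simulator (fun n => Bits (k n) ⊕ List Bool)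
    (fun n => Bits (C.cwLen n) ⊕ Option (Bits (k n))) (fun n => Msg k n)
    (fun n => Bits (C.cwLen n)) (C.LogState ℓ) where
  extra n := ℓ n + q n * (n + n)
  start _ u := ⟨[], false, u.left, enc u.right⟩
  ask n s
    | Sum.inl m => tapeMsg n s.tape m
    -- A decoding query needs no encoding; the answer to this dummy request is discarded and not
    -- logged.
    | Sum.inr _ => fun _ => false
  step n s a c :=
    match a with
    | Sum.inl m => (Sum.inl c, ⟨s.log ++ [(tapeMsg n s.tape m, c)], s.bad, s.digits,
        s.tape.drop (n + n)⟩)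
    | Sum.inr x => (Sum.inr (lookup δ s.log x), ⟨s.log, s.bad || conflict δ s.log x, s.digits,
        s.tape.drop (n + n)⟩)

section

variable {ι : Type} {x : ι → List Bool} {n : ι → ℕ} {ℓ : ℕ → ℕ}

theorem fp_tapeMsg (hn : FP x fun i => unary (n i)) {t : ι → List Bool} (ht : FP x t)
    {m : ∀ i, Bits (k (n i))} (hm : FP x fun i => enc (m i)) :
    FP x fun i => enc (tapeMsg (n i) (t i) (m i)) :=
  fp_mkMsg (n := n) (FP.enc_append (FP.toBits hn ht) hm) (FP.toBits hn (FP.drop hn ht))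

theorem fp_close_entry (hC : C.Efficient) (hδ : PolyLen fun n => ⌊δ * (C.cwLen n : ℝ)⌋₊)
    (hn : FP x fun i => unary (n i)) {e : ∀ i, Msg k (n i) × Bits (C.cwLen (n i))}
    (he : FP x fun i => enc (e i)) {y : ι → List Bool} (hy : FP x y)
    [∀ i, Decidable (Close δ (e i).2 (y i))] : FP x fun i => [decide (Close δ (e i).2 (y i))] :=
  (FP.close (hC.cwLen.fp hn) (hδ.fp hn) (FP.snd he) hy).congr fun i => by congr

theorem fp_lookup (hC : C.Efficient) (hδ : PolyLen fun n => ⌊δ * (C.cwLen n : ℝ)⌋₊)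
    (hn : FP x fun i => unary (n i)) {L : ∀ i, C.Log (n i)}
    (hL : FP x fun i => pack ((L i).map enc)) {y : ι → List Bool} (hy : FP x y) :
    FP x fun i => enc (lookup δ (L i) (y i)) := by
  classical
  have h := FP.find? (p := fun i e => decide (Close δ e.2 (y i))) hL fun {κ Y φ e} hY he =>
    fp_close_entry hC hδ (hY.comp (hn.reindex _)) he (hY.comp (hy.reindex _))
  refine FP.option_cases h (fun Z hZ => ?_) fun Z hZ he => ?_
  · refine (FP.const [false]).congr fun a => ?_
    have h := a.2
    rw [Option.isSome_eq_false_iff, Option.isNone_iff_eq_none] at h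
    rw [lookup, h]
    rfl
  · refine ((fp_text (hZ.comp (hn.reindex _)) (polyLen_of_tagged hC.msgLen)
      (FP.fst he)).enc_some').congr fun a => ?_
    obtain ⟨e, h⟩ := Option.isSome_iff_exists.1 a.2
    rw [lookup]
    simp only [h, Option.get_some]
    rfl

theorem fp_conflict (hC : C.Efficient) (hδ : PolyLen fun n => ⌊δ * (C.cwLen n : ℝ)⌋₊)
    (hn : FP x fun i => unary (n i)) {L : ∀ i, C.Log (n i)}
    (hL : FP x fun i => pack ((L i).map enc)) {y : ι → List Bool} (hy : FP x y) :
    FP x fun i => [conflict δ (L i) (y i)] := by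
  classical
  refine ((FP.find? (p := fun i e => decide (Close δ e.2 (y i) ∧
    some e.1.text ≠ lookup δ (L i) (y i))) hL fun {κ Y φ e} hY he => ?_).isSome).congr
      fun i => by rw [conflict]
  have hn' := hY.comp (hn.reindex φ)
  have h1 := fp_close_entry hC hδ hn' he (hY.comp (hy.reindex _))
  have h2 := FP.beq (fp_text hn' (polyLen_of_tagged hC.msgLen) (FP.fst he)).enc_some'
    (hY.comp ((fp_lookup hC hδ hn hL hy).reindex φ))
  refine (FP.bit₂ and h1 (h2.bit₁ not)).congr fun a => ?_
  rw [Bool.decide_and, decide_not]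
  congr 4
  refine propext ⟨fun h => ?_, fun h => by rw [h]⟩
  rcases hl : lookup δ (L (φ a)) (y (φ a)) with _ | m
  · rw [hl, enc_some, enc_none] at h; exact absurd (List.cons.inj h).1 (by decide)
  · rw [hl, enc_some, enc_some] at h
    rw [enc_injective (List.cons.inj h).2]

theorem logSimulator_efficient (hC : C.Efficient)
    (hδ : PolyLen fun n => ⌊δ * (C.cwLen n : ℝ)⌋₊) (hq : PolyLen q) (hℓ : PolyLen ℓ) :
    (C.logSimulator δ q ℓ).Efficient where
  extra := .of_fp fun _ hn => (hℓ.fp hn).unary_add ((hq.fp hn).unary_mul (hn.unary_add hn))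
  start hn hu := FP.pair FP.nil (FP.pair (FP.const [false])
    (FP.pair (FP.enc_left (hℓ.fp hn) hu) (FP.enc_right (hℓ.fp hn) hu)))
  ask {ι x n s a} hn hs ha := by
    have hk := polyLen_of_tagged hC.msgLen
    refine FP.sum_cases ha (fun Y hY hm => ?_) fun Y hY hx => ?_
    · have ht := hY.comp ((FP.snd (FP.snd (FP.snd hs))).reindex Subtype.val)
      refine (fp_tapeMsg (hY.comp (hn.reindex _)) ht hm).congr fun i => ?_
      obtain ⟨m, h⟩ := Sum.isLeft_iff.1 i.2
      simp only [h, logSimulator, Sum.getLeft_inl]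
    · have hn' := hY.comp (hn.reindex Subtype.val)
      refine (FP.replicate ((hn'.unary_add (hk.fp hn')).unary_add hn') false).congr fun i => ?_
      obtain ⟨x, h⟩ := Sum.isRight_iff.1 i.2
      simp only [h, logSimulator]
      exact (List.ofFn_const _ _).symm
  answer {ι x n s a y} hn hs ha hy := by
    refine FP.sum_cases ha (fun Y hY hm => ?_) fun Y hY hx => ?_
    · refine ((hY.comp (hy.reindex Subtype.val)).cons false).congr fun i => ?_
      obtain ⟨m, h⟩ := Sum.isLeft_iff.1 i.2
      simp only [h, logSimulator, enc_inl]
    · refine ((fp_lookup hC hδ (hY.comp (hn.reindex _)) (hY.comp ((FP.fst hs).reindex Subtype.val))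
        hx).cons true).congr fun i => ?_
      obtain ⟨x, h⟩ := Sum.isRight_iff.1 i.2
      simp only [h, logSimulator, enc_inr, Sum.getRight_inr]
      rfl
  state {ι x n s a y} hn hs ha hy := by
    refine FP.sum_cases ha (fun Y hY hm => ?_) fun Y hY hx => ?_
    · have hn' := hY.comp (hn.reindex Subtype.val)
      have hlog := hY.comp ((FP.fst hs).reindex Subtype.val)
      have hbad := hY.comp ((FP.fst (FP.snd hs)).reindex Subtype.val)
      have hdig := hY.comp ((FP.fst (FP.snd (FP.snd hs))).reindex Subtype.val)
      have ht := hY.comp ((FP.snd (FP.snd (FP.snd hs))).reindex Subtype.val)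
      refine FP.congr (FP.pair (FP.append hlog ((FP.pair (fp_tapeMsg hn' ht hm)
        (hY.comp (hy.reindex Subtype.val))).pack_cons (l := fun _ => []) .pack_nil))
        (FP.pair hbad (FP.pair hdig (FP.drop (hn'.unary_add hn') ht)))) fun i => ?_
      obtain ⟨m, h⟩ := Sum.isLeft_iff.1 i.2
      simp only [h, logSimulator, Sum.getLeft_inl, enc_logState, List.map_append, pack_append,
        List.map_singleton, enc_prod]
    · have hn' := hY.comp (hn.reindex Subtype.val)
      have hlog := hY.comp ((FP.fst hs).reindex Subtype.val)
      have hbad := hY.comp ((FP.fst (FP.snd hs)).reindex Subtype.val)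
      have hdig := hY.comp ((FP.fst (FP.snd (FP.snd hs))).reindex Subtype.val)
      have ht := hY.comp ((FP.snd (FP.snd (FP.snd hs))).reindex Subtype.val)
      refine FP.congr (FP.pair hlog (FP.pair (FP.bit₂ or hbad (fp_conflict hC hδ hn' hlog hx))
        (FP.pair hdig (FP.drop (hn'.unary_add hn') ht)))) fun i => ?_
      obtain ⟨x, h⟩ := Sum.isRight_iff.1 i.2
      simp only [h, logSimulator, Sum.getRight_inr, enc_logState, enc_list]
  size := by
    obtain ⟨P, hP⟩ := hC.cwLen.polyBdd
    obtain ⟨K, hK⟩ := (polyLen_of_tagged hC.msgLen).polyBdd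
    refine ⟨8 * P + 8 * K + 20 * Polynomial.X + Polynomial.C 10, fun n s a y => ?_⟩
    simp only [Polynomial.eval_add, Polynomial.eval_C, Polynomial.eval_mul, Polynomial.eval_ofNat,
      Polynomial.eval_X]
    have h1 : C.cwLen n ≤ P.eval n := hP n
    have h2 : k n ≤ K.eval n := hK n
    rcases a with m | x
    · simp only [logSimulator, enc_inl, List.length_cons, length_enc_bits, enc_logState, length_pc,
        List.map_append, pack_append, List.length_append, List.map_singleton, pack_cons, pack_nil,
        List.length_drop, enc_prod, List.length_nil]
      omega
    · have := length_enc_option_bits (lookup δ s.log x)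
      simp only [logSimulator, enc_inr, List.length_cons, length_enc_bits, enc_logState, length_pc,
        List.length_drop]
      simp
      omega

end

end Code

end PRC

namespace PRC

open BitEncoding (enc)

/-! ### The adversaries of the reductions -/

namespace Adversary

variable {Q A : ℕ → Type}

/-- The adversary with the opposite output. -/
def negate (𝒜 : Adversary Q A fun _ => Bool) : Adversary Q A fun _ => Bool :=
  { 𝒜 with output := fun n ω l => !𝒜.output n ω l }

theorem Efficient.negate [∀ n, BitEncoding (Q n)] [∀ n, BitEncoding (A n)]
    {𝒜 : Adversary Q A fun _ => Bool} (h : 𝒜.Efficient) : 𝒜.negate.Efficient where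
  coins := h.coins
  queries := h.queries
  next := h.next
  output := polyTime_view fun _ hn hω hl => FP.bit₁ not (h.fp_output hn hω hl)

end Adversary

theorem FP.filterMap_getLeft? {ι : Type} {x : ι → List Bool} {α β : ι → Type}
    [∀ i, BitEncoding (α i)] [∀ i, BitEncoding (β i)] {l : ∀ i, List (α i ⊕ β i)}
    (hl : FP x fun i => pack ((l i).map enc)) :
    FP x fun i => pack (((l i).filterMap Sum.getLeft?).map enc) := by
  have hlen : FP x fun i => unary (l i).length := hl.pack_length.congr fun i => by simp
  refine FP.congr (FP.iterate (N := fun i => (l i).length)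
    (st := fun i j => pack ((((l i).take j).filterMap Sum.getLeft?).map enc)) hlen ?_
    (fun Y hj hs hx => ?_) ?_) fun i => by rw [List.take_length]
  · exact nil.congr fun i => by simp [pack]
  · have he : FP Y fun a => enc ((l a.1)[a.2]) :=
      (hj.pack_getElem? (hx.comp (hl.reindex _))).congr fun a => by simp
    have e : ∀ a : (i : ι) × Fin (l i).length, (l a.1).take (a.2 + 1) =
        (l a.1).take a.2 ++ [(l a.1)[a.2]] := fun a => by
      rw [List.take_add_one, List.getElem?_eq_getElem a.2.2]; rfl
    refine sum_cases he (fun Z hZ ha => ?_) fun Z hZ hb => ?_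
    · refine ((hZ.comp (hs.reindex Subtype.val)).append
        (ha.pack_cons (l := fun _ => []) .pack_nil)).congr fun a => ?_
      obtain ⟨m, h⟩ := Sum.isLeft_iff.1 a.2
      simp only [e, List.filterMap_append, List.map_append, PRC.pack_append, h, Sum.getLeft_inl,
        List.filterMap_cons, Sum.getLeft?_inl, List.filterMap_nil, List.map_cons, List.map_nil]
    · refine (hZ.comp (hs.reindex Subtype.val)).congr fun a => ?_
      obtain ⟨m, h⟩ := Sum.isRight_iff.1 a.2
      simp only [e, List.filterMap_append, h, List.filterMap_cons, Sum.getLeft?_inr,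
        List.filterMap_nil, List.append_nil]
  · refine (hl.length.reindex Sigma.fst).mono fun a => ?_
    refine le_trans ?_ (length_pack_take_le _ a.2)
    rw [← List.map_take]
    generalize (l a.1).take a.2 = v
    induction v with
    | nil => simp
    | cons b v ih =>
      rcases b with b | b
      · simp only [List.filterMap_cons, Sum.getLeft?_inl, List.map_cons, PRC.pack_cons, length_pc,
          enc_inl, List.length_cons]
        omega
      · simp only [List.filterMap_cons, Sum.getLeft?_inr, List.map_cons, PRC.pack_cons, length_pc]
        omega

namespace Code

variable {k : ℕ → ℕ}

/-- A distinguisher for encodings as an adversary that makes no decoding queries. -/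
def EncDistinguisher.ideal {C : Code k} (D : C.EncDistinguisher) : C.IdealAdversary where
  coins := D.coins
  queries := D.queries
  next n ω l := (D.next n ω (l.filterMap Sum.getLeft?)).map Sum.inl
  output n ω l := D.output n ω (l.filterMap Sum.getLeft?)

theorem EncDistinguisher.ideal_efficient {C : Code k} {D : C.EncDistinguisher} (h : D.Efficient) :
    D.ideal.Efficient where
  coins := h.coins
  queries := h.queries
  next := Adversary.polyTime_view (𝒜 := D.ideal) fun X hn hω hl => by
    refine FP.option_cases (h.fp_next hn hω hl.filterMap_getLeft?) (fun Z hZ => ?_) fun Z hZ hq => ?_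
    · refine (FP.const [false]).congr fun a => ?_
      have h := a.2
      rw [Option.isSome_eq_false_iff, Option.isNone_iff_eq_none] at h
      simp only [EncDistinguisher.ideal, h, Option.map_none]
      rfl
    · refine ((hq.cons false).cons true).congr fun a => ?_
      obtain ⟨q, h⟩ := Option.isSome_iff_exists.1 a.2
      simp only [EncDistinguisher.ideal, h, Option.map_some, Option.get_some]
      rfl
  output := Adversary.polyTime_view (𝒜 := D.ideal) fun X hn hω hl =>
    h.fp_output hn hω hl.filterMap_getLeft?

/-- Queries to an encoder and a decoder. -/
abbrev IdealQuery (k : ℕ → ℕ) (n : ℕ) : Type := Bits (k n) ⊕ List Bool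

/-- Answers of an encoder and a decoder for messages without nonce and tag. -/
abbrev IdealAnswer (C : Code fun n => n + k n + n) (n : ℕ) : Type :=
  Bits (C.cwLen n) ⊕ Option (Bits (k n))

/-- Adversaries against the transformed code. -/
abbrev SharpAdversary (C : Code fun n => n + k n + n) : Type :=
  Adversary (IdealQuery k) C.IdealAnswer (fun _ => Bool)

/-- The string of the next query after the answers `h`, if this is a decoding query. -/
def queryString {A : Type} {n : ℕ} (next : List A → Option (IdealQuery k n)) (h : List A) :
    List Bool :=
  match next h with
  | some (Sum.inr x) => x
  | _ => []

variable {C : Code fun n => n + k n + n} (δ : ℝ) (𝒜 : C.SharpAdversary)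

/-- The number of random bits from which a number of a query is chosen. -/
def guessLen (n : ℕ) : ℕ := logBound (𝒜.queries n) (𝒜.queries n)

/-- The distinguisher for the function family. -/
noncomputable def functionAdversary :
    KeyedFunction.Distinguisher (fun n => n + k n) fun n => C.encCoins n + n :=
  (C.functionSimulator δ 𝒜.queries).adversary 𝒜 fun n ω h _ => 𝒜.output n ω h

/-- The distinguisher for encodings of the underlying code. -/
noncomputable def encodingAdversary : C.EncDistinguisher :=
  (C.logSimulator δ 𝒜.queries (guessLen 𝒜)).adversary 𝒜 fun n ω h s => 𝒜.output n ω h && !s.bad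

/-- The robustness adversary: it outputs a random one of the decoding queries. -/
noncomputable def robustnessAdversary : C.RobustAdversary :=
  (C.logSimulator δ 𝒜.queries (guessLen 𝒜)).adversary 𝒜 fun n ω h s =>
    queryString (𝒜.next n ω) (h.take (ofDigits (enc s.digits)))

variable {δ 𝒜}

theorem guessLen_polyLen (h : 𝒜.Efficient) : PolyLen (guessLen 𝒜) :=
  .of_fp fun _ hn => FP.logBound (h.queries.fp hn)

theorem functionAdversary_efficient (hC : C.Efficient)
    (hδ : PolyLen fun n => ⌊δ * (C.cwLen n : ℝ)⌋₊) (h : 𝒜.Efficient) :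
    (functionAdversary δ 𝒜).Efficient :=
  (functionSimulator_efficient hC hδ h.queries).adversary h fun hn hω hl _ => h.fp_output hn hω hl

theorem encodingAdversary_efficient (hC : C.Efficient)
    (hδ : PolyLen fun n => ⌊δ * (C.cwLen n : ℝ)⌋₊) (h : 𝒜.Efficient) :
    (encodingAdversary δ 𝒜).Efficient :=
  (logSimulator_efficient hC hδ h.queries (guessLen_polyLen h)).adversary h fun hn hω hl hs =>
    FP.bit₂ (fun b c => b && !c) (h.fp_output hn hω hl) (FP.fst (FP.snd hs))

theorem robustnessAdversary_efficient (hC : C.Efficient)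
    (hδ : PolyLen fun n => ⌊δ * (C.cwLen n : ℝ)⌋₊) (h : 𝒜.Efficient) :
    (robustnessAdversary δ 𝒜).Efficient :=
  (logSimulator_efficient hC hδ h.queries (guessLen_polyLen h)).adversary h fun {ι x n ω l s} hn hω hl hs => by
    have hq := h.queries.fp hn
    -- The guessed number is below `2 ^ guessLen`, hence at most polynomial, and can be written in
    -- unary.
    have hj := FP.ofDigits ((hq.append hq).append (FP.const (unary 1)) |>.congr (z := fun i =>
        unary (𝒜.queries (n i) + 𝒜.queries (n i) + 1)) fun i => by simp only [unary_add])
      (FP.fst (FP.snd (FP.snd hs))) fun i => by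
        rw [length_enc_bits]
        have := two_pow_logBound_le (𝒜.queries (n i)) (𝒜.queries (n i))
        rw [guessLen]
        omega
    have hh : FP x fun i => pack (((l i).take (ofDigits (enc (s i).digits))).map enc) :=
      (FP.pack_take hj hl).congr fun i => by rw [List.map_take]
    refine FP.option_cases (h.fp_next hn hω hh) (fun Y hY => ?_) fun Y hY hq => ?_
    · refine FP.nil.congr fun a => ?_
      have h := a.2
      rw [Option.isSome_eq_false_iff, Option.isNone_iff_eq_none] at h
      simp only [queryString, h]
      rfl
    · refine FP.sum_cases hq (fun Z hZ hm => ?_) fun Z hZ hx => ?_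
      · refine FP.nil.congr fun a => ?_
        obtain ⟨q, h⟩ := Option.isSome_iff_exists.1 a.1.2
        obtain ⟨m, h2⟩ := Sum.isLeft_iff.1 a.2
        simp only [h, Option.get_some] at h2
        subst h2
        simp only [queryString, h]
        rfl
      · refine hx.congr fun a => ?_
        obtain ⟨q, h⟩ := Option.isSome_iff_exists.1 a.1.2
        obtain ⟨m, h2⟩ := Sum.isRight_iff.1 a.2
        simp only [h, Option.get_some] at h2
        subst h2
        simp only [queryString, h, Option.get_some, Sum.getRight_inr]

end Code

end PRC

namespace PRC

open BitEncoding (enc)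
open scoped ENNReal

/-! ### Expectations -/

/-- The expectation of a function with values in `[0, ∞]`. -/
noncomputable def expect {α : Type} (p : PMF α) (f : α → ℝ≥0∞) : ℝ≥0∞ := ∑' a, p a * f a

section expect

variable {α β : Type} {p : PMF α} {f g : α → ℝ≥0∞}

theorem expect_pure (a : α) (f : α → ℝ≥0∞) : expect (PMF.pure a) f = f a := by
  rw [expect, tsum_eq_single a]
  · simp
  · intro b hb; simp [hb]

theorem expect_bind (p : PMF α) (q : α → PMF β) (f : β → ℝ≥0∞) :
    expect (p.bind q) f = expect p fun a => expect (q a) f := by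
  simp only [expect, PMF.bind_apply, ← ENNReal.tsum_mul_right, ← ENNReal.tsum_mul_left]
  rw [ENNReal.tsum_comm]
  simp only [mul_assoc]

theorem expect_map (p : PMF α) (q : α → β) (f : β → ℝ≥0∞) :
    expect (p.map q) f = expect p fun a => f (q a) := by
  rw [← PMF.bind_pure_comp, expect_bind]
  simp only [Function.comp, expect_pure]

theorem expect_mono (h : ∀ a, f a ≤ g a) : expect p f ≤ expect p g :=
  ENNReal.tsum_le_tsum fun a => mul_le_mul_right (h a) _

theorem expect_add : (expect p fun a => f a + g a) = expect p f + expect p g := by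
  simp only [expect, mul_add, ENNReal.tsum_add]

theorem expect_const (p : PMF α) (c : ℝ≥0∞) : (expect p fun _ => c) = c := by
  rw [expect, ENNReal.tsum_mul_right, p.tsum_coe, one_mul]

theorem expect_mul_left (c : ℝ≥0∞) : (expect p fun a => c * f a) = c * expect p f := by
  simp only [expect, ← ENNReal.tsum_mul_left, mul_left_comm]

theorem expect_le {c : ℝ≥0∞} (h : ∀ a, f a ≤ c) : expect p f ≤ c :=
  (expect_mono h).trans_eq (expect_const p c)

theorem le_expect {c : ℝ≥0∞} (h : ∀ a, c ≤ f a) : c ≤ expect p f :=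
  (expect_const p c).ge.trans (expect_mono h)

theorem expect_comm (p : PMF α) (q : PMF β) (f : α → β → ℝ≥0∞) :
    (expect p fun a => expect q fun b => f a b) = expect q fun b => expect p fun a => f a b := by
  simp only [expect, ← ENNReal.tsum_mul_left]
  rw [ENNReal.tsum_comm]
  simp only [mul_left_comm]

theorem expect_uniform [Fintype α] [Nonempty α] (f : α → ℝ≥0∞) :
    expect (PMF.uniformOfFintype α) f = (∑ a, f a) * (Fintype.card α : ℝ≥0∞)⁻¹ := by
  simp only [expect, PMF.uniformOfFintype_apply, tsum_fintype, Finset.sum_mul, mul_comm]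

theorem expect_uniform_equiv [Fintype α] [Nonempty α] [Fintype β] [Nonempty β] (e : α ≃ β)
    (f : β → ℝ≥0∞) : expect (PMF.uniformOfFintype β) f =
      expect (PMF.uniformOfFintype α) fun a => f (e a) := by
  rw [expect_uniform, expect_uniform, Fintype.card_congr e, Equiv.sum_comp e]

theorem expect_uniform_prod [Fintype α] [Nonempty α] [Fintype β] [Nonempty β]
    (f : α × β → ℝ≥0∞) : expect (PMF.uniformOfFintype (α × β)) f =
      expect (PMF.uniformOfFintype α) fun a => expect (PMF.uniformOfFintype β) fun b => f (a, b) := by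
  simp only [expect_uniform, Fintype.card_prod, Fintype.sum_prod_type, Nat.cast_mul,
    ← Finset.sum_mul]
  rw [ENNReal.mul_inv (Or.inr (by simp)) (Or.inl (by simp)), mul_assoc, mul_comm (_⁻¹) (_⁻¹)]

theorem expect_uniformBits_add (a b : ℕ) (f : Bits (a + b) → ℝ≥0∞) :
    expect (uniformBits (a + b)) f =
      expect (uniformBits a) fun u => expect (uniformBits b) fun v => f (Fin.append u v) := by
  rw [uniformBits, expect_uniform_equiv (Fin.appendEquiv a b), expect_uniform_prod]
  rfl

/-- The indicator of `true`. -/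
def ind (b : Bool) : ℝ≥0∞ := if b then 1 else 0

theorem ind_le_one (b : Bool) : ind b ≤ 1 := by cases b <;> simp [ind]

theorem apply_true_eq_expect (p : PMF Bool) : p true = expect p ind := by
  simp [expect, ind, tsum_fintype]

/-- Uniformly random lists of bits. -/
noncomputable def uniformList (n : ℕ) : PMF (List Bool) := (uniformBits n).map enc

theorem expect_uniformList_add (a b : ℕ) (f : List Bool → ℝ≥0∞) :
    expect (uniformList (a + b)) f =
      expect (uniformBits a) fun u => expect (uniformList b) fun l => f (enc u ++ l) := by
  simp only [uniformList, expect_map, expect_uniformBits_add, enc_append]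

theorem toBits_append {n : ℕ} (u : Bits n) (l : List Bool) : toBits n (enc u ++ l) = u := by
  funext i
  simp [toBits, enc_bits, List.getD_eq_getElem?_getD, List.getElem?_append]

theorem drop_enc_append {n : ℕ} (u : Bits n) (l : List Bool) : (enc u ++ l).drop n = l :=
  List.drop_left' (length_enc_bits u)

end expect

/-! ### The value of an interaction -/

section ival

variable {Q A S S' : Type}

/-- The expectation of a function of the answers and the final oracle state. -/
noncomputable def ival (oracle : S → Q → PMF (A × S)) (next : List A → Option Q) (t : ℕ) (s : S)
    (h : List A) (V : List A → S → ℝ≥0∞) : ℝ≥0∞ :=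
  expect (interact oracle next t s h) fun p => V p.1 p.2

variable {oracle : S → Q → PMF (A × S)} {next : List A → Option Q} {V W : List A → S → ℝ≥0∞}

theorem ival_zero (s : S) (h : List A) : ival oracle next 0 s h V = V h s := by
  rw [ival, interact, expect_pure]

theorem ival_succ_none {t : ℕ} {s : S} {h : List A} (hq : next h = none) :
    ival oracle next (t + 1) s h V = V h s := by
  rw [ival, interact, hq, expect_pure]

theorem ival_succ_some {t : ℕ} {s : S} {h : List A} {q : Q} (hq : next h = some q) :
    ival oracle next (t + 1) s h V =
      expect (oracle s q) fun a => ival oracle next t a.2 (h ++ [a.1]) V := by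
  rw [ival, interact, hq]
  simp only [expect_bind]
  rfl

theorem ival_le {c : ℝ≥0∞} {t : ℕ} {s : S} {h : List A} (hV : ∀ h s, V h s ≤ c) :
    ival oracle next t s h V ≤ c :=
  expect_le fun _ => hV _ _

theorem ival_add {t : ℕ} {s : S} {h : List A} :
    ival oracle next t s h (fun h s => V h s + W h s) =
      ival oracle next t s h V + ival oracle next t s h W := expect_add

/-- Only transcripts with at most `t` new answers occur. The length bound is what makes the guess of
a query index exhaustive. -/
theorem ival_mono_length {t : ℕ} {s : S} {h : List A}
    (hV : ∀ h' s, h'.length ≤ h.length + t → V h' s ≤ W h' s) :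
    ival oracle next t s h V ≤ ival oracle next t s h W := by
  induction t generalizing s h with
  | zero => simpa only [ival_zero] using hV h s (by omega)
  | succ t ih =>
    cases hq : next h with
    | none => simpa only [ival_succ_none hq] using hV h s (by omega)
    | some q =>
      simp only [ival_succ_some hq]
      refine expect_mono fun a => ih fun h' s' hl => hV h' s' ?_
      simp only [List.length_append, List.length_singleton] at hl
      omega

/-- Comparison of two oracles along a relation between their states. -/
theorem ival_le_ival {oracle' : S' → Q → PMF (A × S')} {V' : List A → S' → ℝ≥0∞}
    (rel : S → S' → Prop)
    (hstep : ∀ s s' q (φ : A → S → ℝ≥0∞) (φ' : A → S' → ℝ≥0∞), rel s s' →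
      (∀ a s s', rel s s' → φ a s ≤ φ' a s') →
      (expect (oracle s q) fun a => φ a.1 a.2) ≤ expect (oracle' s' q) fun a => φ' a.1 a.2)
    (hV : ∀ h s s', rel s s' → V h s ≤ V' h s') {t : ℕ} {s : S} {s' : S'} {h : List A}
    (hs : rel s s') : ival oracle next t s h V ≤ ival oracle' next t s' h V' := by
  induction t generalizing s s' h with
  | zero => simpa only [ival_zero] using hV h s s' hs
  | succ t ih =>
    cases hq : next h with
    | none => simpa only [ival_succ_none hq] using hV h s s' hs
    | some q =>
      simp only [ival_succ_some hq]
      exact hstep s s' q (fun a s => ival oracle next t s (h ++ [a]) V)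
        (fun a s => ival oracle' next t s (h ++ [a]) V') hs fun a s s' h' => ih h'

/-- Replacing a random tape, of which every query uses `b` bits, by fresh random bits. -/
theorem expect_tape (mk : S → List Bool → S') (b : ℕ) {oracle' : S' → Q → PMF (A × S')}
    {V' : List A → S' → ℝ≥0∞}
    (hstep : ∀ s q m (φ : A → S' → ℝ≥0∞),
      (expect (uniformList (b + m)) fun l => expect (oracle' (mk s l) q) fun a => φ a.1 a.2) =
      expect (oracle s q) fun a => expect (uniformList m) fun l => φ a.1 (mk a.2 l))
    (hV : ∀ h s l, V' h (mk s l) = V h s) (t : ℕ) (s : S) (h : List A) :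
    (expect (uniformList (t * b)) fun l => ival oracle' next t (mk s l) h V') =
      ival oracle next t s h V := by
  induction t generalizing s h with
  | zero => simp only [ival_zero, hV, expect_const]
  | succ t ih =>
    cases hq : next h with
    | none => simp only [ival_succ_none hq, hV, expect_const]
    | some q =>
      simp only [ival_succ_some hq]
      rw [show (t + 1) * b = b + t * b by ring]
      rw [hstep s q _ fun a s => ival oracle' next t s (h ++ [a]) V']
      simp only [ih]

end ival

namespace Adversary

variable {Q A R : ℕ → Type} (𝒜 : Adversary Q A R) (n : ℕ) {S : Type}

theorem expect_run (oracle : S → Q n → PMF (A n × S)) (s₀ : S) (f : R n × S → ℝ≥0∞) :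
    expect (𝒜.run n oracle s₀) f = expect (uniformBits (𝒜.coins n)) fun ω =>
      ival oracle (𝒜.next n ω) (𝒜.queries n) s₀ [] fun h s => f (𝒜.output n ω h, s) := by
  simp only [run, expect_bind, expect_map, ival]

/-- A stateless oracle. -/
noncomputable def stateless {Q A : Type} (oracle : Q → PMF A) : Unit → Q → PMF (A × Unit) :=
  fun _ q => (oracle q).map fun a => (a, ())

theorem expect_runWith (oracle : Q n → PMF (A n)) (f : R n → ℝ≥0∞) :
    expect (𝒜.runWith n oracle) f = expect (uniformBits (𝒜.coins n)) fun ω =>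
      ival (stateless oracle) (𝒜.next n ω) (𝒜.queries n) () [] fun h _ => f (𝒜.output n ω h) := by
  simp only [runWith, expect_map, expect_run]
  rfl

end Adversary

namespace Simulator

variable {Q A R Q' A' R' S : ℕ → Type} (σ : Simulator Q A Q' A' S) (𝒜 : Adversary Q A R) {n : ℕ}
  {T : Type}

/-- The oracle that the simulated adversary sees. -/
noncomputable def oracle (O : T → Q' n → PMF (A' n × T)) :
    T × S n → Q n → PMF (A n × (T × S n)) :=
  fun s q => (O s.1 (σ.ask n s.2 q)).map fun a =>
    ((σ.step n s.2 q a.1).1, (a.2, (σ.step n s.2 q a.1).2))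

/-- Simulation is an exact identity of expectations: the replayed state after the oracle answers `l`
is the state of the stateful oracle that the simulated adversary sees. The induction is over the
remaining rounds, for all `l`. -/
theorem expect_adversary_run (out : (n : ℕ) → Bits (𝒜.coins n) → List (A n) → S n → R' n)
    (O : T → Q' n → PMF (A' n × T)) (s₀ : T) (f : R' n × T → ℝ≥0∞) :
    expect ((σ.adversary 𝒜 out).run n O s₀) f =
      expect (uniformBits (𝒜.coins n)) fun ω => expect (uniformBits (σ.extra n)) fun e =>
        ival (σ.oracle O) (𝒜.next n ω) (𝒜.queries n) (s₀, σ.start n e) []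
          fun h s => f (out n ω h s.2, s.1) := by
  rw [Adversary.expect_run]
  simp only [adversary]
  rw [expect_uniformBits_add]
  congr 1
  funext ω
  congr 1
  funext e
  simp only [Bits.left_append, Bits.right_append]
  suffices H : ∀ (t : ℕ) (s : T) (l : List (A' n)),
      ival O (fun l => (𝒜.next n ω (σ.replay 𝒜 n ω (σ.start n e) l).1).map
          (σ.ask n (σ.replay 𝒜 n ω (σ.start n e) l).2)) t s l
        (fun l s => f (out n ω (σ.replay 𝒜 n ω (σ.start n e) l).1
          (σ.replay 𝒜 n ω (σ.start n e) l).2, s)) =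
      ival (σ.oracle O) (𝒜.next n ω) t (s, (σ.replay 𝒜 n ω (σ.start n e) l).2)
        (σ.replay 𝒜 n ω (σ.start n e) l).1 fun h s => f (out n ω h s.2, s.1) from H _ _ []
  intro t
  induction t with
  | zero => intro s l; simp only [ival_zero]
  | succ t ih =>
    intro s l
    cases hq : 𝒜.next n ω (σ.replay 𝒜 n ω (σ.start n e) l).1 with
    | none =>
      rw [ival_succ_none hq, ival_succ_none (by rw [hq, Option.map_none])]
    | some q =>
      rw [ival_succ_some hq, ival_succ_some (by rw [hq, Option.map_some]), oracle, expect_map]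
      congr 1
      funext a
      rw [ih]
      have : σ.replay 𝒜 n ω (σ.start n e) (l ++ [a.1]) =
          ((σ.replay 𝒜 n ω (σ.start n e) l).1 ++
            [(σ.step n (σ.replay 𝒜 n ω (σ.start n e) l).2 q a.1).1],
            (σ.step n (σ.replay 𝒜 n ω (σ.start n e) l).2 q a.1).2) := by
        rw [replay, List.foldl_append, List.foldl_cons, List.foldl_nil, ← replay, replayStep, hq]
      rw [this]

theorem expect_adversary_runWith (out : (n : ℕ) → Bits (𝒜.coins n) → List (A n) → S n → R' n)
    (O : Q' n → PMF (A' n)) (f : R' n → ℝ≥0∞) :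
    expect ((σ.adversary 𝒜 out).runWith n O) f =
      expect (uniformBits (𝒜.coins n)) fun ω => expect (uniformBits (σ.extra n)) fun e =>
        ival (σ.oracle (Adversary.stateless O)) (𝒜.next n ω) (𝒜.queries n) ((), σ.start n e) []
          fun h s => f (out n ω h s.2) := by
  rw [Adversary.runWith, expect_map]
  exact expect_adversary_run σ 𝒜 out _ _ _

end Simulator

end PRC

namespace PRC

open BitEncoding (enc)
open scoped ENNReal

/-! ### Uniformly random functions and strings -/

theorem expect_uniformBits_eq (n : ℕ) (a : Bits n) :
    (expect (uniformBits n) fun r => ind (decide (r = a))) = (2 ^ n : ℝ≥0∞)⁻¹ := by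
  rw [uniformBits, expect_uniform]
  simp [ind]

/-- The basis of lazy sampling: the value of a uniform function at `p` is uniform and independent of
the others, so it can be drawn afresh. -/
theorem expect_function_update {α β : Type} [Fintype α] [DecidableEq α] [Fintype β] [Nonempty β]
    (p : α) (Φ : (α → β) → ℝ≥0∞) :
    expect (PMF.uniformOfFintype (α → β)) Φ = expect (PMF.uniformOfFintype β) fun y =>
      expect (PMF.uniformOfFintype (α → β)) fun g => Φ (Function.update g p y) := by
  have e : ∀ y z (g : {j // j ≠ p} → β), Function.update ((Equiv.funSplitAt p β).symm (z, g)) p y =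
      (Equiv.funSplitAt p β).symm (y, g) := by
    intro y z g
    funext j
    by_cases hj : j = p
    · subst hj; simp [Equiv.funSplitAt, Equiv.piSplitAt]
    · simp [Equiv.funSplitAt, Equiv.piSplitAt, hj]
  simp only [expect_uniform_equiv (Equiv.funSplitAt p β).symm, expect_uniform_prod, e, expect_const]

namespace Code

variable {k : ℕ → ℕ} (C : Code fun n => n + k n + n) (δ : ℝ) (n : ℕ) (sk : Bits (C.skLen n))

/-- The values of the function at points `r‖m`. -/
abbrev Tags (n : ℕ) : Type := Bits (n + k n) → Bits (C.encCoins n + n)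

/-- The code with an arbitrary function in place of the keyed function. -/
noncomputable def functionOracle (f : C.Tags n) : IdealQuery k n → PMF (C.IdealAnswer n)
  | Sum.inl m => (uniformBits n).map fun r =>
      Sum.inl (C.encodeWith n sk (Fin.append r m) (f (Fin.append r m)))
  | Sum.inr x => (uniformBits (C.decCoins n)).map fun w => Sum.inr (C.decodeWith δ n f sk x w)

variable {C n} in
open Classical in
/-- The decoder that accepts only messages from the log. -/
noncomputable def acceptLogged (L : C.Log n) (x : List Bool) (M : Option (Msg k n)) :
    Option (Bits (k n)) :=
  match M with
  | none => none
  | some M => if ∃ e ∈ L, e.1 = M ∧ Close δ e.2 x then some (Msg.text M) else none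

/-- Encodings with fresh tags and coins, and a decoder that accepts only messages from the log. -/
noncomputable def freshOracle : C.Log n → IdealQuery k n → PMF (C.IdealAnswer n × C.Log n)
  | L, Sum.inl m => (uniformBits n).bind fun r => (uniformBits (C.encCoins n + n)).map fun y =>
      (Sum.inl (C.encodeWith n sk (Fin.append r m) y),
        L ++ [(mkMsg (Fin.append r m) y.right, C.encodeWith n sk (Fin.append r m) y)])
  | L, Sum.inr x => (C.sampleDecode n sk x).map fun M => (Sum.inr (acceptLogged δ L x M), L)

variable {C n}

/-- The function with the values in the table, and those of `g` elsewhere. -/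
def override (T : List (Bits (n + k n) × Bits (C.encCoins n + n))) (g : C.Tags n) : C.Tags n :=
  fun p => ((T.find? fun e => e.1 = p).map Prod.snd).getD (g p)

/-- The log that belongs to a table of function values. -/
def tableLog (T : List (Bits (n + k n) × Bits (C.encCoins n + n))) : C.Log n :=
  T.map fun e => (mkMsg e.1 e.2.right, C.encodeWith n sk e.1 e.2)

theorem override_of_notMem {T : List (Bits (n + k n) × Bits (C.encCoins n + n))} {g : C.Tags n}
    {p : Bits (n + k n)} (hp : p ∉ T.map Prod.fst) : override T g p = g p := by
  have : T.find? (fun e => e.1 = p) = none := by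
    rw [List.find?_eq_none]
    intro e he h
    exact hp (List.mem_map.2 ⟨e, he, by simpa using h⟩)
  rw [override, this]
  rfl

theorem override_of_mem {T : List (Bits (n + k n) × Bits (C.encCoins n + n))} {g : C.Tags n}
    (hT : (T.map Prod.fst).Nodup) {e : Bits (n + k n) × Bits (C.encCoins n + n)} (he : e ∈ T) :
    override T g e.1 = e.2 := by
  have hs : (T.find? fun e' => e'.1 = e.1).isSome := by
    rw [List.find?_isSome]
    exact ⟨e, he, by simp⟩
  obtain ⟨e', h⟩ := Option.isSome_iff_exists.1 hs
  have h1 : e'.1 = e.1 := by simpa using List.find?_some h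
  have h2 : e' = e := List.inj_on_of_nodup_map hT (List.mem_of_find?_eq_some h) he h1
  rw [override, h, h2]
  rfl

/-- Moves a lazily sampled value from the random function `g` into the table. -/
theorem override_append {T : List (Bits (n + k n) × Bits (C.encCoins n + n))} {g : C.Tags n}
    {p : Bits (n + k n)} (hp : p ∉ T.map Prod.fst) (y : Bits (C.encCoins n + n)) :
    override T (Function.update g p y) = override (T ++ [(p, y)]) g := by
  funext p'
  by_cases h : p' = p
  · subst h
    rw [override_of_notMem hp, Function.update_self, override, List.find?_append]
    have : T.find? (fun e => e.1 = p') = none := by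
      rw [List.find?_eq_none]
      intro e he h
      exact hp (List.mem_map.2 ⟨e, he, by simpa using h⟩)
    rw [this]
    simp
  · rw [override, override, Function.update_of_ne h, List.find?_append]
    rcases hf : T.find? (fun e => e.1 = p') with _ | e <;> simp [Ne.symm h]

theorem text_point (M : Msg k n) : Msg.text M = Bits.right (Msg.point M) := rfl

theorem mkMsg_eq_iff {p : Bits (n + k n)} {R : Bits n} {M : Msg k n} :
    mkMsg p R = M ↔ p = Msg.point M ∧ R = Bits.right M := by
  constructor
  · rintro rfl
    exact ⟨(Bits.left_append p R).symm, (Bits.right_append p R).symm⟩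
  · rintro ⟨rfl, rfl⟩
    exact Bits.append_left_right M

/-- The points of the table are distinct, so a point determines its entry. A correct tag then means
that `M` is the logged message, and re-encoding reproduces the logged codeword. -/
theorem decodeWith_override_of_mem {T : List (Bits (n + k n) × Bits (C.encCoins n + n))}
    {g : C.Tags n} (hT : (T.map Prod.fst).Nodup) {x : List Bool} {w : Bits (C.decCoins n)}
    (hM : ∀ M, C.decode n sk x w = some M → Msg.point M ∈ T.map Prod.fst) :
    C.decodeWith δ n (override T g) sk x w =
      acceptLogged δ (tableLog sk T) x (C.decode n sk x w) := by
  classical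
  cases hd : C.decode n sk x w with
  | none => rw [decodeWith, hd]; rfl
  | some M =>
    obtain ⟨e, he, hp⟩ := List.mem_map.1 (hM M hd)
    have ho := override_of_mem (g := g) hT he
    rw [hp] at ho
    rw [decodeWith, hd]
    simp only [ho]
    refine if_congr ?_ rfl rfl
    constructor
    · rintro ⟨h1, h2⟩
      refine ⟨_, List.mem_map.2 ⟨e, he, rfl⟩, mkMsg_eq_iff.2 ⟨hp, h1⟩, ?_⟩
      simp only [encodeWith]
      rwa [mkMsg_eq_iff.2 ⟨hp, h1⟩]
    · rintro ⟨e', he', h1, h2⟩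
      obtain ⟨e'', he'', rfl⟩ := List.mem_map.1 he'
      simp only at h1 h2
      obtain ⟨h3, h4⟩ := mkMsg_eq_iff.1 h1
      have : e'' = e := List.inj_on_of_nodup_map hT he'' he (by rw [h3, hp])
      subst this
      refine ⟨h4, ?_⟩
      rw [encodeWith, h1] at h2
      exact h2

theorem acceptLogged_of_notMem {T : List (Bits (n + k n) × Bits (C.encCoins n + n))} {M : Msg k n}
    {x : List Bool} (hM : Msg.point M ∉ T.map Prod.fst) :
    acceptLogged δ (tableLog sk T) x (some M) = none := by
  classical
  refine if_neg ?_
  rintro ⟨e, he, h1, -⟩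
  obtain ⟨e', he', rfl⟩ := List.mem_map.1 he
  exact hM (List.mem_map.2 ⟨e', he', (mkMsg_eq_iff.1 h1).1⟩)

/-- No guess for a tag is correct. -/
def Misses (G : List (Bits (n + k n) × Bits n)) (g : C.Tags n) : Prop :=
  ∀ e ∈ G, (g e.1).right ≠ e.2

open Classical in
-- A union bound: each point of `K` equals `r‖m` for at most one `r`, namely its first `n` bits.
theorem expect_nonce_mem_le (K : List (Bits (n + k n))) (m : Bits (k n)) :
    (expect (uniformBits n) fun r => ind (decide (Fin.append r m ∈ K))) ≤
      K.length * (2 ^ n : ℝ≥0∞)⁻¹ := by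
  induction K with
  | nil => simp [ind, expect_const]
  | cons p K ih =>
    rw [List.length_cons, Nat.cast_add, Nat.cast_one, add_mul, one_mul, add_comm (_ * _)]
    refine le_trans ?_ (add_le_add (expect_uniformBits_eq n (Bits.left p)).le ih)
    rw [← expect_add]
    refine expect_mono fun r => ?_
    by_cases h1 : Fin.append r m = p
    · have h2 : ind (decide (r = Bits.left p)) = 1 := by simp [← h1, Bits.left_append, ind]
      rw [h2]
      exact (ind_le_one _).trans le_self_add
    · by_cases h2 : Fin.append r m ∈ K <;> simp [h1, h2, ind]

theorem expect_tag_eq (p : Bits (n + k n)) (R : Bits n) :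
    (expect (PMF.uniformOfFintype (C.Tags n)) fun g => ind (decide ((g p).right = R))) =
      (2 ^ n : ℝ≥0∞)⁻¹ := by
  rw [expect_function_update p]
  simp only [Function.update_self, expect_const]
  rw [← uniformBits, expect_uniformBits_add]
  simp only [Bits.right_append, expect_uniformBits_eq, expect_const]

open Classical in
-- Lazy sampling with two records: `T` holds the points used by encodings with their values, `G` the
-- pairs of point and tag refuted by rejected decodings. All other values stay uniform subject to
-- missing `G`; this conditioning is expressed by an unnormalized indicator instead of a conditional
-- distribution. Each query adds at most one item to `T` or `G`, so `N` bounds them throughout, and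
-- each query costs at most `(N + 1) / 2 ^ n`.
theorem expect_functionOracle_le {next : List (C.IdealAnswer n) → Option (IdealQuery k n)}
    {V : List (C.IdealAnswer n) → ℝ≥0∞} (hV : ∀ h, V h ≤ 1) (N t : ℕ)
    (T : List (Bits (n + k n) × Bits (C.encCoins n + n))) (G : List (Bits (n + k n) × Bits n))
    (hT : (T.map Prod.fst).Nodup) (hG : ∀ e ∈ G, e.1 ∉ T.map Prod.fst)
    (hN : T.length + G.length + t ≤ N) (h : List (C.IdealAnswer n)) :
    (expect (PMF.uniformOfFintype (C.Tags n)) fun g => ind (decide (Misses G g)) *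
      ival (Adversary.stateless (C.functionOracle δ n sk (override T g))) next t () h
        fun h _ => V h) ≤
      ival (C.freshOracle δ n sk) next t (tableLog sk T) h (fun h _ => V h) +
        t * ((N + 1) * (2 ^ n : ℝ≥0∞)⁻¹) := by
  have hle : ∀ {b : Bool} {c : ℝ≥0∞}, ind b * c ≤ c := fun {b c} =>
    (mul_le_mul_left (ind_le_one b) c).trans_eq (one_mul c)
  induction t generalizing T G h with
  | zero =>
    simp only [ival_zero]
    exact (expect_le fun g => hle).trans le_self_add
  | succ t ih =>
    cases hq : next h with
    | none =>
      simp only [ival_succ_none hq]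
      exact (expect_le fun g => hle).trans le_self_add
    | some q =>
      simp only [ival_succ_some hq, Adversary.stateless, expect_map, Nat.cast_add, Nat.cast_one,
        add_mul (t : ℝ≥0∞), one_mul]
      set ε : ℝ≥0∞ := (N + 1) * (2 ^ n : ℝ≥0∞)⁻¹ with hε
      rcases q with m | x
      · simp only [functionOracle, freshOracle, expect_map, expect_bind, ← expect_mul_left]
        rw [expect_comm]
        -- A new point must avoid the guessed points too, because redrawing the value there could
        -- change whether the guesses miss.
        set K := T.map Prod.fst ++ G.map Prod.fst with hK
        have hKε : (expect (uniformBits n) fun r => ind (decide (Fin.append r m ∈ K))) ≤ ε := by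
          refine (expect_nonce_mem_le K m).trans (mul_le_mul_left ?_ _)
          have : K.length ≤ N + 1 := by simp [hK]; omega
          exact_mod_cast this
        rw [add_comm (_ * ε) ε, ← add_assoc, add_right_comm]
        refine le_trans ?_ (add_le_add le_rfl hKε)
        rw [← expect_const (uniformBits n) ((t : ℝ≥0∞) * ε), ← expect_add, ← expect_add]
        refine expect_mono fun r => ?_
        by_cases hr : Fin.append r m ∈ K
        · simp only [hr, decide_true]
          exact (expect_le fun g => hle.trans (ival_le fun h _ => hV h)).trans le_add_self
        · refine le_trans ?_ le_self_add
          have hrT : Fin.append r m ∉ T.map Prod.fst := fun h => hr (List.mem_append_left _ h)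
          have hrG : Fin.append r m ∉ G.map Prod.fst := fun h => hr (List.mem_append_right _ h)
          -- At a new point the function value is redrawn; it supplies the fresh coins and tag of
          -- `freshOracle`.
          rw [expect_function_update (Fin.append r m), ← expect_const (uniformBits (C.encCoins n + n))
            ((t : ℝ≥0∞) * ε), ← expect_add, uniformBits]
          refine expect_mono fun y => ?_
          have hm : ∀ g : C.Tags n, Misses G (Function.update g (Fin.append r m) y) ↔ Misses G g := by
            intro g
            refine forall₂_congr fun e he => ?_
            rw [Function.update_of_ne]
            rintro h
            exact hrG (List.mem_map.2 ⟨e, he, h⟩)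
          have ho : ∀ g : C.Tags n, override (T ++ [(Fin.append r m, y)]) g (Fin.append r m) = y := by
            intro g
            rw [← override_append hrT, override_of_notMem hrT, Function.update_self]
          simp only [hm, override_append hrT, ho]
          have := ih (T ++ [(Fin.append r m, y)]) G (by
              rw [List.map_append, List.map_singleton, ← List.concat_eq_append]
              exact List.Nodup.concat hrT hT)
            (fun e he => by
              rw [List.map_append, List.mem_append, not_or]
              refine ⟨hG e he, fun h => hrG ?_⟩
              rw [List.map_singleton, List.mem_singleton] at h
              exact List.mem_map.2 ⟨e, he, h⟩)
            (by simp; omega) (h ++ [Sum.inl (C.encodeWith n sk (Fin.append r m) y)])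
          rw [tableLog, List.map_append] at this
          exact this
      · simp only [functionOracle, freshOracle, sampleDecode, expect_map, ← expect_mul_left]
        rw [expect_comm, ← expect_const (uniformBits (C.decCoins n)) ((t : ℝ≥0∞) * ε + ε),
          ← expect_add]
        refine expect_mono fun w => ?_
        by_cases hM : ∀ M, C.decode n sk x w = some M → Msg.point M ∈ T.map Prod.fst
        · simp only [decodeWith_override_of_mem δ sk hT hM]
          refine (ih T G hT hG (by omega) _).trans ?_
          rw [← add_assoc]
          exact le_self_add
        -- The decoded point is not in the table, so the decoder rejects unless the tag is a correct
        -- guess. The correct guess is paid for with `2 ^ (-n)`; the failed one is added to `G`.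
        · push Not at hM
          obtain ⟨M, hd, hp⟩ := hM
          rw [hd, acceptLogged_of_notMem δ sk hp]
          have hih := ih T ((Msg.point M, Bits.right M) :: G) hT
            (by
              intro e he
              rcases List.mem_cons.1 he with rfl | he
              · exact hp
              · exact hG e he) (by simp; omega) (h ++ [Sum.inr none])
          have hε' : (2 ^ n : ℝ≥0∞)⁻¹ ≤ ε := by
            rw [hε, add_mul, one_mul]
            exact le_add_self
          rw [← add_assoc]
          refine le_trans ?_ (add_le_add hih hε')
          rw [← expect_tag_eq (C := C) (Msg.point M) (Bits.right M), ← expect_add]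
          refine expect_mono fun g => ?_
          by_cases hg : (g (Msg.point M)).right = Bits.right M
          · simp only [hg, decide_true]
            exact (hle.trans (ival_le fun h _ => hV h)).trans le_add_self
          · refine le_trans ?_ le_self_add
            have h1 : C.decodeWith δ n (override T g) sk x w = none := by
              rw [decodeWith, hd]
              refine if_neg fun h => hg ?_
              rw [override_of_notMem hp] at h
              exact h.1
            have h2 : Misses ((Msg.point M, Bits.right M) :: G) g ↔ Misses G g := by
              simp [Misses, hg]
            rw [h1]
            simp only [h2]
            exact le_rfl

theorem expect_functionOracle_le_freshOracle
    {next : List (C.IdealAnswer n) → Option (IdealQuery k n)}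
    {V : List (C.IdealAnswer n) → ℝ≥0∞} (hV : ∀ h, V h ≤ 1) (t : ℕ) :
    (expect (PMF.uniformOfFintype (C.Tags n)) fun f =>
      ival (Adversary.stateless (C.functionOracle δ n sk f)) next t () [] fun h _ => V h) ≤
      ival (C.freshOracle δ n sk) next t [] [] (fun h _ => V h) +
        t * ((t + 1) * (2 ^ n : ℝ≥0∞)⁻¹) := by
  classical
  have := expect_functionOracle_le δ sk (next := next) hV t t [] [] (by simp) (by simp) (by simp) []
  have e : ∀ g : C.Tags n, override [] g = g := fun g => rfl
  simpa [Misses, ind, e, tableLog] using this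

end Code

end PRC

namespace PRC

open BitEncoding (enc)
open scoped ENNReal

namespace Code

variable {k : ℕ → ℕ} {C : Code fun n => n + k n + n} (δ : ℝ) {n : ℕ} (sk : Bits (C.skLen n))

/-! ### Decoding from the log -/

theorem lookup_eq_of_close {L : C.Log n} {x : List Bool} (hc : conflict δ L x = false)
    {e : Msg k n × Bits (C.cwLen n)} (he : e ∈ L) (hx : Close δ e.2 x) :
    lookup δ L x = some (Msg.text e.1) := by
  rw [conflict, Option.isSome_eq_false_iff, Option.isNone_iff_eq_none, List.find?_eq_none] at hc
  by_contra h
  exact hc e he (by simpa using ⟨hx, fun h' => h h'.symm⟩)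

theorem lookup_eq_none {L : C.Log n} {x : List Bool} (h : ∀ e ∈ L, ¬Close δ e.2 x) :
    lookup δ L x = none := by
  rw [lookup, Option.map_eq_none_iff, List.find?_eq_none]
  simpa using h

theorem exists_of_conflict {L : C.Log n} {x : List Bool} (hc : conflict δ L x = true) :
    ∃ e ∈ L, ∃ e' ∈ L, Close δ e.2 x ∧ Close δ e'.2 x ∧ Msg.text e.1 ≠ Msg.text e'.1 := by
  classical
  rw [conflict, List.find?_isSome] at hc
  obtain ⟨e, he, h⟩ := hc
  obtain ⟨hx, hne⟩ : Close δ e.2 x ∧ some e.1.text ≠ lookup δ L x := by simpa using h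
  have hs : (L.find? fun e => decide (Close δ e.2 x)).isSome := by
    rw [List.find?_isSome]
    exact ⟨e, he, by simpa using hx⟩
  obtain ⟨e', h'⟩ := Option.isSome_iff_exists.1 hs
  refine ⟨e, he, e', List.mem_of_find?_eq_some h', hx, by simpa using List.find?_some h', fun h => hne ?_⟩
  rw [lookup, h', h]
  rfl

/-- `hM` is the event that robustness provides: decoding recovers every logged message with a close
codeword. If there is none, both sides are `⊥`, since acceptance also needs a close entry. -/
theorem acceptLogged_eq_lookup {L : C.Log n} {x : List Bool} (hc : conflict δ L x = false)
    {M : Option (Msg k n)} (hM : ∀ e ∈ L, Close δ e.2 x → M = some e.1) :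
    acceptLogged δ L x M = lookup δ L x := by
  classical
  by_cases h : ∃ e ∈ L, Close δ e.2 x
  · obtain ⟨e, he, hx⟩ := h
    rw [hM e he hx, lookup_eq_of_close δ hc he hx]
    exact if_pos ⟨e, he, rfl, hx⟩
  · push Not at h
    rw [lookup_eq_none δ h]
    cases M with
    | none => rfl
    | some M => exact if_neg fun ⟨e, he, _, hx⟩ => h e he hx

/-! ### The oracle without key -/

/-- Decoding queries are answered from the log of encodings; the flag records conflicts. -/
noncomputable def logOracle {T : Type} (O : T → Msg k n → PMF (Bits (C.cwLen n) × T)) :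
    T × (C.Log n × Bool) → IdealQuery k n → PMF (C.IdealAnswer n × (T × (C.Log n × Bool)))
  | s, Sum.inl m => (uniformBits n).bind fun r => (uniformBits n).bind fun R =>
      (O s.1 (mkMsg (Fin.append r m) R)).map fun a =>
        (Sum.inl a.1, (a.2, (s.2.1 ++ [(mkMsg (Fin.append r m) R, a.1)], s.2.2)))
  | s, Sum.inr x => (O s.1 fun _ => false).map fun a =>
      (Sum.inr (lookup δ s.2.1 x), (a.2, (s.2.1, s.2.2 || conflict δ s.2.1 x)))

/-- The probability that `x` is not decoded to the message of a close entry. -/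
noncomputable def loss (P : Set (Msg k n × Bits (C.cwLen n))) (x : List Bool) : ℝ≥0∞ :=
  open Classical in
  expect (C.sampleDecode n sk x) fun M =>
    ind (decide (∃ e ∈ P, Close δ e.2 x ∧ M ≠ some e.1))

theorem ind_mono {p q : Prop} [Decidable p] [Decidable q] (h : p → q) :
    ind (decide p) ≤ ind (decide q) := by
  by_cases hp : p
  · simp [hp, h hp]
  · simp [hp, ind]

theorem loss_mono {P P' : Set (Msg k n × Bits (C.cwLen n))} (h : P ⊆ P') (x : List Bool) :
    loss δ sk P x ≤ loss δ sk P' x := by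
  classical
  exact expect_mono fun _ => ind_mono fun ⟨e, he, h'⟩ => ⟨e, h he, h'⟩

/-- Two close entries carry different messages, so whatever the decoder returns is wrong for one of
them. -/
theorem loss_eq_one_of_conflict {L : C.Log n} {x : List Bool} (hc : conflict δ L x = true) :
    loss δ sk {e | e ∈ L} x = 1 := by
  classical
  obtain ⟨e, he, e', he', hx, hx', hne⟩ := exists_of_conflict δ hc
  rw [loss, ← expect_const (C.sampleDecode n sk x) 1]
  congr 1
  funext M
  have : ∃ e ∈ {e | e ∈ L}, Close δ e.2 x ∧ M ≠ some e.1 := by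
    by_cases hM : M = some e.1
    · refine ⟨e', he', hx', fun h => hne ?_⟩
      rw [hM, Option.some.injEq] at h
      rw [h]
    · exact ⟨e, he, hx, hM⟩
  simp only [this, decide_true, ind, if_true]

/-- The sum of the losses of all queries. -/
noncomputable def totalLoss {A : Type} (next : List A → Option (IdealQuery k n))
    (P : Set (Msg k n × Bits (C.cwLen n))) (h : List A) : ℝ≥0∞ :=
  ∑ j ∈ Finset.range h.length, loss δ sk P (queryString next (h.take j))

section

variable {A : Type} {next : List A → Option (IdealQuery k n)}

theorem totalLoss_mono {P P' : Set (Msg k n × Bits (C.cwLen n))} (hP : P ⊆ P') (h : List A) :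
    totalLoss δ sk next P h ≤ totalLoss δ sk next P' h :=
  Finset.sum_le_sum fun _ _ => loss_mono δ sk hP _

theorem totalLoss_concat (P : Set (Msg k n × Bits (C.cwLen n))) (h : List A) (a : A) :
    totalLoss δ sk next P (h ++ [a]) =
      totalLoss δ sk next P h + loss δ sk P (queryString next h) := by
  rw [totalLoss, List.length_append, List.length_singleton, Finset.sum_range_succ,
    List.take_left' rfl]
  congr 1
  refine Finset.sum_congr rfl fun j hj => ?_
  rw [List.take_append_of_le_length (Finset.mem_range.1 hj).le]

end

variable {next : List (C.IdealAnswer n) → Option (IdealQuery k n)}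

/-- The log and the list of queries only grow and losses are nonnegative, so losses already incurred
are not lost later. -/
theorem totalLoss_le_ival {T : Type} (O : T → Msg k n → PMF (Bits (C.cwLen n) × T)) (t : ℕ)
    (s : T × (C.Log n × Bool)) (h : List (C.IdealAnswer n)) :
    totalLoss δ sk next {e | e ∈ s.2.1} h ≤
      ival (logOracle δ O) next t s h fun h s => totalLoss δ sk next {e | e ∈ s.2.1} h := by
  induction t generalizing s h with
  | zero => rw [ival_zero]
  | succ t ih =>
    cases hq : next h with
    | none => rw [ival_succ_none hq]
    | some q =>
      rw [ival_succ_some hq, ← expect_const (logOracle δ O s q) (totalLoss δ sk next {e | e ∈ s.2.1} h)]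
      have key : ∀ (s' : T × (C.Log n × Bool)) a, s.2.1 ⊆ s'.2.1 →
          totalLoss δ sk next {e | e ∈ s.2.1} h ≤
          ival (logOracle δ O) next t s' (h ++ [a]) fun h s => totalLoss δ sk next {e | e ∈ s.2.1} h := by
        intro s' a hs
        refine le_trans ?_ (ih s' (h ++ [a]))
        rw [totalLoss_concat]
        exact (totalLoss_mono δ sk (fun e he => hs he) h).trans le_self_add
      rcases q with m | x
      · simp only [logOracle, expect_bind, expect_map]
        exact expect_mono fun r => expect_mono fun R => expect_mono fun a =>
          key _ _ (List.subset_append_left _ _)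
      · simp only [logOracle, expect_map]
        exact expect_mono fun a => key _ _ (List.Subset.refl _)

/-- A potential argument: the losses incurred so far are added to the left side, and each decoding
query pays with its own loss for replacing the decoder by the lookup. A flagged run contributes 0
through `V`, because its loss of 1 already covers any value of `V`. -/
theorem ival_freshOracle_le {V : List (C.IdealAnswer n) → ℝ≥0∞} (hV : ∀ h, V h ≤ 1) (t : ℕ)
    (L : C.Log n) (h : List (C.IdealAnswer n)) :
    ival (C.freshOracle δ n sk) next t L h (fun h _ => V h) +
      totalLoss δ sk next {e | e ∈ L} h ≤
    ival (logOracle δ (Adversary.stateless (C.sampleEncode n sk))) next t ((), (L, false)) h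
      fun h s => (if s.2.2 then 0 else V h) + totalLoss δ sk next {e | e ∈ s.2.1} h := by
  induction t generalizing L h with
  | zero => simp [ival_zero]
  | succ t ih =>
    cases hq : next h with
    | none => simp [ival_succ_none hq]
    | some q =>
      rw [ival_succ_some hq]
      rcases q with m | x
      · rw [ival_succ_some hq]
        simp only [freshOracle, logOracle, Adversary.stateless, expect_bind, expect_map,
          sampleEncode]
        rw [← expect_const (uniformBits n) (totalLoss δ sk next {e | e ∈ L} h), ← expect_add]
        refine expect_mono fun r => ?_
        rw [expect_uniformBits_add, expect_comm,
          ← expect_const (uniformBits n) (totalLoss δ sk next {e | e ∈ L} h), ← expect_add]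
        refine expect_mono fun R => ?_
        rw [← expect_const (uniformBits (C.encCoins n)) (totalLoss δ sk next {e | e ∈ L} h),
          ← expect_add]
        refine expect_mono fun R₁ => ?_
        simp only [encodeWith, Bits.right_append, Bits.left_append]
        refine le_trans (add_le_add le_rfl ?_) (ih _ _)
        -- An encoding query also contributes a term, the loss of the default string `[]`; it is
        -- nonnegative and can be dropped.
        rw [totalLoss_concat]
        exact (totalLoss_mono δ sk (fun e he => List.mem_append_left _ he) h).trans le_self_add
      · have hqs : queryString next h = x := by rw [queryString, hq]
        cases hc : conflict δ L x with
        | true =>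
          have hge := totalLoss_le_ival δ sk (next := next)
            (Adversary.stateless (C.sampleEncode n sk)) t ((), (L, true)) (h ++ [Sum.inr (lookup δ L x)])
          rw [totalLoss_concat, hqs, loss_eq_one_of_conflict δ sk hc, add_comm] at hge
          rw [ival_succ_some hq]
          simp only [logOracle, expect_map, hc, Bool.or_true]
          refine le_trans (add_le_add (expect_le fun a => ival_le fun h _ => hV h) le_rfl)
            (hge.trans (le_expect fun a => ?_))
          exact ival_mono_length fun h' s _ => le_add_self
        | false =>
          rw [ival_succ_some hq]
          simp only [freshOracle, logOracle, expect_map, hc, Bool.or_false]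
          have hih := ih L (h ++ [Sum.inr (lookup δ L x)])
          rw [totalLoss_concat, hqs] at hih
          refine le_trans ?_ (le_expect fun a => hih)
          rw [add_comm (totalLoss _ _ _ _ _), ← add_assoc]
          refine add_le_add ?_ le_rfl
          rw [loss, ← expect_const (C.sampleDecode n sk x)
            (ival (C.freshOracle δ n sk) next t L (h ++ [Sum.inr (lookup δ L x)]) fun h _ => V h),
            ← expect_add]
          refine expect_mono fun M => ?_
          -- If the decoder errs, the indicator in the loss pays for the whole value, which is at
          -- most 1; otherwise the answers coincide.
          by_cases hM : ∃ e ∈ {e | e ∈ L}, Close δ e.2 x ∧ M ≠ some e.1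
          · simp only [hM, decide_true]
            exact (ival_le fun h _ => hV h).trans (le_add_self (a := ind true))
          · push Not at hM
            rw [acceptLogged_eq_lookup δ hc hM]
            exact le_self_add

theorem ival_freshOracle_le_logOracle {V : List (C.IdealAnswer n) → ℝ≥0∞} (hV : ∀ h, V h ≤ 1)
    (t : ℕ) : ival (C.freshOracle δ n sk) next t [] [] (fun h _ => V h) ≤
    ival (logOracle δ (Adversary.stateless (C.sampleEncode n sk))) next t ((), ([], false)) []
      (fun h s => if s.2.2 then 0 else V h) +
    ival (logOracle δ (Adversary.stateless (C.sampleEncode n sk))) next t ((), ([], false)) []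
      fun h s => totalLoss δ sk next {e | e ∈ s.2.1} h := by
  rw [← ival_add]
  exact le_self_add.trans (ival_freshOracle_le δ sk hV t [] [])

/-! ### Comparison with the ideal game -/

/-- The flag is never cleared, so a run that has met a conflict ends with value 0. -/
theorem ival_logOracle_bad {T : Type} (O : T → Msg k n → PMF (Bits (C.cwLen n) × T))
    {V : List (C.IdealAnswer n) → ℝ≥0∞} (t : ℕ) (s : T) (L : C.Log n) (h : List (C.IdealAnswer n)) :
    ival (logOracle δ O) next t (s, (L, true)) h (fun h s => if s.2.2 then 0 else V h) = 0 := by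
  induction t generalizing s L h with
  | zero => simp [ival_zero]
  | succ t ih =>
    cases hq : next h with
    | none => simp [ival_succ_none hq]
    | some q =>
      rw [ival_succ_some hq]
      rcases q with m | x
      · simp only [logOracle, expect_bind, expect_map, ih, expect_const]
      · simp only [logOracle, expect_map, Bool.true_or, ih, expect_const]

end Code

end PRC

namespace PRC

open BitEncoding (enc)
open scoped ENNReal

namespace Code

variable {k : ℕ → ℕ} {C : Code fun n => n + k n + n} {δ : ℝ} {n : ℕ}

/-! ### The ideal game -/

/-- The transcript of the ideal game that belongs to a log. -/
def logTranscript (L : C.Log n) : Finset (Bits (k n) × Bits (C.cwLen n)) :=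
  (L.map fun e => (Msg.text e.1, e.2)).toFinset

theorem mem_candidates {k : ℕ → ℕ} {D : Code k} {n : ℕ} {T : D.Transcript n} {x : List Bool}
    {m : Bits (k n)} : m ∈ D.candidates δ T x ↔ ∃ c, (m, c) ∈ T ∧ Close δ c x := by
  simp [candidates]

theorem idealDecode_eq_pure {k : ℕ → ℕ} {D : Code k} {n : ℕ} {T : D.Transcript n} {x : List Bool}
    {o : Option (Bits (k n))} (h : ∀ m, m ∈ D.candidates δ T x ↔ o = some m) :
    D.idealDecode δ T x = PMF.pure o := by
  classical
  rw [idealDecode]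
  split_ifs with hne
  · obtain ⟨m, hm⟩ := id hne
    have ho := (h m).1 hm
    subst ho
    have hs : D.candidates δ T x = {m} :=
      Finset.eq_singleton_iff_unique_mem.2 ⟨hm, fun m' hm' => by
        have := (h m').1 hm'
        rw [Option.some.injEq] at this
        exact this.symm⟩
    have hu : PMF.uniformOfFinset (D.candidates δ T x) hne = PMF.pure m := by
      ext a
      rw [PMF.uniformOfFinset_apply, PMF.pure_apply, hs]
      simp
    rw [hu, PMF.pure_map]
  · cases o with
    | none => rfl
    | some m => exact absurd ⟨m, (h m).2 rfl⟩ hne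

theorem lookup_eq_some_iff {L : C.Log n} {x : List Bool} (hc : conflict δ L x = false)
    {m : Bits (k n)} : lookup δ L x = some m ↔ ∃ e ∈ L, Msg.text e.1 = m ∧ Close δ e.2 x := by
  constructor
  · intro h
    by_contra hne
    have : ∃ e ∈ L, Close δ e.2 x := by
      by_contra hn
      push Not at hn
      rw [lookup_eq_none δ hn] at h
      cases h
    obtain ⟨e, he, hx⟩ := this
    rw [lookup_eq_of_close δ hc he hx, Option.some.injEq] at h
    exact hne ⟨e, he, h, hx⟩
  · rintro ⟨e, he, rfl, hx⟩
    exact lookup_eq_of_close δ hc he hx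

/-- The oracle of the ideal game for the transformed code. -/
noncomputable def sharpIdealOracle
    (F : KeyedFunction (fun n => n + k n) fun n => C.encCoins n + n) (δ : ℝ) (n : ℕ)
    (T : Finset (Bits (k n) × Bits (C.cwLen n))) (q : IdealQuery k n) :
    PMF (C.IdealAnswer n × Finset (Bits (k n) × Bits (C.cwLen n))) :=
  (C.sharp F δ).idealOracle δ n T q

variable (F : KeyedFunction (fun n => n + k n) fun n => C.encCoins n + n)

open Classical in
theorem sharpIdealOracle_inl (T : Finset (Bits (k n) × Bits (C.cwLen n))) (m : Bits (k n)) :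
    sharpIdealOracle F δ n T (Sum.inl m) =
      (uniformBits (C.cwLen n)).map fun c => (Sum.inl c, insert (m, c) T) := rfl

/-- Without a conflict all close entries carry the same message, so the candidate set has at most
one element and the uniform choice is deterministic. -/
theorem sharpIdealOracle_inr {L : C.Log n} {x : List Bool} (hc : conflict δ L x = false) :
    sharpIdealOracle F δ n (logTranscript L) (Sum.inr x) =
      PMF.pure (Sum.inr (lookup δ L x), logTranscript L) := by
  have h : (C.sharp F δ).idealDecode δ (n := n) (logTranscript L) x = PMF.pure (lookup δ L x) := by
    refine idealDecode_eq_pure fun m => mem_candidates.trans ?_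
    refine Iff.trans (b := ∃ c : Bits (C.cwLen n), (m, c) ∈ logTranscript L ∧ Close δ c x) Iff.rfl ?_
    rw [lookup_eq_some_iff hc]
    simp only [logTranscript, List.mem_toFinset, List.mem_map, Prod.mk.injEq]
    constructor
    · rintro ⟨c, ⟨e, he, h1, rfl⟩, hx⟩
      exact ⟨e, he, h1, hx⟩
    · rintro ⟨e, he, h1, hx⟩
      exact ⟨_, ⟨e, he, h1, rfl⟩, hx⟩
  exact (congrArg (PMF.map _) h).trans (PMF.pure_map _ _)

/-- At a conflict the left side becomes 0, so the random choice of the ideal decoder never has to be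
analysed and the probability of conflicts among uniform codewords plays no role. -/
theorem ival_logOracle_le_idealOracle
    {next : List (C.IdealAnswer n) → Option (IdealQuery k n)}
    (V : List (C.IdealAnswer n) → ℝ≥0∞) (t : ℕ) (L : C.Log n) (h : List (C.IdealAnswer n)) :
    ival (logOracle δ (Adversary.stateless fun _ => uniformBits (C.cwLen n))) next t
      ((), (L, false)) h (fun h s => if s.2.2 then 0 else V h) ≤
    ival (sharpIdealOracle F δ n) next t (logTranscript L) h fun h _ => V h := by
  classical
  induction t generalizing L h with
  | zero => simp [ival_zero]
  | succ t ih =>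
    cases hq : next h with
    | none => simp [ival_succ_none hq]
    | some q =>
      rw [ival_succ_some hq, ival_succ_some hq]
      rcases q with m | x
      · simp only [logOracle, sharpIdealOracle_inl, expect_bind, expect_map]
        refine expect_le fun r => expect_le fun R => ?_
        rw [Adversary.stateless, expect_map]
        refine expect_mono fun c => ?_
        have e : logTranscript (L ++ [(mkMsg (Fin.append r m) R, c)]) =
            insert (m, c) (logTranscript L) := by
          have : Msg.text (mkMsg (Fin.append r m) R) = m := by
            rw [text_point, ← (mkMsg_eq_iff.1 rfl).1, Bits.right_append]
          ext a
          simp [logTranscript, this, eq_comm]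
        refine (ih _ _).trans_eq ?_
        rw [e]
      · cases hc : conflict δ L x with
        | true =>
          refine le_trans (le_of_eq ?_) (zero_le (a := _))
          simp only [logOracle, expect_map, hc, Bool.false_or, ival_logOracle_bad, expect_const]
        | false =>
          simp only [logOracle, expect_map, hc, Bool.false_or, sharpIdealOracle_inr F hc, expect_pure]
          exact expect_le fun a => ih _ _

/-! ### Runs of the adversaries of the reductions -/

/-- The decoder evaluates the function at one point only, so a single oracle answer suffices to
simulate it. -/
theorem decodeWith_const {f : C.Tags n} {sk : Bits (C.skLen n)} {x : List Bool}
    {w : Bits (C.decCoins n)} {p : Bits (n + k n)}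
    (h : ∀ M, C.decode n sk x w = some M → p = Msg.point M) :
    C.decodeWith δ n (fun _ => f p) sk x w = C.decodeWith δ n f sk x w := by
  rw [decodeWith, decodeWith]
  cases hd : C.decode n sk x w with
  | none => rfl
  | some M =>
    obtain rfl := h M hd
    rfl

theorem expect_functionSimulator {f : C.Tags n} {sk : Bits (C.skLen n)} {q : ℕ → ℕ}
    {next : List (C.IdealAnswer n) → Option (IdealQuery k n)}
    (V : List (C.IdealAnswer n) → ℝ≥0∞) (t : ℕ) :
    (expect (uniformList (t * (n + C.decCoins n))) fun l =>
      ival ((C.functionSimulator δ q).oracle (Adversary.stateless fun p => PMF.pure (f p))) next t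
        ((), (sk, l)) [] fun h _ => V h) =
    ival (Adversary.stateless (C.functionOracle δ n sk f)) next t () [] fun h _ => V h := by
  refine expect_tape (S := Unit) (fun _ l => ((), (sk, l))) _ ?_ (fun _ _ _ => rfl) t () []
  rintro ⟨⟩ (m | x) b φ
  · simp only [Simulator.oracle, functionSimulator, Adversary.stateless, expect_map, expect_pure,
      functionOracle, add_assoc, expect_uniformList_add, toBits_append]
    simp only [← List.drop_drop, drop_enc_append, expect_const]
  · simp only [Simulator.oracle, functionSimulator, Adversary.stateless, expect_map, expect_pure,
      functionOracle, add_assoc, expect_uniformList_add]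
    simp only [← List.drop_drop, drop_enc_append, toBits_append, expect_const]
    congr 1
    funext w
    rw [decodeWith_const]
    intro M hM
    rw [hM]

theorem expect_logSimulator {T : Type} (O : T → Msg k n → PMF (Bits (C.cwLen n) × T)) {q ℓ : ℕ → ℕ}
    {next : List (C.IdealAnswer n) → Option (IdealQuery k n)} (d : Bits (ℓ n))
    (V : List (C.IdealAnswer n) → T → Bool → Bits (ℓ n) → ℝ≥0∞) (t : ℕ) (s : T) :
    (expect (uniformList (t * (n + n))) fun l =>
      ival ((C.logSimulator δ q ℓ).oracle O) next t (s, ⟨[], false, d, l⟩) [] fun h s =>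
        V h s.1 s.2.bad s.2.digits) =
    ival (logOracle δ O) next t (s, ([], false)) [] fun h s => V h s.1 s.2.2 d := by
  refine expect_tape (S := T × (C.Log n × Bool)) (V := fun h s => V h s.1 s.2.2 d)
    (V' := fun h s => V h s.1 s.2.bad s.2.digits)
    (fun s l => ((s.1, ⟨s.2.1, s.2.2, d, l⟩) : T × C.LogState ℓ n)) _ ?_
    (fun _ _ _ => rfl) t (s, ([], false)) []
  rintro s (m | x) b φ
  · simp only [Simulator.oracle, logSimulator, expect_map, expect_bind, logOracle, add_assoc,
      expect_uniformList_add, tapeMsg, toBits_append]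
    simp only [← List.drop_drop, drop_enc_append, toBits_append]
    congr 1
    funext r
    congr 1
    funext R
    rw [expect_comm]
  · simp only [Simulator.oracle, logSimulator, expect_map, logOracle, add_assoc,
      expect_uniformList_add]
    simp only [← List.drop_drop, drop_enc_append, expect_const]
    rw [expect_comm]

variable (𝒜 : C.SharpAdversary)

theorem expect_functionAdversary (f : C.Tags n) :
    expect ((functionAdversary δ 𝒜).runWith n fun p => PMF.pure (f p)) ind =
      expect (C.sampleKey n) fun sk => expect (uniformBits (𝒜.coins n)) fun ω =>
        ival (Adversary.stateless (C.functionOracle δ n sk f)) (𝒜.next n ω) (𝒜.queries n) () []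
          fun h _ => ind (𝒜.output n ω h) := by
  rw [functionAdversary, Simulator.expect_adversary_runWith, expect_comm (C.sampleKey n)]
  congr 1
  funext ω
  rw [sampleKey, expect_map]
  simp only [← expect_functionSimulator (q := 𝒜.queries)]
  exact (expect_uniformBits_add (C.keyCoins n) _ _).trans (by
    simp only [functionSimulator, Bits.left_append, Bits.right_append, uniformList, expect_map])

theorem expect_encodingAdversary (E : Msg k n → PMF (Bits (C.cwLen n))) :
    expect ((encodingAdversary δ 𝒜).runWith n E) ind =
      expect (uniformBits (𝒜.coins n)) fun ω =>
        ival (logOracle δ (Adversary.stateless E)) (𝒜.next n ω) (𝒜.queries n) ((), ([], false)) []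
          fun h s => if s.2.2 then 0 else ind (𝒜.output n ω h) := by
  rw [encodingAdversary, Simulator.expect_adversary_runWith]
  congr 1
  funext ω
  rw [← expect_const (uniformBits (guessLen 𝒜 n)) (ival _ _ _ _ _ _)]
  refine (expect_uniformBits_add (guessLen 𝒜 n) _ _).trans ?_
  congr 1
  funext d
  rw [← expect_logSimulator (q := 𝒜.queries) (Adversary.stateless E) d
    (fun h _ b _ => if b then 0 else ind (𝒜.output n ω h)), uniformList, expect_map]
  congr 1
  funext v
  have e : ∀ b c : Bool, ind (b && !c) = if c then 0 else ind b := by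
    intro b c; cases b <;> cases c <;> rfl
  simp only [logSimulator, Bits.left_append, Bits.right_append, e]

/-- The encoding oracle of the robustness game. -/
noncomputable def transcriptOracle (sk : Bits (C.skLen n)) (T : C.Transcript n) (M : Msg k n) :
    PMF (Bits (C.cwLen n) × C.Transcript n) :=
  open Classical in (C.sampleEncode n sk M).map fun c => (c, insert (M, c) T)

theorem robustGame_apply_true : (C.robustGame δ (robustnessAdversary δ 𝒜) n) true =
    expect (C.sampleKey n) fun sk => expect (uniformBits (𝒜.coins n)) fun ω =>
      expect (uniformBits (guessLen 𝒜 n)) fun d =>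
        ival (logOracle δ (transcriptOracle sk)) (𝒜.next n ω) (𝒜.queries n) (∅, ([], false)) []
          fun h s => loss δ sk {e | e ∈ s.1}
            (queryString (𝒜.next n ω) (h.take (ofDigits (enc d)))) := by
  rw [apply_true_eq_expect, robustGame, expect_bind]
  congr 1
  funext sk
  rw [expect_bind, robustnessAdversary, Simulator.expect_adversary_run]
  congr 1
  funext ω
  refine (expect_uniformBits_add (guessLen 𝒜 n) _ _).trans ?_
  congr 1
  funext d
  rw [← expect_logSimulator (q := 𝒜.queries) (transcriptOracle sk) d
    (fun h T _ d => loss δ sk {e | e ∈ T} (queryString (𝒜.next n ω) (h.take (ofDigits (enc d))))),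
    uniformList, expect_map]
  congr 1
  funext v
  have e : ∀ (T : C.Transcript n) (x : List Bool),
      (expect ((C.sampleDecode n sk x).map fun m' =>
        open Classical in decide (∃ e ∈ T, Close δ e.2 x ∧ m' ≠ some e.1)) ind) =
      loss δ sk {e | e ∈ T} x := by
    intro T x
    rw [loss, expect_map]
    exact congrArg (expect _) (funext fun a => congrArg ind (decide_eq_decide.2 Iff.rfl))
  simp only [logSimulator, Bits.left_append, Bits.right_append]
  refine congrArg (ival _ _ _ _ _) ?_
  funext h s
  rw [← e]

/-- Every index below `N` has a digit string of length `ℓ`, hence is guessed with probability at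
least `2 ^ (-ℓ)`. Guesses beyond `N` only add nonnegative terms. -/
theorem sum_le_expect_guess {ℓ N : ℕ} (hN : N ≤ 2 ^ ℓ) (g : ℕ → ℝ≥0∞) :
    ∑ j ∈ Finset.range N, g j ≤
      2 ^ ℓ * expect (uniformBits ℓ) fun d => g (ofDigits (enc d)) := by
  classical
  have hex : ∀ j, ∃ d : Bits ℓ, j < N → ofDigits (enc d) = j := by
    intro j
    by_cases hj : j < N
    · obtain ⟨l, hl, hv⟩ := exists_ofDigits_eq ℓ j (hj.trans_le hN)
      subst hl
      refine ⟨fun i => l.get i, fun _ => ?_⟩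
      rw [enc_bits, List.ofFn_get, hv]
    · exact ⟨fun _ => false, fun h => absurd h hj⟩
  choose d hd using hex
  have hinj : Set.InjOn d (Finset.range N) := by
    intro i hi j hj h
    rw [← hd i (Finset.mem_range.1 hi), ← hd j (Finset.mem_range.1 hj), h]
  rw [uniformBits, expect_uniform]
  have hcard : (Fintype.card (Bits ℓ) : ℝ≥0∞) = 2 ^ ℓ := by simp
  rw [hcard, mul_left_comm, ENNReal.mul_inv_cancel (by simp) (by simp), mul_one]
  calc ∑ j ∈ Finset.range N, g j
      = ∑ j ∈ Finset.range N, g (ofDigits (enc (d j))) :=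
        Finset.sum_congr rfl fun j hj => by rw [hd j (Finset.mem_range.1 hj)]
    _ = ∑ d' ∈ (Finset.range N).image d, g (ofDigits (enc d')) := (Finset.sum_image (f := fun d' => g (ofDigits (enc d'))) hinj).symm
    _ ≤ _ := Finset.sum_le_sum_of_subset (Finset.subset_univ _)

theorem ival_sum_le_guess {Q A S : Type} {oracle : S → Q → PMF (A × S)} {next : List A → Option Q}
    {ℓ t : ℕ} (ht : t ≤ 2 ^ ℓ) {s : S} (g : ℕ → List A → S → ℝ≥0∞) :
    ival oracle next t s [] (fun h s => ∑ j ∈ Finset.range h.length, g j h s) ≤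
      2 ^ ℓ * expect (uniformBits ℓ) fun d =>
        ival oracle next t s [] fun h s => g (ofDigits (enc d)) h s := by
  have h1 : (expect (uniformBits ℓ) fun d =>
      ival oracle next t s [] fun h s => g (ofDigits (enc d)) h s) =
      ival oracle next t s [] fun h s =>
        expect (uniformBits ℓ) fun d => g (ofDigits (enc d)) h s := expect_comm _ _ _
  have h2 : (2 ^ ℓ * ival oracle next t s [] fun h s =>
        expect (uniformBits ℓ) fun d => g (ofDigits (enc d)) h s) =
      ival oracle next t s [] fun h s =>
        2 ^ ℓ * expect (uniformBits ℓ) fun d => g (ofDigits (enc d)) h s :=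
    (expect_mul_left _).symm
  rw [h1, h2]
  exact ival_mono_length fun h s hh =>
    sum_le_expect_guess (le_trans (by simpa using hh) ht) fun j => g j h s

/-- The transcript of the robustness game contains the whole log, and besides it the dummy encodings
made at decoding queries. As the loss is monotone in the set of entries, the inclusion is enough. -/
theorem expect_totalLoss_le (sk : Bits (C.skLen n))
    {next : List (C.IdealAnswer n) → Option (IdealQuery k n)} {ℓ t : ℕ} (ht : t ≤ 2 ^ ℓ) :
    ival (logOracle δ (Adversary.stateless (C.sampleEncode n sk))) next t ((), ([], false)) []
      (fun h s => totalLoss δ sk next {e | e ∈ s.2.1} h) ≤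
    2 ^ ℓ * expect (uniformBits ℓ) fun d =>
      ival (logOracle δ (transcriptOracle sk)) next t (∅, ([], false)) []
        fun h s => loss δ sk {e | e ∈ s.1} (queryString next (h.take (ofDigits (enc d)))) := by
  classical
  have h1 : ival (logOracle δ (Adversary.stateless (C.sampleEncode n sk))) next t
      ((), ([], false)) [] (fun h s => totalLoss δ sk next {e | e ∈ s.2.1} h) ≤
      ival (logOracle δ (transcriptOracle sk)) next t (∅, ([], false)) []
        fun h s => totalLoss δ sk next {e | e ∈ s.1} h := by
    refine ival_le_ival (fun s s' => s.2 = s'.2 ∧ ∀ e ∈ s.2.1, e ∈ s'.1) ?_ ?_ ⟨rfl, by simp⟩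
    · rintro ⟨u, p⟩ ⟨T, p'⟩ q φ φ' ⟨h1, h2⟩ hφ
      obtain rfl : p = p' := h1
      rcases q with m | x
      · simp only [logOracle, expect_bind, expect_map, Adversary.stateless, transcriptOracle]
        refine expect_mono fun r => expect_mono fun R => expect_mono fun c => hφ _ _ _ ⟨rfl, ?_⟩
        intro e he
        rcases List.mem_append.1 he with he | he
        · exact Finset.mem_insert_of_mem (h2 e he)
        · rw [List.mem_singleton] at he
          subst he
          exact Finset.mem_insert_self _ _
      · simp only [logOracle, expect_map, Adversary.stateless, transcriptOracle]
        exact expect_mono fun c => hφ _ _ _ ⟨rfl, fun e he => Finset.mem_insert_of_mem (h2 e he)⟩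
    · rintro h s s' ⟨-, h2⟩
      exact totalLoss_mono δ sk h2 h
  refine h1.trans ?_
  simp only [totalLoss]
  exact ival_sum_le_guess (S := C.Transcript n × (C.Log n × Bool)) ht
    fun j h s => loss δ sk {e | e ∈ s.1} (queryString next (h.take j))

end Code

end PRC

namespace PRC

open BitEncoding (enc)
open scoped ENNReal

theorem eq_of_expect {α : Type} {p q : PMF α} (h : ∀ f, expect p f = expect q f) : p = q := by
  classical
  ext a
  simpa [expect] using h fun b => if b = a then 1 else 0

namespace Code

variable {k : ℕ → ℕ} {C : Code fun n => n + k n + n} {δ : ℝ} {n : ℕ}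
  {F : KeyedFunction (fun n => n + k n) fun n => C.encCoins n + n}

/-! ### The games as expectations -/

theorem sharp_real_oracle (K : Bits (F.keyLen n)) (sk : Bits (C.skLen n)) (q : IdealQuery k n) :
    (match q with
      | Sum.inl m => ((C.sharp F δ).sampleEncode n (Fin.append K sk) m).map Sum.inl
      | Sum.inr x => ((C.sharp F δ).sampleDecode n (Fin.append K sk) x).map Sum.inr) =
      C.functionOracle δ n sk (F.eval n K) q := by
  rcases q with m | x
  · refine (PMF.map_comp _ _ _).trans ?_
    refine congrArg (fun f => PMF.map f _) (funext fun r => ?_)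
    refine congrArg Sum.inl ((sharp_encode F n _ m r).trans ?_)
    rw [Bits.left_append, Bits.right_append]
  · refine (PMF.map_comp _ _ _).trans ?_
    refine congrArg (fun f => PMF.map f _) (funext fun w => ?_)
    refine congrArg Sum.inr ((sharp_decode F n _ x w).trans ?_)
    rw [Bits.left_append, Bits.right_append]

theorem sharp_sampleKey : (C.sharp F δ).sampleKey n =
    (uniformBits (F.keyCoins n)).bind fun u => (C.sampleKey n).map fun sk =>
      (Fin.append (F.keyGen n u) sk : Bits (F.keyLen n + C.skLen n)) := by
  refine eq_of_expect fun f => ?_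
  refine ((expect_map _ _ _).trans (expect_uniformBits_add (F.keyCoins n) (C.keyCoins n) _)).trans
    (Eq.trans ?_ (expect_bind _ _ _).symm)
  simp only [sampleKey]
  refine congrArg (expect _) (funext fun u =>
    Eq.trans ?_ ((expect_map _ _ _).trans (expect_map _ _ _)).symm)
  refine congrArg (expect _) (funext fun v => congrArg f ?_)
  change Fin.append (F.keyGen n (Bits.left (Fin.append u v))) (C.keyGen n (Bits.right (Fin.append u v)))
    = _
  rw [Bits.left_append, Bits.right_append]

theorem sharp_realGame (𝒜 : C.SharpAdversary) : (C.sharp F δ).realGame 𝒜 n =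
    (uniformBits (F.keyCoins n)).bind fun u => (C.sampleKey n).bind fun sk =>
      𝒜.runWith n (C.functionOracle δ n sk (F.eval n (F.keyGen n u))) := by
  refine (congrArg (fun p => PMF.bind p _) sharp_sampleKey).trans ?_
  refine (PMF.bind_bind _ _ _).trans (congrArg (PMF.bind _) (funext fun u => ?_))
  refine (PMF.bind_map _ _ _).trans (congrArg (PMF.bind _) (funext fun sk => ?_))
  exact congrArg (Adversary.runWith 𝒜 n) (funext fun q => sharp_real_oracle _ _ q)

/-- The outcome of the game for the transformed code with an arbitrary function. -/
theorem functionAdversary_game (𝒜 : C.SharpAdversary) (f : C.Tags n) :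
    ((functionAdversary δ 𝒜).runWith n fun p => PMF.pure (f p)) true =
      ((C.sampleKey n).bind fun sk => 𝒜.runWith n (C.functionOracle δ n sk f)) true := by
  rw [apply_true_eq_expect, apply_true_eq_expect, expect_functionAdversary, expect_bind]
  simp only [Adversary.expect_runWith]

theorem realExp_functionAdversary (𝒜 : C.SharpAdversary) :
    F.realExp (functionAdversary δ 𝒜) n true = (C.sharp F δ).realGame 𝒜 n true := by
  rw [sharp_realGame, KeyedFunction.realExp, PMF.bind_apply, PMF.bind_apply]
  simp only [functionAdversary_game]

theorem idealGame_eq_expect (𝒜 : C.SharpAdversary) : (C.sharp F δ).idealGame δ 𝒜 n true =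
    expect (uniformBits (𝒜.coins n)) fun ω =>
      ival (sharpIdealOracle F δ n) (𝒜.next n ω) (𝒜.queries n) ∅ [] fun h _ =>
        ind (𝒜.output n ω h) := by
  refine (apply_true_eq_expect _).trans ((expect_map _ _ _).trans ?_)
  exact Adversary.expect_run 𝒜 n (sharpIdealOracle F δ n) ∅ _

theorem encodingAdversary_le_idealGame (𝒜 : C.SharpAdversary) :
    ((encodingAdversary δ 𝒜).runWith n fun _ => uniformBits (C.cwLen n)) true ≤
      (C.sharp F δ).idealGame δ 𝒜 n true := by
  rw [idealGame_eq_expect, apply_true_eq_expect, expect_encodingAdversary]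
  exact expect_mono fun ω => ival_logOracle_le_idealOracle F _ _ [] []

/-- The hops that need no computational assumption: from a random function to the lookup game with
genuine encodings. The terms on the right are the lookup game, the guessed robustness game and the
statistical error of lazy sampling. -/
theorem randomExp_functionAdversary_le (𝒜 : C.SharpAdversary) :
    KeyedFunction.randomExp (functionAdversary δ 𝒜) n true ≤
      ((C.sampleKey n).bind fun sk =>
        (encodingAdversary δ 𝒜).runWith n (C.sampleEncode n sk)) true +
      2 ^ guessLen 𝒜 n * C.robustGame δ (robustnessAdversary δ 𝒜) n true +
      𝒜.queries n * ((𝒜.queries n + 1) * (2 ^ n : ℝ≥0∞)⁻¹) := by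
  rw [robustGame_apply_true, ← expect_mul_left, apply_true_eq_expect, apply_true_eq_expect,
    KeyedFunction.randomExp, expect_bind, expect_bind]
  simp only [expect_functionAdversary, expect_encodingAdversary]
  rw [expect_comm, ← expect_add,
    ← expect_const (C.sampleKey n) (𝒜.queries n * ((𝒜.queries n + 1) * (2 ^ n : ℝ≥0∞)⁻¹)),
    ← expect_add]
  refine expect_mono fun sk => ?_
  rw [expect_comm, ← expect_mul_left, ← expect_add,
    ← expect_const (uniformBits (𝒜.coins n)) (𝒜.queries n * ((𝒜.queries n + 1) * (2 ^ n : ℝ≥0∞)⁻¹)),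
    ← expect_add]
  refine expect_mono fun ω => ?_
  refine (expect_functionOracle_le_freshOracle δ sk (fun h => ind_le_one _) _).trans
    (add_le_add ?_ le_rfl)
  refine (ival_freshOracle_le_logOracle δ sk (fun h => ind_le_one _) _).trans (add_le_add le_rfl ?_)
  exact expect_totalLoss_le sk (lt_two_pow_logBound _).le

end Code

end PRC

namespace PRC

open BitEncoding (enc)
open scoped ENNReal

/-! ### Negligible functions -/

theorem Negligible.mono {f g : ℕ → ℝ} (hf : Negligible f) (h : ∀ n, |g n| ≤ |f n|) :
    Negligible g :=
  hf.trans_abs_le h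

theorem Negligible.mul_natCast {f : ℕ → ℝ} (hf : Negligible f) {q : ℕ → ℕ} {P : Polynomial ℕ}
    (hq : ∀ n, q n ≤ P.eval n) : Negligible fun n => q n * f n := by
  refine Negligible.mono (hf.polynomial_mul (P.map (Nat.castRingHom ℝ))) fun n => ?_
  rw [abs_mul, abs_mul]
  refine mul_le_mul_of_nonneg_right ?_ (abs_nonneg _)
  have : (P.map (Nat.castRingHom ℝ)).eval (n : ℝ) = ((P.eval n : ℕ) : ℝ) :=
    Polynomial.eval_natCast_map _ _ _
  rw [this, Nat.abs_cast, Nat.abs_cast]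
  exact_mod_cast hq n

theorem negligible_inv_two_pow : Negligible fun n => ((2 : ℝ) ^ n)⁻¹ := by
  intro c
  simpa only [div_eq_mul_inv] using tendsto_pow_const_div_const_pow_of_one_lt c one_lt_two

theorem PolyLen.exists_polynomial {ℓ : ℕ → ℕ} (h : PolyLen ℓ) :
    ∃ P : Polynomial ℕ, ∀ n, ℓ n ≤ P.eval n := by
  obtain ⟨P, hP⟩ := (h.fp (n := fun n : ℕ => n) (FP.id (x := fun n => unary n))).length
  exact ⟨P, fun n => by simpa only [length_unary] using hP n⟩

/-! ### Probabilities -/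

theorem PMF.apply_ne_top (p : PMF Bool) : p true ≠ ∞ := p.apply_ne_top true

theorem prob_le_one (p : PMF Bool) : prob p ≤ 1 :=
  ENNReal.toReal_le_of_le_ofReal zero_le_one (by simpa using p.coe_le_one true)

theorem prob_nonneg (p : PMF Bool) : 0 ≤ prob p := ENNReal.toReal_nonneg

theorem prob_map_not (p : PMF Bool) : prob (p.map not) = 1 - prob p := by
  have h1 : (p.map not) true = p false := by
    rw [apply_true_eq_expect, expect_map]
    simp [expect, ind, tsum_fintype]
  have h2 : p true + p false = 1 := by simpa [tsum_fintype] using p.tsum_coe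
  rw [prob, prob, h1, eq_sub_iff_add_eq, add_comm,
    ← ENNReal.toReal_add (p.apply_ne_top _) (p.apply_ne_top _), h2, ENNReal.toReal_one]

theorem Adversary.run_negate {Q A : ℕ → Type} (𝒜 : Adversary Q A fun _ => Bool) (n : ℕ) {S : Type}
    (oracle : S → Q n → PMF (A n × S)) (s₀ : S) :
    𝒜.negate.run n oracle s₀ = (𝒜.run n oracle s₀).map fun p => (!p.1, p.2) := by
  simp only [Adversary.run, PMF.map_bind, PMF.map_comp]
  rfl

theorem Adversary.runWith_negate {Q A : ℕ → Type} (𝒜 : Adversary Q A fun _ => Bool) (n : ℕ)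
    (oracle : Q n → PMF (A n)) : 𝒜.negate.runWith n oracle = (𝒜.runWith n oracle).map not := by
  simp only [Adversary.runWith, Adversary.run_negate, PMF.map_comp]
  rfl

namespace Code

variable {k : ℕ → ℕ}

/-! ### Encoding queries only -/

section EncDistinguisher

variable {D : Code k}

theorem realGame_negate (𝒜 : D.IdealAdversary) (n : ℕ) :
    D.realGame 𝒜.negate n = (D.realGame 𝒜 n).map not := by
  rw [realGame, realGame, PMF.map_bind]
  simp only [Adversary.runWith_negate]

theorem idealGame_negate (δ : ℝ) (𝒜 : D.IdealAdversary) (n : ℕ) :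
    D.idealGame δ 𝒜.negate n = (D.idealGame δ 𝒜 n).map not := by
  rw [idealGame, idealGame, Adversary.run_negate, PMF.map_comp, PMF.map_comp]
  rfl

/-- The oracle state may change with each answer, but answers to encoding queries do not depend on
it; without decoding queries it can be forgotten. -/
theorem ival_inl {Q Q' A A' S : Type} {O : S → Q ⊕ Q' → PMF ((A ⊕ A') × S)} {E : Q → PMF A}
    (hO : ∀ s q, ∃ f : A → S, O s (Sum.inl q) = (E q).map fun a => (Sum.inl a, f a))
    (next : List A → Option Q) (V : List A → ℝ≥0∞) (t : ℕ) (s : S) (h : List (A ⊕ A')) :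
    ival O (fun h => (next (h.filterMap Sum.getLeft?)).map Sum.inl) t s h
      (fun h _ => V (h.filterMap Sum.getLeft?)) =
    ival (Adversary.stateless E) next t () (h.filterMap Sum.getLeft?) fun h _ => V h := by
  induction t generalizing s h with
  | zero => rw [ival_zero, ival_zero]
  | succ t ih =>
    cases hq : next (h.filterMap Sum.getLeft?) with
    | none => rw [ival_succ_none hq, ival_succ_none (by rw [hq]; rfl)]
    | some q =>
      obtain ⟨f, hf⟩ := hO s q
      rw [ival_succ_some hq, ival_succ_some (by rw [hq]; rfl), hf, Adversary.stateless,
        expect_map, expect_map]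
      congr 1
      funext a
      rw [ih, List.filterMap_append]
      rfl

theorem realGame_ideal (𝒟 : D.EncDistinguisher) (n : ℕ) : D.realGame 𝒟.ideal n true =
    ((D.sampleKey n).bind fun sk => 𝒟.runWith n (D.sampleEncode n sk)) true := by
  rw [realGame, PMF.bind_apply, PMF.bind_apply]
  congr 1
  funext sk
  congr 1
  rw [apply_true_eq_expect, apply_true_eq_expect, Adversary.expect_runWith,
    Adversary.expect_runWith]
  refine congrArg (expect _) (funext fun ω => ?_)
  exact ival_inl (fun s m => ⟨fun _ => (), PMF.map_comp _ _ _⟩) (𝒟.next n ω)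
    (fun h => ind (𝒟.output n ω h)) _ _ []

theorem idealGame_ideal (δ : ℝ) (𝒟 : D.EncDistinguisher) (n : ℕ) :
    D.idealGame δ 𝒟.ideal n true = (𝒟.runWith n fun _ => uniformBits (D.cwLen n)) true := by
  classical
  rw [idealGame, apply_true_eq_expect, apply_true_eq_expect, expect_map, Adversary.expect_run,
    Adversary.expect_runWith]
  refine congrArg (expect _) (funext fun ω => ?_)
  exact ival_inl (fun s m => ⟨fun c => insert (m, c) s, rfl⟩) (𝒟.next n ω)
    (fun h => ind (𝒟.output n ω h)) _ _ []

theorem IdealSecure.pseudorandom {δ : ℝ} (h : D.IdealSecure δ) : D.Pseudorandom := by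
  intro 𝒟 h𝒟
  have := h 𝒟.ideal (EncDistinguisher.ideal_efficient h𝒟)
  simpa only [prob, realGame_ideal, idealGame_ideal] using this

end EncDistinguisher

/-! ### Security of the transformed code -/

variable {C : Code fun n => n + k n + n} {F : KeyedFunction (fun n => n + k n) fun n => C.encCoins n + n}
  {δ : ℝ}

/-- Tag check and re-encoding only cause further rejections, for every function `f`; soundness
therefore needs no assumption on the function family. -/
theorem isNone_decodeWith {n : ℕ} (f : C.Tags n) (sk : Bits (C.skLen n)) (x : List Bool)
    (w : Bits (C.decCoins n)) :
    ind (C.decode n sk x w).isNone ≤ ind (C.decodeWith δ n f sk x w).isNone := by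
  rw [decodeWith]
  cases C.decode n sk x w with
  | none => rfl
  | some M => exact zero_le (a := _)

theorem sharp_sound_le (c : List Bool) (n : ℕ) :
    ((C.sampleKey n).bind fun sk => (C.sampleDecode n sk c).map Option.isNone) true ≤
      (((C.sharp F δ).sampleKey n).bind fun sk =>
        ((C.sharp F δ).sampleDecode n sk c).map Option.isNone) true := by
  rw [apply_true_eq_expect, apply_true_eq_expect, expect_bind]
  refine le_of_le_of_eq ?_ ((expect_bind _ _ _).trans
    ((congrArg (fun p => expect p _) sharp_sampleKey).trans (expect_bind _ _ _))).symm
  refine le_expect fun u => le_of_le_of_eq ?_ (expect_map _ _ _).symm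
  refine expect_mono fun sk => ?_
  rw [expect_map]
  refine le_of_eq_of_le (expect_map _ _ _)
    (le_of_le_of_eq ?_ ((expect_map _ _ _).trans (expect_map _ _ _)).symm)
  refine expect_mono fun w => (isNone_decodeWith (δ := δ) (F.eval n (F.keyGen n u)) _ _ _).trans_eq ?_
  refine congrArg (fun o => ind (Option.isNone o))
    (Eq.trans ?_ (sharp_decode (δ := δ) F n (Fin.append (F.keyGen n u) sk) c w).symm)
  rw [Bits.left_append, Bits.right_append]

theorem Sound.sharp (h : C.Sound) : (C.sharp F δ).Sound := by
  intro c
  refine Negligible.mono (h c) fun n => ?_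
  have h1 := ENNReal.toReal_mono (PMF.apply_ne_top _) (sharp_sound_le (F := F) (δ := δ) (c n) n)
  rw [abs_of_nonneg (sub_nonneg.2 (prob_le_one _)), abs_of_nonneg (sub_nonneg.2 (prob_le_one _))]
  exact sub_le_sub_left h1 1

/-- The distance of the games is bounded by the advantages in the reductions. -/
noncomputable def sharpBound (F : KeyedFunction (fun n => n + k n) fun n => C.encCoins n + n)
    (δ : ℝ) (𝒜 : C.SharpAdversary) (n : ℕ) : ℝ :=
  |prob (F.realExp (functionAdversary δ 𝒜) n) -
    prob (KeyedFunction.randomExp (functionAdversary δ 𝒜) n)| +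
  |prob ((C.sampleKey n).bind fun sk =>
      (encodingAdversary δ 𝒜).runWith n (C.sampleEncode n sk)) -
    prob ((encodingAdversary δ 𝒜).runWith n fun _ => uniformBits (C.cwLen n))| +
  ((2 ^ guessLen 𝒜 n : ℕ) : ℝ) * prob (C.robustGame δ (robustnessAdversary δ 𝒜) n) +
  ((𝒜.queries n * (𝒜.queries n + 1) : ℕ) : ℝ) * ((2 : ℝ) ^ n)⁻¹

theorem negligible_sharpBound (hδ : PolyLen fun n => ⌊δ * (C.cwLen n : ℝ)⌋₊) (hC : C.IsPRC)
    (hrob : C.AdaptivelyRobust δ) (hF : F.IsPRF) {𝒜 : C.SharpAdversary} (h : 𝒜.Efficient) :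
    Negligible (sharpBound F δ 𝒜) := by
  obtain ⟨P, hP⟩ := h.queries.exists_polynomial
  refine (((hF.pseudorandom _ (functionAdversary_efficient hC.efficient hδ h)).add
    (hC.pseudorandom _ (encodingAdversary_efficient hC.efficient hδ h))).add
    -- The factor `2 ^ guessLen` is at most twice the number of queries plus one, and the number of
    -- queries is bounded by `P`.
    ((hrob _ (robustnessAdversary_efficient hC.efficient hδ h)).mul_natCast
      (P := Polynomial.C 2 * P + Polynomial.C 1) fun n => ?_)).add
    (negligible_inv_two_pow.mul_natCast (P := P * (P + Polynomial.C 1)) fun n => ?_)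
  · have := two_pow_logBound_le (𝒜.queries n) (𝒜.queries n)
    have := hP n
    simp only [guessLen, Polynomial.eval_add, Polynomial.eval_mul, Polynomial.eval_C]
    omega
  · simp only [Polynomial.eval_add, Polynomial.eval_mul, Polynomial.eval_C]
    exact Nat.mul_le_mul (hP n) (Nat.add_le_add_right (hP n) 1)

theorem prob_realGame_le (𝒜 : C.SharpAdversary) (n : ℕ) :
    prob ((C.sharp F δ).realGame 𝒜 n) ≤
      prob ((C.sharp F δ).idealGame δ 𝒜 n) + sharpBound F δ 𝒜 n := by
  have h1 : prob ((C.sharp F δ).realGame 𝒜 n) = prob (F.realExp (functionAdversary δ 𝒜) n) := by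
    rw [prob, prob, realExp_functionAdversary]
  have h2 := ENNReal.toReal_mono (PMF.apply_ne_top _)
    (encodingAdversary_le_idealGame (F := F) (δ := δ) (n := n) 𝒜)
  have hq : (𝒜.queries n * ((𝒜.queries n + 1) * (2 ^ n : ℝ≥0∞)⁻¹)) ≠ ∞ :=
    ENNReal.mul_ne_top (by simp) (ENNReal.mul_ne_top (by simp) (by simp))
  have hg : 2 ^ guessLen 𝒜 n * C.robustGame δ (robustnessAdversary δ 𝒜) n true ≠ ∞ :=
    ENNReal.mul_ne_top (by simp) (PMF.apply_ne_top _)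
  have hs := ENNReal.add_ne_top.2 ⟨PMF.apply_ne_top ((C.sampleKey n).bind fun sk =>
    (encodingAdversary δ 𝒜).runWith n (C.sampleEncode n sk)), hg⟩
  have h3 := ENNReal.toReal_mono (ENNReal.add_ne_top.2 ⟨hs, hq⟩)
    (randomExp_functionAdversary_le (δ := δ) (n := n) 𝒜)
  rw [ENNReal.toReal_add hs hq, ENNReal.toReal_add (PMF.apply_ne_top _) hg, ENNReal.toReal_mul,
    ENNReal.toReal_mul, ENNReal.toReal_mul, ENNReal.toReal_inv, ENNReal.toReal_pow,
    ENNReal.toReal_pow, ENNReal.toReal_ofNat, ENNReal.toReal_natCast,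
    ENNReal.toReal_add (by simp) (by simp), ENNReal.toReal_natCast, ENNReal.toReal_one] at h3
  change prob _ ≤ prob _ + _ * prob _ + _ at h3
  change prob _ ≤ prob _ at h2
  have h4 := le_abs_self (prob (F.realExp (functionAdversary δ 𝒜) n) -
    prob (KeyedFunction.randomExp (functionAdversary δ 𝒜) n))
  have h5 := le_abs_self (prob ((C.sampleKey n).bind fun sk =>
      (encodingAdversary δ 𝒜).runWith n (C.sampleEncode n sk)) -
    prob ((encodingAdversary δ 𝒜).runWith n fun _ => uniformBits (C.cwLen n)))
  rw [h1, sharpBound]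
  push_cast
  rw [mul_assoc (𝒜.queries n : ℝ)]
  linarith

theorem sharpBound_nonneg (𝒜 : C.SharpAdversary) (n : ℕ) : 0 ≤ sharpBound F δ 𝒜 n :=
  add_nonneg (add_nonneg (add_nonneg (abs_nonneg _) (abs_nonneg _))
    (mul_nonneg (Nat.cast_nonneg _) (prob_nonneg _))) (by positivity)

theorem sharp_idealSecure (hδ : PolyLen fun n => ⌊δ * (C.cwLen n : ℝ)⌋₊) (hC : C.IsPRC)
    (hrob : C.AdaptivelyRobust δ) (hF : F.IsPRF) : (C.sharp F δ).IdealSecure δ := by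
  intro 𝒜 h
  have h' : Adversary.Efficient (Q := IdealQuery k) (A := C.IdealAnswer) 𝒜 := h
  -- The one-sided bound for the adversary with complemented output is the missing inequality, as
  -- both probabilities turn into their complements.
  refine Negligible.mono ((negligible_sharpBound hδ hC hrob hF h').add
    (negligible_sharpBound hδ hC hrob hF h'.negate)) fun n => ?_
  have h1 := prob_realGame_le (F := F) (δ := δ) 𝒜 n
  have h2 : prob ((C.sharp F δ).realGame 𝒜.negate n) ≤
    prob ((C.sharp F δ).idealGame δ 𝒜.negate n) + sharpBound F δ (Adversary.negate 𝒜) n := prob_realGame_le (F := F) (δ := δ) _ n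
  rw [realGame_negate, idealGame_negate, prob_map_not, prob_map_not] at h2
  rw [abs_abs]
  have h3 := sharpBound_nonneg (F := F) (δ := δ) 𝒜 n
  have h4 := sharpBound_nonneg (F := F) (δ := δ) (Adversary.negate 𝒜) n
  refine le_trans (abs_le.2 ⟨?_, ?_⟩) (le_abs_self _)
  · simp only [Pi.add_apply]
    linarith
  · simp only [Pi.add_apply]
    linarith

end Code

end PRC

theorem mainTheorem6 (k : ℕ → ℕ) (C : PRC.Code fun n => n + k n + n)
    (F : PRC.KeyedFunction (fun n => n + k n) (fun n => C.encCoins n + n)) (δ : ℝ)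
    (hδ : PRC.PolyLen fun n => ⌊δ * (C.cwLen n : ℝ)⌋₊)
    (hC : C.IsPRC) (hrob : C.AdaptivelyRobust δ) (hF : F.IsPRF) :
    (C.sharp F δ).IsPRC ∧ (C.sharp F δ).IdealSecure δ := by
  have h := PRC.Code.sharp_idealSecure hδ hC hrob hF
  exact ⟨⟨PRC.Code.sharp_efficient hδ hC.efficient hF.efficient, hC.sound.sharp, h.pseudorandom⟩, h⟩
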